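/- Let $\lambda=(\lambda_1,\lambda_2,\lambda_3)\in\mathbb R^3$, $0<\varepsilon<\frac12$, $0<\varkappa<\frac12$, and $\gamma=\lambda+i\varepsilon(1,-1,0)$, so $\gamma_1=\lambda_1+i\varepsilon$, $\gamma_2=\lambda_2-i\varepsilon$, $\gamma_3=\lambda_3$. Write $\tau=(\tau_{11},\tau_{21},\tau_{22})$, $s=(s_{11},s_{21},s_{22})$ and $\rho(x)=x_1-x_3$. **Gelfand–Tsetlin realization.** Put $$\widetilde E_{11}=-i\tau_{11},\quad \widetilde E_{22}=-i(\tau_{21}+\tau_{22})+i\tau_{11},\quad \widetilde E_{33}=-i(\gamma_1+\gamma_2+\gamma_3)+i(\tau_{21}+\tau_{22}),$$ $$\widetilde E_{12}=-i\prod_{j=1}^2\big(i(\tau_{11}-\tau_{2j})+\tfrac12\big)e^{-i\partial_{\tau_{11}}},\qquad \widetilde E_{21}=-i\,e^{i\partial_{\tau_{11}}},$$ $$\widetilde E_{23}=\prod_{k=1}^3\big(i(\tau_{21}-\gamma_k)+\tfrac12\big)e^{-i\partial_{\tau_{21}}}+\frac{\prod_{k=1}^3\big(i(\tau_{22}-\gamma_k)+\frac12\big)}{i(\tau_{22}-\tau_{21})[i(\tau_{21}-\tau_{22})-1]}e^{-i\partial_{\tau_{22}}},$$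 $$\widetilde E_{32}=\frac{i(\tau_{11}-\tau_{21})+\frac12}{i(\tau_{21}-\tau_{22})[i(\tau_{21}-\tau_{22})-1]}e^{i\partial_{\tau_{21}}}-\big(i(\tau_{11}-\tau_{22})+\tfrac12\big)e^{i\partial_{\tau_{22}}},$$ $\widetilde E_{13}=[\widetilde E_{12},\widetilde E_{23}]$, $\widetilde E_{31}=[\widetilde E_{32},\widetilde E_{21}]$, and let $\mathfrak E_{jk}$ be $\widetilde E_{jk}$ with $\tau_{11}$ replaced by $\tau_{11}-i\varkappa$ in its coefficients. Let $$\psi_L=e^{-\frac\pi2(\tau_{11}+\tau_{21}+\tau_{22})},\qquad \psi_R=e^{\frac\pi2(\tau_{11}-\tau_{21}-\tau_{22})}\prod_{j=1}^2\Gamma\big(i(\tau_{2j}-\tau_{11})+\tfrac12\big)\prod_{k=1}^3\prod_{j=1}^2\Gamma\big(i(\gamma_k-\tau_{2j})+\tfrac12\big),$$ $$\mu=\frac{(2\pi)^{-3}e^{\pi(\tau_{21}+\tau_{22})}}{\Gamma(i\tau_{21}-i\tau_{22})\Gamma(i\tau_{22}-i\tau_{21})},\qquad \mu_1=\frac{(2\pi)^{-3/2}e^{\frac\pi2(\tau_{21}+\tau_{22})}}{\Gamma(i\tau_{21}-i\tau_{22})},\qquad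 \widetilde\psi_L=\mu_1\psi_L,\quad \widetilde\psi_R=\mu_1\psi_R,$$ $$M_{GT}(x)=e^{-\rho(x)}\,\frac1{2!}\int_{\mathbb R^3}\mu(\tau)\,\overline{\psi_L(\tau)}\,e^{-\sum_k x_k\widetilde E_{kk}}\psi_R(\tau)\,d\tau ,$$ $$\langle\psi_1,\psi_2\rangle_\varkappa=\frac1{2!}\int_{\mathbb R^3}\overline{\psi_1(\tau_{11}+i\varkappa,\tau_{21},\tau_{22})}\,\psi_2(\tau_{11}-i\varkappa,\tau_{21},\tau_{22})\,d\tau .$$ **Modified Gauss–Givental realization.** Put $$\hat{\mathcal E}_{11}=-i(\gamma_1+s_{11}+s_{21}),\quad \hat{\mathcal E}_{22}=i(-\gamma_2+s_{21}-s_{22}),\quad \hat{\mathcal E}_{33}=i(-\gamma_3+s_{11}+s_{22}),$$ $$\hat{\mathcal E}_{12}=(is_{21}+\tfrac12)e^{-i\partial_{s_{21}}},\qquad \hat{\mathcal E}_{32}=\big(i(\gamma_3-\gamma_2-s_{22})+\tfrac12\big)e^{i\partial_{s_{22}}},$$ $$\hat{\mathcal E}_{23}=(is_{11}+\tfrac12)e^{i\partial_{s_{21}}-i\partial_{s_{11}}}+\big(i(s_{11}-s_{21}+s_{22})+\tfrac12\big)e^{-i\partial_{s_{22}}},$$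 $$\hat{\mathcal E}_{21}=\big(i(\gamma_2-\gamma_1-s_{11})+\tfrac12\big)e^{i\partial_{s_{11}}-i\partial_{s_{22}}}+\big(i(\gamma_2-\gamma_1-s_{11}-s_{21}+s_{22})+\tfrac12\big)e^{i\partial_{s_{21}}},$$ $\hat{\mathcal E}_{13}=[\hat{\mathcal E}_{12},\hat{\mathcal E}_{23}]$, $\hat{\mathcal E}_{31}=[\hat{\mathcal E}_{32},\hat{\mathcal E}_{21}]$. Let $$\hat\phi_L=(2\pi)^{-3/2}\,\Gamma\big(i(\bar\gamma_1-\bar\gamma_2+s_{11})+\tfrac12\big)\Gamma\big(i(\bar\gamma_2-\bar\gamma_3+s_{22})+\tfrac12\big)\Gamma\big(i(\bar\gamma_1-\bar\gamma_3+s_{11}+s_{21})+1\big),$$ $$\hat\phi_R=(2\pi)^{-3/2}\,\Gamma(\tfrac12-is_{21})\Gamma(\tfrac12-is_{11})\Gamma(1-is_{11}-is_{22}),\qquad \langle\phi_1,\phi_2\rangle=\int_{\mathbb R^3}\overline{\phi_1}\,\phi_2\,ds,$$ $$M_{GG}(x)=e^{-\rho(x)}\langle\hat\phi_L,\,e^{-\sum_k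 x_k\hat{\mathcal E}_{kk}}\hat\phi_R\rangle .$$ **Integral operators.** The delta-function of complex argument evaluates the analytic continuation, $\int\delta(s-w)\varphi(s)\,ds=\varphi(w)$. Let $\mathcal B_R$, $\mathcal B_L$ be the operators with kernels $$B_R(\tau;s)=\frac{e^{\frac\pi2(\tau_{11}-i\varkappa)}}{2\pi\,\Gamma(i\tau_{21}-i\tau_{22})}\frac{\Gamma(i(\gamma_2-\gamma_1-s_{11})+\frac12)}{\Gamma(\frac12-is_{21})}\prod_{j=1}^2\Gamma\big(i(\tau_{11}-\tau_{2j}-s_{21})+\varkappa\big)\Gamma\big(i(\tau_{2j}-\tau_{11})-\varkappa+\tfrac12\big)\Gamma\big(i(\gamma_3-\tau_{2j})+\tfrac12\big)$$ $$\times\,\delta(\gamma_1+s_{11}+s_{21}-\tau_{11}+i\varkappa)\,\delta(\gamma_1+\gamma_2+s_{11}+s_{22}-\tau_{21}-\tau_{22}),$$ $$B_L(\tau;s)=\frac{e^{-\frac\pi2(\tau_{11}-i\varkappa)}}{2\pi\,\Gamma(i\tau_{21}-i\tau_{22})}\frac{\Gamma(is_{21}+\frac12)}{\Gamma(i(\bar\gamma_1-\bar\gamma_2+s_{11})+\frac12)}\prod_{j=1}^2\frac{\Gamma\big(i(\tau_{11}-\tau_{2j}-s_{21})+\varkappa\big)}{\Gamma\big(i(\tau_{11}-\tau_{2j})+\varkappa+\frac12\big)\Gamma\big(i(\tau_{2j}-\gamma_3)+\frac12\big)}$$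 $$\times\,\delta(\bar\gamma_1+s_{11}+s_{21}-\tau_{11}+i\varkappa)\,\delta(\bar\gamma_1+\bar\gamma_2+s_{11}+s_{22}-\tau_{21}-\tau_{22}),$$ where, after the delta-functions are integrated out, the remaining integration is over $s_{21}\in\mathbb R$ for $\mathcal B_R$ and over $s_{11}\in\mathbb R$ for $\mathcal B_L$. Let $\mathcal B_L^\dagger$ be the adjoint of $\mathcal B_L$ for the pairing $\langle\cdot,\cdot\rangle_\varkappa$, with kernel $$B_L^\dagger(s;\tau)=\frac{e^{-\frac\pi2(\tau_{11}-i\varkappa)}}{2!\,2\pi\,\Gamma(-i\tau_{21}+i\tau_{22})}\frac{\Gamma(\frac12-is_{21})}{\Gamma(-i(\gamma_1-\gamma_2+s_{11})+\frac12)}\prod_{j=1}^2\frac{\Gamma\big(-i(\tau_{11}-\tau_{2j}-s_{21})-\varkappa\big)}{\Gamma\big(-i(\tau_{11}-\tau_{2j})-\varkappa+\frac12\big)\Gamma\big(-i(\tau_{2j}-\gamma_3)+\frac12\big)}$$ $$\times\,\delta(\gamma_1+s_{11}+s_{21}-\tau_{11}+i\varkappa)\,\delta(\gamma_1+\gamma_2+s_{11}+s_{22}-\tau_{21}-\tau_{22}),$$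 the remaining integration being over $\tau_{21}\in\mathbb R$; it is applied to functions continued analytically in $\tau_{11}$. Let $\mathcal V_{GT}$ be the span of all functions obtained from $\widetilde\psi_R(\tau_{11}-i\varkappa,\tau_{21},\tau_{22})$ by polynomials in the $\mathfrak E_{jk}$, and $\mathcal V_{GG}$ the span of all functions obtained from $\hat\phi_R$ by polynomials in the $\hat{\mathcal E}_{jk}$. **Theorem.** All integrals below converge absolutely, and: 1. If $\varkappa+\varepsilon<\frac12$, then $(\mathcal B_R\hat\phi_R)(\tau)=\widetilde\psi_R(\tau_{11}-i\varkappa,\tau_{21},\tau_{22})$ for all $\tau\in\mathbb R^3$. 2. $(\mathcal B_L\hat\phi_L)(\tau)=\widetilde\psi_L(\tau_{11}-i\varkappa,\tau_{21},\tau_{22})$ for all $\tau\in\mathbb R^3$. 3. $\mathcal B_L^\dagger$ maps $\mathcal V_{GT}$ to $\mathcal V_{GG}$, and $\hat{\mathcal E}_{jk}\circ\mathcal B_L^\dagger=\mathcal B_L^\dagger\circ\mathfrak E_{jk}$ on $\mathcal V_{GT}$ for $1\le j,k\le3$ (as identities of functions of real $s$ off the hyperplane $s_{11}+s_{22}=0$,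 where single terms may have poles). 4. If $\varkappa+\varepsilon<\frac12$, then $(\mathcal B_L^\dagger\circ\mathcal B_R)\hat\phi_R=\hat\phi_R$ on $\mathbb R^3$. 5. If $\varkappa+\varepsilon<\frac12$, then for all $x\in\mathbb R^3$ $$M_{GT}(x)=e^{-\rho(x)}\langle\mathcal B_L\hat\phi_L,\,e^{-\sum x_k\mathfrak E_{kk}}\mathcal B_R\hat\phi_R\rangle_\varkappa,\qquad \langle\mathcal B_L\hat\phi_L,\,e^{-\sum x_k\mathfrak E_{kk}}\mathcal B_R\hat\phi_R\rangle_\varkappa=\langle\hat\phi_L,\,\mathcal B_L^\dagger e^{-\sum x_k\mathfrak E_{kk}}\mathcal B_R\hat\phi_R\rangle,$$ $$\mathcal B_L^\dagger e^{-\sum x_k\mathfrak E_{kk}}\mathcal B_R\hat\phi_R=e^{-\sum x_k\hat{\mathcal E}_{kk}}\mathcal B_L^\dagger\mathcal B_R\hat\phi_R,$$ where in $\langle\cdot,\cdot\rangle_\varkappa$ the functions $\mathcal B_L\hat\phi_L$ and $e^{-\sum x_k\mathfrak E_{kk}}\mathcal B_R\hat\phi_R$, continued analytically in $\tau_{11}$,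 stand for $\psi_1(\tau_{11}-i\varkappa,\cdot)$ and $\psi_2(\tau_{11}-i\varkappa,\cdot)$. 6. $M_{GT}(x)=M_{GG}(x)$ for all $x\in\mathbb R^3$. -/

import Mathlib

noncomputable section

namespace Gl3Whittaker

open Complex MeasureTheory

/-! ## Parameters and functions

Vectors of both realizations are functions of three variables given by explicit meromorphic
formulas, so they are functions on `ℂ³`. The variables are `(τ₁₁, τ₂₁, τ₂₂)` in the
Gelfand-Tsetlin realization and `(s₁₁, s₂₁, s₂₂)` in the modified Gauss-Givental one. -/

/-- Functions of three complex variables. -/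
abbrev Fn : Type := ℂ → ℂ → ℂ → ℂ

/-- `γ = λ + i ε (1, -1, 0)`; `gam lam ε 0, 1, 2` are `γ₁, γ₂, γ₃`. -/
def gam (lam : Fin 3 → ℝ) (ε : ℝ) (i : Fin 3) : ℂ :=
  (lam i : ℂ) + I * (ε : ℂ) * (![1, -1, 0] : Fin 3 → ℂ) i

/-- The complex conjugate of `γ`. -/
def gamBar (lam : Fin 3 → ℝ) (ε : ℝ) (i : Fin 3) : ℂ := starRingEnd ℂ (gam lam ε i)

/-- The constant `(2π)^(-3/2)`. -/
def cNorm : ℂ := (((2 * Real.pi) ^ (-(3 / 2 : ℝ)) : ℝ) : ℂ)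

/-- The commutator of two operators on functions. -/
def opComm (A B : Fn → Fn) : Fn → Fn := fun f t u v => A (B f) t u v - B (A f) t u v

/-! ## The Gelfand-Tsetlin realization -/

/-- The functions by which the Cartan generators `E₁₁, E₂₂, E₃₃` act by multiplication. -/
def gtCartan (lam : Fin 3 → ℝ) (ε : ℝ) (i : Fin 3) (t u v : ℂ) : ℂ :=
  match i with
  | 0 => -I * t
  | 1 => -I * (u + v) + I * t
  | 2 => -I * (gam lam ε 0 + gam lam ε 1 + gam lam ε 2) + I * (u + v)

def gtE12 (f : Fn) : Fn := fun t u v =>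
  -I * (I * (t - u) + 1 / 2) * (I * (t - v) + 1 / 2) * f (t - I) u v

def gtE21 (f : Fn) : Fn := fun t u v => -I * f (t + I) u v

def gtE23 (lam : Fin 3 → ℝ) (ε : ℝ) (f : Fn) : Fn := fun t u v =>
  (∏ i, (I * (u - gam lam ε i) + 1 / 2)) * f t (u - I) v
  + (∏ i, (I * (v - gam lam ε i) + 1 / 2)) / (I * (v - u) * (I * (u - v) - 1)) * f t u (v - I)

def gtE32 (f : Fn) : Fn := fun t u v =>
  (I * (t - u) + 1 / 2) / (I * (u - v) * (I * (u - v) - 1)) * f t (u + I) v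
  - (I * (t - v) + 1 / 2) * f t u (v + I)

/-- The difference operators `Ẽ_ij` of the Gelfand-Tsetlin realization, after conjugation by
the square root of the measure; `Ẽ₁₃ = [Ẽ₁₂, Ẽ₂₃]` and `Ẽ₃₁ = [Ẽ₃₂, Ẽ₂₁]`. -/
def gtOp (lam : Fin 3 → ℝ) (ε : ℝ) (i j : Fin 3) : Fn → Fn :=
  match i, j with
  | 0, 1 => gtE12
  | 1, 0 => gtE21
  | 1, 2 => gtE23 lam ε
  | 2, 1 => gtE32
  | 0, 2 => opComm gtE12 (gtE23 lam ε)
  | 2, 0 => opComm gtE32 gtE21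
  | 0, 0 => fun f t u v => gtCartan lam ε 0 t u v * f t u v
  | 1, 1 => fun f t u v => gtCartan lam ε 1 t u v * f t u v
  | 2, 2 => fun f t u v => gtCartan lam ε 2 t u v * f t u v

/-- Translation of the first variable. -/
def shift1 (c : ℂ) (f : Fn) : Fn := fun t u v => f (t + c) u v

/-- `𝔈_ij(τ) = Ẽ_ij(τ₁₁ - iϰ, τ₂₁, τ₂₂)`: the coefficients of the difference operators are
evaluated at the shifted argument. -/
def gtOpShift (lam : Fin 3 → ℝ) (ε ϰ : ℝ) (i j : Fin 3) (f : Fn) : Fn :=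
  shift1 (-(I * ϰ)) (gtOp lam ε i j (shift1 (I * ϰ) f))

/-- The left Whittaker vector. -/
def psiL (t u v : ℂ) : ℂ := exp (-(Real.pi / 2) * (t + u + v))

/-- The right Whittaker vector. -/
def psiR (lam : Fin 3 → ℝ) (ε : ℝ) (t u v : ℂ) : ℂ :=
  exp ((Real.pi / 2) * (t - u - v))
  * (Complex.Gamma (I * (u - t) + 1 / 2) * Complex.Gamma (I * (v - t) + 1 / 2))
  * ∏ i, (Complex.Gamma (I * (gam lam ε i - u) + 1 / 2)
        * Complex.Gamma (I * (gam lam ε i - v) + 1 / 2))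

/-- The measure density `(2π)^(-3) e^{π(τ₂₁+τ₂₂)} / |Γ(iτ₂₁ - iτ₂₂)|²`. -/
def gtMeasure (u v : ℝ) : ℂ :=
  1 / (2 * Real.pi) ^ 3 * exp (Real.pi * (u + v))
  / (Complex.Gamma (I * u - I * v) * Complex.Gamma (I * v - I * u))

/-- The left Whittaker vector `ψ̃_L = μ₁ ψ_L`. -/
def psiLt (t u v : ℂ) : ℂ :=
  cNorm * exp (-(Real.pi * t / 2)) / Complex.Gamma (I * u - I * v)

/-- The right Whittaker vector `ψ̃_R = μ₁ ψ_R`. -/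
def psiRt (lam : Fin 3 → ℝ) (ε : ℝ) (t u v : ℂ) : ℂ :=
  cNorm * exp (Real.pi * t / 2) / Complex.Gamma (I * u - I * v)
  * (Complex.Gamma (I * (u - t) + 1 / 2) * Complex.Gamma (I * (v - t) + 1 / 2))
  * ∏ i, (Complex.Gamma (I * (gam lam ε i - u) + 1 / 2)
        * Complex.Gamma (I * (gam lam ε i - v) + 1 / 2))

/-! ## The modified Gauss-Givental realization -/

/-- The functions by which the Cartan generators act by multiplication. -/
def ggCartan (lam : Fin 3 → ℝ) (ε : ℝ) (i : Fin 3) (a b d : ℂ) : ℂ :=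
  match i with
  | 0 => -I * (gam lam ε 0 + a + b)
  | 1 => I * (-gam lam ε 1 + b - d)
  | 2 => I * (-gam lam ε 2 + a + d)

def ggE12 (f : Fn) : Fn := fun a b d => (I * b + 1 / 2) * f a (b - I) d

def ggE23 (f : Fn) : Fn := fun a b d =>
  (I * a + 1 / 2) * f (a - I) (b + I) d + (I * (a - b + d) + 1 / 2) * f a b (d - I)

def ggE21 (lam : Fin 3 → ℝ) (ε : ℝ) (f : Fn) : Fn := fun a b d =>
  (I * (gam lam ε 1 - gam lam ε 0 - a) + 1 / 2) * f (a + I) b (d - I)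
  + (I * (gam lam ε 1 - gam lam ε 0 - a - b + d) + 1 / 2) * f a (b + I) d

def ggE32 (lam : Fin 3 → ℝ) (ε : ℝ) (f : Fn) : Fn := fun a b d =>
  (I * (gam lam ε 2 - gam lam ε 1 - d) + 1 / 2) * f a b (d + I)

/-- The difference operators of the modified Gauss-Givental realization. -/
def ggOp (lam : Fin 3 → ℝ) (ε : ℝ) (i j : Fin 3) : Fn → Fn :=
  match i, j with
  | 0, 1 => ggE12
  | 1, 0 => ggE21 lam ε
  | 1, 2 => ggE23
  | 2, 1 => ggE32 lam ε
  | 0, 2 => opComm ggE12 ggE23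
  | 2, 0 => opComm (ggE32 lam ε) (ggE21 lam ε)
  | 0, 0 => fun f a b d => ggCartan lam ε 0 a b d * f a b d
  | 1, 1 => fun f a b d => ggCartan lam ε 1 a b d * f a b d
  | 2, 2 => fun f a b d => ggCartan lam ε 2 a b d * f a b d

/-- The left Whittaker vector; it belongs to the dual representation, hence `γ̄`. -/
def phiL (lam : Fin 3 → ℝ) (ε : ℝ) (a b d : ℂ) : ℂ :=
  cNorm * Complex.Gamma (I * (gamBar lam ε 0 - gamBar lam ε 1 + a) + 1 / 2)
  * Complex.Gamma (I * (gamBar lam ε 1 - gamBar lam ε 2 + d) + 1 / 2)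
  * Complex.Gamma (I * (gamBar lam ε 0 - gamBar lam ε 2 + a + b) + 1)

/-- The right Whittaker vector. -/
def phiR (a b d : ℂ) : ℂ :=
  cNorm * Complex.Gamma (1 / 2 - I * b) * Complex.Gamma (1 / 2 - I * a)
  * Complex.Gamma (1 - I * a - I * d)

/-! ## The representation spaces -/

/-- The cyclic module generated by the vector `v` under the operators `op i j`: all functions
obtained from `v` by polynomials in these operators. -/
inductive Cyclic (op : Fin 3 → Fin 3 → Fn → Fn) (v : Fn) : Fn → Prop
  | base : Cyclic op v v
  | add (f g : Fn) : Cyclic op v f → Cyclic op v g → Cyclic op v (f + g)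
  | smul (c : ℂ) (f : Fn) : Cyclic op v f → Cyclic op v (c • f)
  | act (i j : Fin 3) (f : Fn) : Cyclic op v f → Cyclic op v (op i j f)

/-- Gelfand-Tsetlin space: generated by the shifted vector `ψ̃_R(τ₁₁ - iϰ, τ₂₁, τ₂₂)`
under the operators `𝔈_ij`. -/
def GTSpace (lam : Fin 3 → ℝ) (ε ϰ : ℝ) : Fn → Prop :=
  Cyclic (gtOpShift lam ε ϰ) (shift1 (-(I * ϰ)) (psiRt lam ε))

/-- Gauss-Givental space: generated by `φ̂_R` under the operators `Ê_ij`. -/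
def GGSpace (lam : Fin 3 → ℝ) (ε : ℝ) : Fn → Prop := Cyclic (ggOp lam ε) phiR

/-- `g` restricts to `F` on real points. The hyperplane `s₁₁ + s₂₂ = 0` is left out: there the
individual terms of a vector of `GGSpace` may have poles, which cancel only in the sum. -/
def RestrictsTo (g : Fn) (F : ℝ → ℝ → ℝ → ℂ) : Prop :=
  ∀ a b d : ℝ, a + d ≠ 0 → g a b d = F a b d

/-! ## Delta-functions of complex argument and analytic continuation -/

/-- `∫ ds δ(s - w) φ(s) = φ(w)`, for a function `φ` that is given together with its continuation
to complex arguments. -/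
def cdelta (w : ℂ) (φ : ℂ → ℂ) : ℂ := φ w

/-- `Φ` is an analytic continuation of `φ : ℝ → ℂ` to the closed strip between the lines
`Im z = 0` and `Im z = h`. -/
def IsStripExt (φ : ℝ → ℂ) (h : ℝ) (Φ : ℂ → ℂ) : Prop :=
  AnalyticOnNhd ℂ Φ {z : ℂ | z.im ∈ Set.uIcc 0 h} ∧ ∀ x : ℝ, Φ x = φ x

open Classical in
/-- The value at `w` of the analytic continuation of `φ` to the strip between `ℝ` and
`ℝ + i Im w` (and `0` if there is none). -/
def stripExt (φ : ℝ → ℂ) (w : ℂ) : ℂ :=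
  if h : ∃ Φ, IsStripExt φ w.im Φ then h.choose w else 0

/-- The continuation does not depend on choices. -/
theorem stripExt_eq {φ : ℝ → ℂ} {w : ℂ} {Φ : ℂ → ℂ} (h : IsStripExt φ w.im Φ) :
    stripExt φ w = Φ w := by
  classical
  have hex : ∃ Φ, IsStripExt φ w.im Φ := ⟨Φ, h⟩
  rw [stripExt, dif_pos hex]
  obtain ⟨hA, hR⟩ := hex.choose_spec
  have hconv : Convex ℝ {z : ℂ | z.im ∈ Set.uIcc 0 w.im} :=
    (convex_uIcc (𝕜 := ℝ) 0 w.im).is_linear_preimage Complex.imLm.isLinear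
  have hfreq : ∃ᶠ z in nhdsWithin (0 : ℂ) {0}ᶜ, hex.choose z = Φ z := by
    have ht : Filter.Tendsto (fun n : ℕ => (((1 : ℝ) / ((n : ℝ) + 1) : ℝ) : ℂ)) Filter.atTop
        (nhdsWithin (0 : ℂ) {0}ᶜ) := by
      refine tendsto_nhdsWithin_iff.2 ⟨?_, ?_⟩
      · have := (Complex.continuous_ofReal.tendsto 0).comp
          (tendsto_one_div_add_atTop_nhds_zero_nat (𝕜 := ℝ))
        simpa only [Function.comp_def, Complex.ofReal_zero] using this
      · refine Filter.Eventually.of_forall fun n => ?_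
        have hn : (1 : ℝ) / ((n : ℝ) + 1) ≠ 0 := by positivity
        simpa only [Set.mem_compl_iff, Set.mem_singleton_iff, Complex.ofReal_eq_zero] using hn
    refine ht.frequently (Filter.Frequently.of_forall fun n => ?_)
    rw [hR, h.2]
  exact hA.eqOn_of_preconnected_of_frequently_eq h.1 hconv.isPreconnected
    (by simp) hfreq (by simp)

/-- Analytic continuation of a function of real `(τ₁₁, τ₂₁, τ₂₂)` in the variable `τ₁₁`. -/
def ext1 (F : ℝ → ℝ → ℝ → ℂ) : ℂ → ℝ → ℝ → ℂ := fun t u v => stripExt (fun r => F r u v) t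

/-- Restriction of a function on `ℂ³` to real `τ₂₁, τ₂₂`. -/
def mixed (f : Fn) : ℂ → ℝ → ℝ → ℂ := fun t u v => f t u v

/-! ## The integral operators -/

/-- The kernel of `B_R` without its delta-functions. -/
def kerR (lam : Fin 3 → ℝ) (ε ϰ : ℝ) (t u v a b : ℂ) : ℂ :=
  1 / (2 * Real.pi) * (exp (Real.pi * (t - I * ϰ) / 2) / Complex.Gamma (I * u - I * v))
  * (Complex.Gamma (I * (gam lam ε 1 - gam lam ε 0 - a) + 1 / 2)
      / Complex.Gamma (-I * b + 1 / 2))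
  * (Complex.Gamma (I * (t - u - b) + ϰ) * Complex.Gamma (I * (u - t) - ϰ + 1 / 2))
  * (Complex.Gamma (I * (t - v - b) + ϰ) * Complex.Gamma (I * (v - t) - ϰ + 1 / 2))
  * (Complex.Gamma (I * (gam lam ε 2 - u) + 1 / 2)
      * Complex.Gamma (I * (gam lam ε 2 - v) + 1 / 2))

/-- Integrand of `(B_R φ)(τ)` in the real variable `s₂₁`, after integration over `s₁₁` and `s₂₂`
against `δ(γ₁ + s₁₁ + s₂₁ - τ₁₁ + iϰ) δ(γ₁ + γ₂ + s₁₁ + s₂₂ - τ₂₁ - τ₂₂)`. -/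
def BRint (lam : Fin 3 → ℝ) (ε ϰ : ℝ) (φ : Fn) (t u v : ℝ) (b : ℝ) : ℂ :=
  cdelta (t - I * ϰ - gam lam ε 0 - b) fun a =>
    cdelta (u + v - gam lam ε 0 - gam lam ε 1 - a) fun d =>
      kerR lam ε ϰ t u v a b * φ a b d

/-- The operator `B_R`. -/
def BR (lam : Fin 3 → ℝ) (ε ϰ : ℝ) (φ : Fn) (t u v : ℝ) : ℂ :=
  ∫ b : ℝ, BRint lam ε ϰ φ t u v b

/-- The kernel of `B_L` without its delta-functions. -/
def kerL (lam : Fin 3 → ℝ) (ε ϰ : ℝ) (t u v a b : ℂ) : ℂ :=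
  1 / (2 * Real.pi) * (exp (-(Real.pi * (t - I * ϰ) / 2)) / Complex.Gamma (I * u - I * v))
  * (Complex.Gamma (I * b + 1 / 2)
      / Complex.Gamma (I * (gamBar lam ε 0 - gamBar lam ε 1 + a) + 1 / 2))
  * (Complex.Gamma (I * (t - u - b) + ϰ)
      / (Complex.Gamma (I * (t - u) + ϰ + 1 / 2)
          * Complex.Gamma (I * (u - gam lam ε 2) + 1 / 2)))
  * (Complex.Gamma (I * (t - v - b) + ϰ)
      / (Complex.Gamma (I * (t - v) + ϰ + 1 / 2)
          * Complex.Gamma (I * (v - gam lam ε 2) + 1 / 2)))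

/-- Integrand of `(B_L φ)(τ)` in the real variable `s₁₁`, after integration over `s₂₁` and `s₂₂`
against `δ(γ̄₁ + s₁₁ + s₂₁ - τ₁₁ + iϰ) δ(γ̄₁ + γ̄₂ + s₁₁ + s₂₂ - τ₂₁ - τ₂₂)`. -/
def BLint (lam : Fin 3 → ℝ) (ε ϰ : ℝ) (φ : Fn) (t u v : ℝ) (a : ℝ) : ℂ :=
  cdelta (t - I * ϰ - gamBar lam ε 0 - a) fun b =>
    cdelta (u + v - gamBar lam ε 0 - gamBar lam ε 1 - a) fun d =>
      kerL lam ε ϰ t u v a b * φ a b d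

/-- The operator `B_L`. -/
def BL (lam : Fin 3 → ℝ) (ε ϰ : ℝ) (φ : Fn) (t u v : ℝ) : ℂ :=
  ∫ a : ℝ, BLint lam ε ϰ φ t u v a

/-- The kernel of the adjoint `B_L†` without its delta-functions. It is the complex conjugate of
the kernel of `B_L` at `(τ₁₁ + 2iϰ, τ₂₁, τ₂₂; s)`, times the factor `1/2` of the pairing. -/
def kerLdag (lam : Fin 3 → ℝ) (ε ϰ : ℝ) (a b t u v : ℂ) : ℂ :=
  1 / 2 * (1 / (2 * Real.pi))
  * (exp (-(Real.pi * (t - I * ϰ) / 2)) / Complex.Gamma (-I * u + I * v))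
  * (Complex.Gamma (-I * b + 1 / 2)
      / Complex.Gamma (-I * (gam lam ε 0 - gam lam ε 1 + a) + 1 / 2))
  * (Complex.Gamma (-I * (t - u - b) - ϰ)
      / (Complex.Gamma (-I * (t - u) - ϰ + 1 / 2)
          * Complex.Gamma (-I * (u - gam lam ε 2) + 1 / 2)))
  * (Complex.Gamma (-I * (t - v - b) - ϰ)
      / (Complex.Gamma (-I * (t - v) - ϰ + 1 / 2)
          * Complex.Gamma (-I * (v - gam lam ε 2) + 1 / 2)))

/-- Integrand of `(B_L† f)(s)` in the real variable `τ₂₁`, after integration over `τ₁₁` and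
`τ₂₂` against `δ(γ₁ + s₁₁ + s₂₁ - τ₁₁ + iϰ) δ(γ₁ + γ₂ + s₁₁ + s₂₂ - τ₂₁ - τ₂₂)`. The argument
of the second one is real, since `γ₁ + γ₂ = λ₁ + λ₂`. -/
def BLdagInt (lam : Fin 3 → ℝ) (ε ϰ : ℝ) (f : ℂ → ℝ → ℝ → ℂ) (a b d : ℝ) (u : ℝ) : ℂ :=
  cdelta (gam lam ε 0 + a + b + I * ϰ) fun t =>
    kerLdag lam ε ϰ a b t u ((lam 0 + lam 1 + a + d - u : ℝ) : ℂ)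
      * f t u (lam 0 + lam 1 + a + d - u)

/-- The operator `B_L†`. -/
def BLdag (lam : Fin 3 → ℝ) (ε ϰ : ℝ) (f : ℂ → ℝ → ℝ → ℂ) (a b d : ℝ) : ℂ :=
  ∫ u : ℝ, BLdagInt lam ε ϰ f a b d u

/-! ## Exponentials of the Cartan generators, pairings and matrix elements -/

/-- `e^{-∑ x_i 𝔈_ii}`, multiplication by a function. -/
def expGTShift (lam : Fin 3 → ℝ) (ε ϰ : ℝ) (x : Fin 3 → ℝ) (f : ℂ → ℝ → ℝ → ℂ) :
    ℂ → ℝ → ℝ → ℂ :=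
  fun t u v => exp (-∑ i, (x i : ℂ) * gtCartan lam ε i (t - I * ϰ) u v) * f t u v

/-- `e^{-∑ x_i Ê_ii}`, multiplication by a function, on functions of real `s`. -/
def expGG (lam : Fin 3 → ℝ) (ε : ℝ) (x : Fin 3 → ℝ) (F : ℝ → ℝ → ℝ → ℂ) : ℝ → ℝ → ℝ → ℂ :=
  fun a b d => exp (-∑ i, (x i : ℂ) * ggCartan lam ε i a b d) * F a b d

/-- Integrand of the Gelfand-Tsetlin matrix element. -/
def gtMatInt (lam : Fin 3 → ℝ) (ε : ℝ) (x : Fin 3 → ℝ) (p : ℝ × ℝ × ℝ) : ℂ :=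
  gtMeasure p.2.1 p.2.2 * starRingEnd ℂ (psiL p.1 p.2.1 p.2.2)
    * (exp (-∑ i, (x i : ℂ) * gtCartan lam ε i p.1 p.2.1 p.2.2)
        * psiR lam ε p.1 p.2.1 p.2.2)

/-- `e^{-ρ(x)}`, where `ρ(x) = x₁ - x₃`. -/
def expRho (x : Fin 3 → ℝ) : ℂ := exp (-((x 0 : ℂ) - x 2))

/-- The Gelfand-Tsetlin (Mellin-Barnes) matrix element `e^{-ρ(x)} ⟨ψ_L, e^{-∑ x_i E_ii} ψ_R⟩`.
The factor `1/2 = 1/2!` is the symmetry factor: the Gelfand-Tsetlin variables of the second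
row form an unordered pair `{τ₂₁, τ₂₂}`. -/
def gtMatrixElement (lam : Fin 3 → ℝ) (ε : ℝ) (x : Fin 3 → ℝ) : ℂ :=
  expRho x * (1 / 2 * ∫ p : ℝ × ℝ × ℝ, gtMatInt lam ε x p)

/-- Integrand of the deformed `L²`-pairing of `F₁` and `F₂`, which are
`ψ₁(τ₁₁ - iϰ, ·)` and `ψ₂(τ₁₁ - iϰ, ·)`: it is `conj ψ₁(τ₁₁ + iϰ, ·) ψ₂(τ₁₁ - iϰ, ·)`. -/
def gtPairInt (ϰ : ℝ) (F₁ F₂ : ℂ → ℝ → ℝ → ℂ) (p : ℝ × ℝ × ℝ) : ℂ :=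
  starRingEnd ℂ (F₁ (p.1 + 2 * I * ϰ) p.2.1 p.2.2) * F₂ p.1 p.2.1 p.2.2

/-- The deformed pairing `⟨ψ₁, ψ₂⟩_ϰ`, in terms of the shifted functions, with the symmetry
factor `1/2`. -/
def gtPair (ϰ : ℝ) (F₁ F₂ : ℂ → ℝ → ℝ → ℂ) : ℂ :=
  1 / 2 * ∫ p : ℝ × ℝ × ℝ, gtPairInt ϰ F₁ F₂ p

/-- Integrand of the standard `L²`-pairing. -/
def ggPairInt (F₁ F₂ : ℝ → ℝ → ℝ → ℂ) (p : ℝ × ℝ × ℝ) : ℂ :=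
  starRingEnd ℂ (F₁ p.1 p.2.1 p.2.2) * F₂ p.1 p.2.1 p.2.2

/-- The standard `L²`-pairing of the modified Gauss-Givental realization. -/
def ggPair (F₁ F₂ : ℝ → ℝ → ℝ → ℂ) : ℂ := ∫ p : ℝ × ℝ × ℝ, ggPairInt F₁ F₂ p

/-- Restriction of a function on `ℂ³` to `ℝ³`. -/
def onReal (f : Fn) : ℝ → ℝ → ℝ → ℂ := fun a b d => f a b d

/-- The modified Gauss-Givental matrix element `e^{-ρ(x)} ⟨φ̂_L, e^{-∑ x_i Ê_ii} φ̂_R⟩`. -/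
def ggMatrixElement (lam : Fin 3 → ℝ) (ε : ℝ) (x : Fin 3 → ℝ) : ℂ :=
  expRho x * ggPair (onReal (phiL lam ε)) (expGG lam ε x (onReal phiR))

end Gl3Whittaker

end

section

open Complex MeasureTheory Filter Topology Set

namespace Gl3Whittaker

/-! On the support of the delta-functions every application of `B_R`, `B_L` or `B_L†` needed here is
an integral of Gamma functions with a closed form, so the theorem rests on two classical
evaluations. For `B_R φ̂_R` and `B_L φ̂_L` the integrand is a constant times
Γ(A+iy)Γ(B+iy)Γ(C-iy)Γ(D-iy), and Barnes' first lemma `integral_barnes` applies. For `B_L†` on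
`ψ̃_R` the factors 1/Γ(±i(τ₂₁-τ₂₂)) combine with six Gammas to the continuous dual Hahn weight in
half the difference τ₂₁-τ₂₂; its mass `integral_hahn` is a product of Gammas of pairwise parameter
sums, which gives `φ̂_R`.

Both evaluations have the same proof. A contour shift yields a first-order difference equation in
one parameter, so the quotient of the integral by its expected value has period 1. It grows more
slowly than exp(2π|Im|), hence is constant (`eq_of_periodic_of_growth`). By symmetry it is constant
in all parameters, and its value is computed when all of them are 1/2. The growth bounds need
exponential decay of Γ on vertical strips, obtained by rotating the ray in Euler's integral.

For the intertwining property, multiply `ψ̃_R` by h(τ₁₁, τ₂₁+τ₂₂) (Y(τ₂₁))_n (Y(τ₂₂))_n. Since (Y)_n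
Γ(Y) = Γ(Y+n), this only raises one Hahn parameter by n, and h is constant along the integration.
The image is `φ̂_R` times h (α)_n (q)_n. The relation `Rel` records these pairs, and the rest is
algebra: conjugated by the Whittaker vectors, the generators of the two realizations act in the same
way on the two families (`relOp_E12`, `relOp_E21`, `relOp_E23`, `relOp_E32`). A vector of the
Gauss-Givental space is determined at regular points by its real values (`SepHol.eq_zero_of_real`),
so it does not matter which one represents the image.

For the matrix elements, the Gelfand-Tsetlin integrand `gtForm` is holomorphic in τ₁₁ above Im τ₁₁ =
-1/2, and its line of integration may be moved. The line Im τ₁₁ = -ϰ gives the deformed pairing. On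
the line Im τ₁₁ = ε the kernel of `B_L` with ϰ = ε is supported at real s, which leads to an
absolutely convergent integral of `jointForm` over four real variables. Integrating over s₁₁ first
reproduces the conjugate of `B_L φ̂_L`, hence the Gelfand-Tsetlin side; integrating over τ₂₁ first
reproduces `B_L† ψ̃_R`, hence the Gauss-Givental side. -/

/-! ### Parameter integrals and exponential bounds for `Γ` -/

lemma differentiableAt_integral_of_bound {α : Type*} [MeasurableSpace α] {μ : Measure α}
    {F : ℂ → α → ℂ} {z₀ : ℂ} {R : ℝ} (hR : 0 < R) {bound : α → ℝ}
    (hmeas : ∀ z ∈ Metric.ball z₀ R, AEStronglyMeasurable (F z) μ)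
    (hdiff : ∀ᵐ x ∂μ, DifferentiableOn ℂ (fun z => F z x) (Metric.ball z₀ R))
    (hb : ∀ᵐ x ∂μ, ∀ z ∈ Metric.ball z₀ R, ‖F z x‖ ≤ bound x) (hint : Integrable bound μ) :
    DifferentiableAt ℂ (fun z => ∫ x, F z x ∂μ) z₀ := by
  have hz₀ : z₀ ∈ Metric.ball z₀ R := Metric.mem_ball_self hR
  have hderiv : ∀ᵐ x ∂μ, ∀ z ∈ Metric.ball z₀ R,
      HasDerivAt (fun z => F z x) (deriv (fun z => F z x) z) z := by
    filter_upwards [hdiff] with x hx z hz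
    exact (hx.differentiableAt (Metric.isOpen_ball.mem_nhds hz)).hasDerivAt
  -- The derivative is measurable in `x` as a pointwise limit of difference quotients along a
  -- sequence tending to `z₀`.
  have hmeas' : AEStronglyMeasurable (fun x => deriv (fun z => F z x) z₀) μ := by
    obtain ⟨u, hu1, hu2⟩ : ∃ u : ℕ → ℂ, (∀ n, u n ∈ Metric.ball z₀ R) ∧
        Tendsto u atTop (𝓝[≠] z₀) := by
      have : ∀ᶠ z in 𝓝[≠] z₀, z ∈ Metric.ball z₀ R :=
        mem_nhdsWithin_of_mem_nhds (Metric.isOpen_ball.mem_nhds hz₀)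
      obtain ⟨u, hu, hu'⟩ := exists_seq_forall_of_frequently this.frequently
      exact ⟨u, hu', hu⟩
    refine aestronglyMeasurable_of_tendsto_ae atTop
      (f := fun n x => (u n - z₀)⁻¹ • (F (u n) x - F z₀ x)) (fun n => ?_) ?_
    · exact ((hmeas _ (hu1 n)).sub (hmeas _ hz₀)).const_smul (u n - z₀)⁻¹
    · filter_upwards [hderiv] with x hx
      have := (hasDerivAt_iff_tendsto_slope.1 (hx z₀ hz₀)).comp hu2
      simpa only [slope_def_module, Function.comp_def] using this
  -- Circles of radius `R / 4` about points of this ball stay inside the ball of radius `R`, so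
  -- Cauchy's estimate dominates the derivative by `bound x / (R / 4)`.
  have hball : Metric.ball z₀ (R / 2) ∈ 𝓝 z₀ := Metric.ball_mem_nhds _ (by positivity)
  refine (hasDerivAt_integral_of_dominated_loc_of_deriv_le (bound := fun x => bound x / (R / 4))
    hball ?_ ?_ (F' := fun z x => deriv (fun z => F z x) z) hmeas' ?_
    (hint.div_const _) ?_).2.differentiableAt
  · filter_upwards [Metric.isOpen_ball.mem_nhds hz₀] with z hz using hmeas z hz
  · refine hint.mono' (hmeas _ hz₀) ?_
    filter_upwards [hb] with x hx using hx _ hz₀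
  · filter_upwards [hb, hdiff] with x hx hd z hz
    have hsub : Metric.closedBall z (R / 4) ⊆ Metric.ball z₀ R := fun w hw => by
      rw [Metric.mem_ball] at hz ⊢
      rw [Metric.mem_closedBall] at hw
      linarith [dist_triangle w z z₀]
    refine norm_deriv_le_of_forall_mem_sphere_norm_le (by positivity)
      ((hd.mono hsub).diffContOnCl_ball (subset_refl _)) fun w hw => ?_
    exact hx w (hsub (Metric.sphere_subset_closedBall hw))
  · filter_upwards [hderiv] with x hx z hz
    exact hx z (Metric.ball_subset_ball (by linarith) hz)

lemma norm_ofReal_cpow_mul_exp {a r : ℂ} {t : ℝ} (ht : 0 < t) :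
    ‖(t : ℂ) ^ (a - 1) * exp (-(r * t))‖ = t ^ (a.re - 1) * Real.exp (-(r.re * t)) := by
  rw [norm_mul, Complex.norm_cpow_eq_rpow_re_of_pos ht, Complex.norm_exp]
  simp

lemma integrableOn_rpow_mul_exp {x δ : ℝ} (hx : 0 < x) (hδ : 0 < δ) :
    IntegrableOn (fun t : ℝ => t ^ (x - 1) * Real.exp (-(δ * t))) (Ioi 0) := by
  have := integrableOn_rpow_mul_exp_neg_mul_rpow (s := x - 1) (p := 1) (by linarith) one_pos hδ
  simpa using this

/-- Both sides are holomorphic in `r` on the right half-plane and agree for real `r`, so the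
identity theorem applies. Complex `r` amounts to rotating the ray of integration in Euler's
integral. -/
lemma integral_cpow_mul_exp_neg_mul_Ioi_complex {a r : ℂ} (ha : 0 < a.re) (hr : 0 < r.re) :
    ∫ t : ℝ in Ioi 0, (t : ℂ) ^ (a - 1) * exp (-(r * t)) = (1 / r) ^ a * Complex.Gamma a := by
  have hopen : IsOpen {z : ℂ | 0 < z.re} := isOpen_lt continuous_const continuous_re
  have hL : DifferentiableOn ℂ (fun r : ℂ => ∫ t : ℝ in Ioi 0, (t : ℂ) ^ (a - 1) * exp (-(r * t)))
      {z : ℂ | 0 < z.re} := by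
    intro z hz
    refine DifferentiableAt.differentiableWithinAt ?_
    have hz' : 0 < z.re := hz
    refine differentiableAt_integral_of_bound (R := z.re / 2) (by positivity)
      (bound := fun t => t ^ (a.re - 1) * Real.exp (-(z.re / 2 * t))) ?_ ?_ ?_
      (integrableOn_rpow_mul_exp ha (by positivity))
    · intro w _
      refine ContinuousOn.aestronglyMeasurable ?_ measurableSet_Ioi
      refine ContinuousOn.mul ?_ (by fun_prop)
      intro t ht
      exact ((continuousAt_cpow_const (by simp [slitPlane, Set.mem_Ioi.1 ht])).comp
        continuous_ofReal.continuousAt).continuousWithinAt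
    · exact ae_of_all _ fun t => by fun_prop
    · refine (ae_restrict_iff' measurableSet_Ioi).2 (ae_of_all _ fun t ht w hw => ?_)
      rw [norm_ofReal_cpow_mul_exp ht]
      have ht' : 0 < t := ht
      have h1 : z.re / 2 ≤ w.re := by
        have h2 := (abs_re_le_norm (w - z)).trans_lt (by simpa [dist_eq] using hw)
        rw [sub_re, abs_lt] at h2
        linarith
      gcongr
  have hRd : DifferentiableOn ℂ (fun r : ℂ => (1 / r) ^ a * Complex.Gamma a)
      {z : ℂ | 0 < z.re} := by
    intro z hz
    have hz' : 0 < z.re := hz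
    have hz0 : z ≠ 0 := fun h => by simp [h] at hz'
    have : (1 / z) ∈ slitPlane := by
      refine Or.inl ?_
      rw [one_div, inv_re]
      exact div_pos hz' (normSq_pos.2 hz0)
    exact (((differentiableAt_const _).div differentiableAt_id hz0).cpow
      (differentiableAt_const _) this |>.mul_const _).differentiableWithinAt
  have hconv : Convex ℝ {z : ℂ | 0 < z.re} := convex_halfSpace_re_gt 0
  have ht : Tendsto (fun n : ℕ => (((1 : ℝ) + (1 : ℝ) / ((n : ℝ) + 1) : ℝ) : ℂ)) atTop
        (𝓝[≠] (1 : ℂ)) := by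
    refine tendsto_nhdsWithin_iff.2 ⟨?_, Eventually.of_forall fun n => ?_⟩
    · have := (Complex.continuous_ofReal.tendsto _).comp
          ((tendsto_one_div_add_atTop_nhds_zero_nat (𝕜 := ℝ)).const_add 1)
      simpa [Function.comp_def] using this
    · have hn : (1 : ℝ) / ((n : ℝ) + 1) ≠ 0 := by positivity
      simp only [mem_compl_iff, mem_singleton_iff]
      rw [← ofReal_one, ofReal_inj]
      simpa using hn
  exact (hL.analyticOnNhd hopen).eqOn_of_preconnected_of_frequently_eq (hRd.analyticOnNhd hopen)
    hconv.isPreconnected (z₀ := 1) (by simp) (ht.frequently (Frequently.of_forall fun n => by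
      exact integral_cpow_mul_exp_neg_mul_Ioi ha (by positivity))) hr

/-- The rate of exponential decay of `Γ` along vertical lines that is used throughout; any number
between `π / 3` and `π / 2` would do. -/
noncomputable def decayRate : ℝ := 2 * Real.pi / 5

lemma decayRate_pos : 0 < decayRate := by unfold decayRate; positivity

/-- Rotate the ray in Euler's integral by an angle θ: then Γ(s) is exp(iθs) times the integral of
t^(s-1) exp(-e^{iθ}t). The prefactor has modulus exp(-θ Im s), and the integral is dominated by the
real one with rate cos θ, which is positive because |θ| < π/2. -/
lemma norm_Gamma_le_of_re_pos {s : ℂ} (hs : 0 < s.re) :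
    ‖Complex.Gamma s‖ ≤
      Real.Gamma s.re * (1 / Real.cos decayRate) ^ s.re * Real.exp (-(decayRate * |s.im|)) := by
  have hcos : 0 < Real.cos decayRate := by
    apply Real.cos_pos_of_mem_Ioo
    unfold decayRate
    constructor <;> linarith [Real.pi_pos]
  -- The sign of θ follows that of `s.im`, so that the prefactor decays in both directions.
  obtain ⟨θ, hθ, hθs, hcosθ⟩ : ∃ θ : ℝ, |θ| = decayRate ∧ θ * s.im = decayRate * |s.im| ∧
      Real.cos θ = Real.cos decayRate := by
    rcases le_total 0 s.im with h | h
    · exact ⟨decayRate, abs_of_pos decayRate_pos, by rw [abs_of_nonneg h], rfl⟩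
    · exact ⟨-decayRate, by rw [abs_neg, abs_of_pos decayRate_pos], by
        rw [abs_of_nonpos h]; ring, Real.cos_neg _⟩
  have hr : 0 < (exp (θ * I)).re := by
    rw [exp_ofReal_mul_I_re, hcosθ]; exact hcos
  have key := integral_cpow_mul_exp_neg_mul_Ioi_complex hs hr
  have hlog : (1 / exp (θ * I)) ^ s = exp (-(θ * I) * s) := by
    have hpi : decayRate < Real.pi := by unfold decayRate; linarith [Real.pi_pos]
    have habs := abs_lt.1 (hθ.trans_lt hpi)
    rw [one_div, ← exp_neg, cpow_def_of_ne_zero (exp_ne_zero _), log_exp]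
    · simp; linarith
    · simp; linarith
  have hG : Complex.Gamma s = exp (θ * I * s) *
      ∫ t : ℝ in Ioi 0, (t : ℂ) ^ (s - 1) * exp (-(exp (θ * I) * t)) := by
    rw [key, hlog, ← mul_assoc, ← exp_add]
    simp
  rw [hG, norm_mul]
  have hE : ‖exp (θ * I * s)‖ = Real.exp (-(decayRate * |s.im|)) := by
    rw [Complex.norm_exp, ← hθs]; simp
  rw [hE, mul_comm (Real.exp _)]
  refine mul_le_mul_of_nonneg_right ?_ (Real.exp_pos _).le
  rw [mul_comm (Real.Gamma _), ← Real.integral_rpow_mul_exp_neg_mul_Ioi hs hcos]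
  refine (norm_integral_le_integral_norm _).trans (le_of_eq ?_)
  refine setIntegral_congr_fun measurableSet_Ioi fun t ht => ?_
  rw [norm_ofReal_cpow_mul_exp ht, exp_ofReal_mul_I_re, hcosθ]

/-- `Γ` decays exponentially, uniformly on vertical strips in the right half-plane. -/
lemma exists_norm_Gamma_le {m M : ℝ} (hm : 0 < m) :
    ∃ C : ℝ, 0 < C ∧ ∀ s : ℂ, m ≤ s.re → s.re ≤ M →
      ‖Complex.Gamma s‖ ≤ C * Real.exp (-(decayRate * |s.im|)) := by
  have hcont : ContinuousOn (fun x : ℝ => Real.Gamma x * (1 / Real.cos decayRate) ^ x)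
      (Icc m M) := by
    have hcos : 0 < Real.cos decayRate := by
      apply Real.cos_pos_of_mem_Ioo
      unfold decayRate
      constructor <;> linarith [Real.pi_pos]
    refine ContinuousOn.mul (fun x hx => ?_) ?_
    · refine (Real.differentiableAt_Gamma fun n => ?_).continuousAt.continuousWithinAt
      have : (0 : ℝ) ≤ n := n.cast_nonneg
      linarith [hx.1]
    · exact (Real.continuous_const_rpow (by positivity)).continuousOn
  obtain ⟨C, hC⟩ := isCompact_Icc.exists_bound_of_continuousOn hcont
  refine ⟨max C 1, by positivity, fun s h1 h2 => ?_⟩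
  refine (norm_Gamma_le_of_re_pos (hm.trans_le h1)).trans ?_
  refine mul_le_mul_of_nonneg_right ?_ (Real.exp_pos _).le
  exact ((le_abs_self _).trans (hC s.re ⟨h1, h2⟩)).trans (le_max_left _ _)

/-- Decay of `Γ` along a vertical line. -/
lemma exists_norm_Gamma_add_le {A : ℂ} (hA : 0 < A.re) :
    ∃ C : ℝ, 0 < C ∧ ∀ y : ℝ,
      ‖Complex.Gamma (A + I * y)‖ ≤ C * Real.exp (-(decayRate * |y|)) := by
  obtain ⟨C, hC, h⟩ := exists_norm_Gamma_le (M := A.re) hA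
  refine ⟨C * Real.exp (decayRate * |A.im|), by positivity, fun y => ?_⟩
  refine (h (A + I * y) (by simp) (by simp)).trans ?_
  rw [mul_assoc, ← Real.exp_add]
  refine mul_le_mul_of_nonneg_left (Real.exp_le_exp.2 ?_) hC.le
  have h1 : |y| ≤ |(A + I * y).im| + |A.im| := by
    have := abs_sub (A + I * y).im A.im
    simpa using this
  nlinarith [decayRate_pos]

/-- Growth of `1 / Γ` on vertical strips. -/
lemma exists_norm_inv_Gamma_le (M : ℝ) :
    ∃ C : ℝ, 0 < C ∧ ∀ s : ℂ, 0 < s.re → s.re ≤ M → 1 ≤ |s.im| →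
      ‖(Complex.Gamma s)⁻¹‖ ≤ C * Real.exp ((Real.pi - decayRate) * |s.im|) := by
  obtain ⟨n, hn⟩ := exists_nat_gt M
  obtain ⟨C, hC, h⟩ := exists_norm_Gamma_le (m := n - M + 1) (M := n + 1) (by linarith)
  -- Each factor of the functional equation has modulus at least `|z.im| ≥ 1`, so moving to the
  -- right can only increase the norm. This carries `1 - s` into the half-plane where the decay
  -- estimate holds.
  have shift : ∀ (k : ℕ) (z : ℂ), 1 ≤ |z.im| → ‖Complex.Gamma z‖ ≤ ‖Complex.Gamma (z + k)‖ := by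
    intro k
    induction k with
    | zero => intro z _; simp
    | succ k ih =>
      intro z hz
      have hz0 : z + k ≠ 0 := fun h0 => by
        have := congrArg im h0
        simp at this
        rw [this] at hz; norm_num at hz
      refine (ih z hz).trans ?_
      push_cast
      rw [← add_assoc, Complex.Gamma_add_one _ hz0, norm_mul]
      refine le_mul_of_one_le_left (norm_nonneg _) (hz.trans ?_)
      simpa using abs_im_le_norm (z + k)
  refine ⟨C / Real.pi, by positivity, fun s h0 hM him => ?_⟩
  have hrefl := Complex.Gamma_mul_Gamma_one_sub s
  have hsin : Complex.sin (Real.pi * s) ≠ 0 := by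
    rw [Ne, Complex.sin_eq_zero_iff]
    rintro ⟨k, hk⟩
    have : s = k := by
      have hpi : (Real.pi : ℂ) ≠ 0 := by exact_mod_cast Real.pi_ne_zero
      rw [mul_comm (k : ℂ)] at hk
      exact mul_left_cancel₀ hpi hk
    rw [this] at him
    norm_num at him
  -- By reflection 1/Γ(s) = Γ(1-s) sin(πs)/π. The sine grows at rate π and Γ(1-s) decays at rate
  -- `decayRate`, whence the exponent.
  have hinv : (Complex.Gamma s)⁻¹ = Complex.Gamma (1 - s) * Complex.sin (Real.pi * s) / Real.pi := by
    have hpi : (Real.pi : ℂ) ≠ 0 := by exact_mod_cast Real.pi_ne_zero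
    have hG : Complex.Gamma s ≠ 0 := Complex.Gamma_ne_zero_of_re_pos h0
    rw [eq_div_iff hsin] at hrefl
    rw [inv_eq_one_div, div_eq_div_iff hG hpi]
    linear_combination -hrefl
  have hsin_le : ‖Complex.sin (Real.pi * s)‖ ≤ Real.exp (Real.pi * |s.im|) := by
    rw [Complex.sin, norm_div, norm_mul, norm_I, mul_one]
    have e1 : ‖exp (-(Real.pi * s) * I)‖ ≤ Real.exp (Real.pi * |s.im|) := by
      rw [Complex.norm_exp]; apply Real.exp_le_exp.2
      simp; gcongr; exact le_abs_self _
    have e2 : ‖exp (Real.pi * s * I)‖ ≤ Real.exp (Real.pi * |s.im|) := by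
      rw [Complex.norm_exp]; apply Real.exp_le_exp.2
      simp only [mul_re, mul_im, ofReal_re, ofReal_im, I_re, I_im]
      nlinarith [neg_abs_le s.im, Real.pi_pos]
    have := norm_sub_le (exp (-(Real.pi * s) * I)) (exp (Real.pi * s * I))
    rw [div_le_iff₀ (by simp)]
    simp only [Complex.norm_ofNat]
    linarith
  have hΓ : ‖Complex.Gamma (1 - s)‖ ≤ C * Real.exp (-(decayRate * |s.im|)) := by
    refine (shift n (1 - s) (by simpa using him)).trans ?_
    have := h (1 - s + n) (by simp; linarith) (by simp; linarith)
    simpa using this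
  rw [hinv, norm_div, norm_mul, norm_real, Real.norm_of_nonneg Real.pi_pos.le]
  rw [div_mul_eq_mul_div]
  refine div_le_div_of_nonneg_right ?_ Real.pi_pos.le
  refine (mul_le_mul hΓ hsin_le (norm_nonneg _) (by positivity)).trans (le_of_eq ?_)
  rw [mul_assoc, ← Real.exp_add]
  ring_nf

/-! ### Contour shifts and a Liouville theorem for periodic functions -/

lemma integrable_exp_neg_mul_abs {δ : ℝ} (hδ : 0 < δ) :
    Integrable fun x : ℝ => Real.exp (-(δ * |x|)) := by
  rw [← integrableOn_univ, ← Iic_union_Ioi (a := (0 : ℝ))]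
  refine IntegrableOn.union ?_ ?_
  · refine (integrableOn_exp_mul_Iic hδ 0).congr_fun (fun x hx => ?_) measurableSet_Iic
    simp [abs_of_nonpos (Set.mem_Iic.1 hx)]
  · refine (exp_neg_integrableOn_Ioi 0 hδ).congr_fun (fun x hx => ?_) measurableSet_Ioi
    simp [abs_of_pos (Set.mem_Ioi.1 hx)]

/-- Shifting the line of integration inside a horizontal strip. -/
lemma integral_horizontal_shift {f : ℂ → ℂ} {h C δ : ℝ} (hδ : 0 < δ)
    (hf : DifferentiableOn ℂ f {z : ℂ | z.im ∈ uIcc 0 h})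
    (hb : ∀ z : ℂ, z.im ∈ uIcc 0 h → ‖f z‖ ≤ C * Real.exp (-(δ * |z.re|))) :
    ∫ x : ℝ, f (x + h * I) = ∫ x : ℝ, f x := by
  have hcont : ∀ y ∈ uIcc 0 h, Continuous fun x : ℝ => f (x + y * I) := fun y hy => by
    refine hf.continuousOn.comp_continuous (by fun_prop) fun x => ?_
    simpa using hy
  have hint : ∀ y ∈ uIcc 0 h, Integrable fun x : ℝ => f (x + y * I) := fun y hy => by
    refine ((integrable_exp_neg_mul_abs hδ).const_mul C).mono'
      (hcont y hy).aestronglyMeasurable (ae_of_all _ fun x => ?_)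
    simpa using hb (x + y * I) (by simpa using hy)
  have hlim : ∀ y ∈ uIcc 0 h, Tendsto (fun n : ℕ => ∫ x in (-(n : ℝ))..n, f (x + y * I)) atTop
      (𝓝 (∫ x : ℝ, f (x + y * I))) := fun y hy =>
    intervalIntegral_tendsto_integral (hint y hy)
      (tendsto_neg_atTop_atBot.comp tendsto_natCast_atTop_atTop) tendsto_natCast_atTop_atTop
  -- The vertical sides of the rectangle have fixed length and lie at real part ±n, where the
  -- integrand is exponentially small.
  have hside : ∀ σ : ℝ, |σ| = 1 → Tendsto (fun n : ℕ => I • ∫ y in (0:ℝ)..h, f ((σ * n : ℝ) + y * I))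
      atTop (𝓝 0) := fun σ hσ => by
    have hz : Tendsto (fun n : ℕ => C * Real.exp (-(δ * (n : ℝ))) * |h - 0|) atTop (𝓝 0) := by
      have h1 : Tendsto (fun n : ℕ => Real.exp (-(δ * (n : ℝ)))) atTop (𝓝 0) :=
        Real.tendsto_exp_neg_atTop_nhds_zero.comp
          (tendsto_natCast_atTop_atTop.const_mul_atTop hδ)
      simpa using (h1.const_mul C).mul_const |h - 0|
    refine squeeze_zero_norm (fun n => ?_) hz
    rw [norm_smul, norm_I, one_mul]
    refine intervalIntegral.norm_integral_le_of_norm_le_const fun y hy => ?_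
    have := hb ((σ * n : ℝ) + y * I) (by simpa using uIoc_subset_uIcc hy)
    simpa [abs_mul, hσ] using this
  have hrect : ∀ n : ℕ, (∫ x in (-(n : ℝ))..n, f (x + h * I)) =
      (∫ x in (-(n : ℝ))..n, f (x + (0 : ℝ) * I))
      + (I • ∫ y in (0:ℝ)..h, f (((1 : ℝ) * n : ℝ) + y * I))
      - (I • ∫ y in (0:ℝ)..h, f (((-1 : ℝ) * n : ℝ) + y * I)) := fun n => by
    have := integral_boundary_rect_eq_zero_of_differentiableOn f (-(n : ℝ) : ℝ)
      ((n : ℝ) + h * I) (hf.mono fun z hz => by simpa using hz.2)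
    simp only [ofReal_re, ofReal_im, add_re, mul_re, I_re, mul_zero, I_im, mul_one, sub_self,
      add_zero, add_im, mul_im, zero_add] at this
    rw [one_mul, neg_one_mul]
    linear_combination -this
  have h0 : (0 : ℝ) ∈ uIcc 0 h := left_mem_uIcc
  have hh : h ∈ uIcc 0 h := right_mem_uIcc
  have hfin := ((hlim 0 h0).add (hside 1 (by simp))).sub (hside (-1) (by simp))
  have := tendsto_nhds_unique (hlim h hh) (hfin.congr fun n => (hrect n).symm)
  simpa using this

/-- A holomorphic function of period `1` on the right half-plane that grows more slowly than
`exp (2π |Im z|)` is constant. -/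
lemma eq_of_periodic_of_growth {h : ℂ → ℂ} {C c Y : ℝ} (hY : 0 < Y) (hc0 : 0 ≤ c) (hc : c < 2 * Real.pi)
    (hd : DifferentiableOn ℂ h {z : ℂ | 0 < z.re})
    (hper : ∀ z : ℂ, 0 < z.re → h (z + 1) = h z)
    (hg : ∀ z : ℂ, 1 ≤ z.re → z.re ≤ 2 → Y ≤ |z.im| → ‖h z‖ ≤ C * Real.exp (c * |z.im|))
    {z w : ℂ} (hz : 0 < z.re) (hw : 0 < w.re) : h z = h w := by
  have hnat : ∀ (n : ℕ) (z : ℂ), 0 < z.re → h (z + n) = h z := by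
    intro n
    induction n with
    | zero => simp
    | succ n ih =>
      intro z hz
      have hzn : 0 < (z + n).re := by simp; positivity
      push_cast
      rw [← add_assoc, hper _ hzn, ih z hz]
  -- The periodic extension of `h` to the whole plane: every point is moved to the strip 1 ≤ Re < 2,
  -- where the growth bound is assumed.
  set H : ℂ → ℂ := fun z => h (z - (⌊z.re⌋ : ℤ) + 1) with hHdef
  have hH : ∀ z : ℂ, 0 < z.re → H z = h z := fun z hz => by
    obtain ⟨k, hk⟩ := Int.eq_ofNat_of_zero_le (Int.floor_nonneg.2 hz.le)
    have h1 := hnat k (z - (⌊z.re⌋ : ℤ) + 1) (by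
      simp; linarith [Int.fract_nonneg z.re])
    rw [hHdef]
    simp only
    rw [← h1, hk]
    push_cast
    rw [show z - (k : ℂ) + 1 + k = z + 1 by ring, hper z hz]
  have hHper : Function.Periodic H ((1 : ℝ) : ℂ) := fun z => by
    simp only [hHdef, ofReal_one, add_re, one_re, Int.floor_add_one]
    congr 1
    push_cast
    ring
  have hHd : ∀ z, DifferentiableAt ℂ H z := fun z₀ => by
    obtain ⟨n, hn⟩ := exists_nat_gt (-z₀.re)
    have hn' : 0 < (z₀ + n).re := by simp; linarith
    have hopen : IsOpen {z : ℂ | 0 < z.re} := isOpen_lt continuous_const continuous_re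
    have h1 : DifferentiableAt ℂ (fun z => h (z + n)) z₀ :=
      DifferentiableAt.comp z₀ (hd.differentiableAt (hopen.mem_nhds hn'))
        (differentiableAt_id.add_const (n : ℂ))
    refine h1.congr_of_eventuallyEq ?_
    have hcont : Continuous fun z : ℂ => z + n := by fun_prop
    filter_upwards [(hopen.preimage hcont).mem_nhds hn'] with z hz
    rw [← hH _ hz]
    have := hHper.nat_mul n z
    simpa using this.symm
  have hHg : ∀ z : ℂ, Y ≤ |z.im| → ‖H z‖ ≤ C * Real.exp (c * |z.im|) := fun z hz => by
    have := hg (z - (⌊z.re⌋ : ℤ) + 1) (by simp)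
      (by simp; linarith [Int.fract_lt_one z.re]) (by simpa using hz)
    simpa using this
  set F := Function.Periodic.cuspFunction 1 H with hF
  have hFd : ∀ q : ℂ, q ≠ 0 → DifferentiableAt ℂ F q := fun q hq => by
    rw [← Function.Periodic.qParam_right_inv one_ne_zero hq]
    exact Function.Periodic.differentiableAt_cuspFunction one_ne_zero hHper (hHd _)
  have hpi := Real.pi_pos
  have hFg : ∀ q : ℂ, q ≠ 0 → 2 * Real.pi * Y ≤ |Real.log ‖q‖| →
      ‖F q‖ ≤ C * Real.exp (c / (2 * Real.pi) * |Real.log ‖q‖|) := fun q hq hlog => by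
    rw [hF, Function.Periodic.cuspFunction_eq_of_nonzero _ _ hq]
    have him : |(Function.Periodic.invQParam 1 q).im| = |Real.log ‖q‖| / (2 * Real.pi) := by
      rw [Function.Periodic.im_invQParam, abs_mul, abs_div, abs_neg, abs_one,
        abs_of_pos (by positivity : 0 < 2 * Real.pi)]
      ring
    refine (hHg _ ?_).trans (le_of_eq ?_)
    · rw [him, le_div_iff₀ (by positivity)]; linarith
    · rw [him]; ring_nf
  -- In the variable q = exp(2πiz) the bound reads |F(q)| ≤ C |q|^(±c/2π) near infinity and near 0
  -- respectively. The exponent is below 1, and `δ` is the room left.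
  set δ : ℝ := 1 - c / (2 * Real.pi) with hδ
  have hδpos : 0 < δ := by
    rw [hδ, sub_pos, div_lt_one (by positivity)]; exact hc
  have hlog0 : Tendsto (fun q : ℂ => Real.log ‖q‖) (𝓝[≠] 0) atBot :=
    Real.tendsto_log_nhdsGT_zero.comp tendsto_norm_nhdsNE_zero
  -- Since |q F(q)| ≤ C |q|^δ near 0, the singularity of `F` at 0 is removable.
  have hsmall : (fun q => F q - F 0) =o[𝓝[≠] 0] fun q => (q - 0)⁻¹ := by
    have h0 : ∀ᶠ q : ℂ in 𝓝[≠] 0, q ≠ 0 := eventually_mem_nhdsWithin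
    refine (Asymptotics.isLittleO_iff_tendsto' ?_).2 ?_
    · filter_upwards [h0] with q hq h'
      simp [hq] at h'
    · have hid : Tendsto (fun q : ℂ => q) (𝓝[≠] 0) (𝓝 0) := tendsto_id.mono_left nhdsWithin_le_nhds
      have h1 : Tendsto (fun q => F q * q) (𝓝[≠] 0) (𝓝 0) := by
        have hb : Tendsto (fun q : ℂ => C * Real.exp (δ * Real.log ‖q‖)) (𝓝[≠] 0) (𝓝 0) := by
          have := (Real.tendsto_exp_atBot.comp (hlog0.const_mul_atBot hδpos)).const_mul C
          simpa [Function.comp_def] using this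
        refine squeeze_zero_norm' ?_ hb
        filter_upwards [h0, hlog0.eventually_le_atBot (-(2 * Real.pi * Y))] with q hq hl
        have hln : |Real.log ‖q‖| = -Real.log ‖q‖ := abs_of_nonpos (by nlinarith)
        have := hFg q hq (by rw [hln]; linarith)
        rw [norm_mul]
        calc ‖F q‖ * ‖q‖ ≤ C * Real.exp (c / (2 * Real.pi) * |Real.log ‖q‖|) * ‖q‖ := by gcongr
          _ = C * Real.exp (δ * Real.log ‖q‖) := by
            nth_rewrite 2 [← Real.exp_log (norm_pos_iff.2 hq)]
            rw [mul_assoc, ← Real.exp_add, hln, hδ]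
            ring_nf
      have h2 := h1.sub (hid.const_mul (F 0))
      simp only [mul_zero, sub_zero] at h2
      refine h2.congr fun q => ?_
      simp [sub_mul]
  set F' := Function.update F 0 (limUnder (𝓝[≠] 0) F) with hF'
  have hF'd : Differentiable ℂ F' := by
    rw [← differentiableOn_univ]
    refine Complex.differentiableOn_update_limUnder_of_isLittleO univ_mem (fun q hq => ?_) hsmall
    exact (hFd q (by simpa using hq)).differentiableWithinAt
  have hFF' : ∀ q : ℂ, q ≠ 0 → F' q = F q := fun q hq => Function.update_of_ne hq _ _
  have hC : 0 ≤ C := by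
    have := (norm_nonneg _).trans (hg ⟨1, Y⟩ le_rfl (by norm_num) (le_abs_self _))
    exact nonneg_of_mul_nonneg_left this (Real.exp_pos _)
  -- Growth slower than linear at infinity: Cauchy's estimate on the circle of radius `R` bounds the
  -- derivative by 2C (2R)^(-δ), which tends to 0.
  have hderiv : ∀ q, deriv F' q = 0 := fun q => by
    rw [← norm_le_zero_iff]
    have hlim : Tendsto (fun R : ℝ => 2 * C * Real.exp (-δ * Real.log (2 * R))) atTop (𝓝 0) := by
      have h1 : Tendsto (fun R : ℝ => Real.log (2 * R)) atTop atTop :=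
        Real.tendsto_log_atTop.comp (tendsto_id.const_mul_atTop two_pos)
      have := (Real.tendsto_exp_atBot.comp
        (h1.const_mul_atTop_of_neg (neg_neg_of_pos hδpos))).const_mul (2 * C)
      simpa [Function.comp_def] using this
    refine ge_of_tendsto hlim ?_
    filter_upwards [eventually_gt_atTop (‖q‖ + Real.exp (2 * Real.pi * Y))] with R hR
    have he := Real.exp_pos (2 * Real.pi * Y)
    have hRpos : 0 < R := by linarith [norm_nonneg q]
    have hbd : ∀ w ∈ Metric.sphere q R,
        ‖F' w‖ ≤ C * Real.exp (c / (2 * Real.pi) * Real.log (2 * R)) := fun w hw => by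
      have hw' : ‖w - q‖ = R := by simpa [dist_eq] using hw
      have hw1 : Real.exp (2 * Real.pi * Y) < ‖w‖ := by
        have := norm_sub_le w q
        linarith
      have hw2 : ‖w‖ ≤ 2 * R := by
        have := norm_add_le (w - q) q
        rw [sub_add_cancel] at this
        linarith
      have hw0 : 0 < ‖w‖ := he.trans hw1
      have hl : 2 * Real.pi * Y ≤ Real.log ‖w‖ := (Real.le_log_iff_exp_le hw0).2 hw1.le
      have hln : |Real.log ‖w‖| = Real.log ‖w‖ := abs_of_nonneg (by nlinarith)
      rw [hFF' w (norm_pos_iff.1 hw0)]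
      refine (hFg w (norm_pos_iff.1 hw0) (by rw [hln]; exact hl)).trans ?_
      rw [hln]
      gcongr
    refine (norm_deriv_le_of_forall_mem_sphere_norm_le hRpos hF'd.diffContOnCl hbd).trans
      (le_of_eq ?_)
    have h2R : R = Real.exp (Real.log (2 * R)) / 2 := by
      rw [Real.exp_log (by positivity)]; ring
    have : Real.exp (-δ * Real.log (2 * R)) =
        Real.exp (c / (2 * Real.pi) * Real.log (2 * R)) / Real.exp (Real.log (2 * R)) := by
      rw [← Real.exp_sub, hδ]; ring_nf
    rw [this, Real.exp_log (by positivity)]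
    field_simp
  have hconst : ∀ z, H z = F' (Function.Periodic.qParam 1 z) := fun z => by
    rw [hFF' _ (Function.Periodic.qParam_ne_zero _), hF,
      Function.Periodic.eq_cuspFunction one_ne_zero hHper]
  rw [← hH z hz, ← hH w hw, hconst z, hconst w]
  exact is_const_of_deriv_eq_zero hF'd hderiv _ _

lemma differentiableAt_Gamma_of_re_pos {s : ℂ} (hs : 0 < s.re) :
    DifferentiableAt ℂ Complex.Gamma s :=
  Complex.differentiableAt_Gamma s fun m h => by
    have : (0 : ℝ) ≤ m := m.cast_nonneg
    rw [h] at hs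
    simp at hs
    linarith

lemma continuous_Gamma_comp {X : Type*} [TopologicalSpace X] {f : X → ℂ} (hf : Continuous f)
    (h : ∀ x, 0 < (f x).re) : Continuous fun x => Complex.Gamma (f x) :=
  continuous_iff_continuousAt.2 fun x =>
    (differentiableAt_Gamma_of_re_pos (h x)).continuousAt.comp hf.continuousAt

lemma exists_norm_Gamma_sub_le {A : ℂ} (hA : 0 < A.re) :
    ∃ C : ℝ, 0 < C ∧ ∀ y : ℝ,
      ‖Complex.Gamma (A - I * y)‖ ≤ C * Real.exp (-(decayRate * |y|)) := by
  obtain ⟨C, hC, h⟩ := exists_norm_Gamma_add_le hA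
  refine ⟨C, hC, fun y => ?_⟩
  have := h (-y)
  rw [abs_neg] at this
  simpa [sub_eq_add_neg] using this

lemma exists_norm_Gamma_add_le_strip {A : ℂ} {h : ℝ} (hA : 0 < A.re) (hA' : 0 < A.re - h) :
    ∃ C : ℝ, 0 < C ∧ ∀ z : ℂ, z.im ∈ uIcc 0 h →
      ‖Complex.Gamma (A + I * z)‖ ≤ C * Real.exp (-(decayRate * |z.re|)) := by
  obtain ⟨C, hC, hb⟩ := exists_norm_Gamma_le (m := min A.re (A.re - h)) (M := max A.re (A.re - h))
    (lt_min hA hA')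
  refine ⟨C * Real.exp (decayRate * |A.im|), by positivity, fun z hz => ?_⟩
  have hre : min A.re (A.re - h) ≤ (A + I * z).re ∧ (A + I * z).re ≤ max A.re (A.re - h) := by
    simp only [add_re, mul_re, I_re, I_im, zero_mul, one_mul, zero_sub]
    rcases mem_uIcc.1 hz with ⟨h1, h2⟩ | ⟨h1, h2⟩
    · exact ⟨(min_le_right _ _).trans (by linarith), le_trans (by linarith) (le_max_left _ _)⟩
    · exact ⟨(min_le_left _ _).trans (by linarith), le_trans (by linarith) (le_max_right _ _)⟩
  refine (hb (A + I * z) hre.1 hre.2).trans ?_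
  rw [mul_assoc, ← Real.exp_add]
  refine mul_le_mul_of_nonneg_left (Real.exp_le_exp.2 ?_) hC.le
  have h1 : |z.re| ≤ |(A + I * z).im| + |A.im| := by
    have := abs_sub (A + I * z).im A.im
    simpa using this
  nlinarith [decayRate_pos]

lemma exists_norm_Gamma_sub_le_strip {A : ℂ} {h : ℝ} (hA : 0 < A.re) (hA' : 0 < A.re + h) :
    ∃ C : ℝ, 0 < C ∧ ∀ z : ℂ, z.im ∈ uIcc 0 h →
      ‖Complex.Gamma (A - I * z)‖ ≤ C * Real.exp (-(decayRate * |z.re|)) := by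
  obtain ⟨C, hC, hb⟩ := exists_norm_Gamma_add_le_strip (h := -h) hA (by linarith)
  refine ⟨C, hC, fun z hz => ?_⟩
  have := hb (-z) (by
    rw [neg_im]
    rcases mem_uIcc.1 hz with ⟨h1, h2⟩ | ⟨h1, h2⟩
    · exact mem_uIcc.2 (Or.inr ⟨by linarith, by linarith⟩)
    · exact mem_uIcc.2 (Or.inl ⟨by linarith, by linarith⟩))
  simpa [sub_eq_add_neg] using this

lemma exists_norm_inv_Gamma_add_le (b : ℂ) (M : ℝ) (hb : 0 < b.re) :
    ∃ C Y : ℝ, 0 < C ∧ 0 < Y ∧ ∀ z : ℂ, 0 < z.re → z.re ≤ M → Y ≤ |z.im| →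
      ‖(Complex.Gamma (z + b))⁻¹‖ ≤ C * Real.exp ((Real.pi - decayRate) * |z.im|) := by
  obtain ⟨C, hC, h⟩ := exists_norm_inv_Gamma_le (M + b.re)
  have hr : 0 ≤ Real.pi - decayRate := by unfold decayRate; linarith [Real.pi_pos]
  refine ⟨C * Real.exp ((Real.pi - decayRate) * |b.im|), 1 + |b.im|, by positivity, by positivity,
    fun z h1 h2 h3 => ?_⟩
  have ha : |z.im| ≤ |(z + b).im| + |b.im| := by
    have := abs_sub (z + b).im b.im
    simpa using this
  refine (h (z + b) (by simp; linarith) (by simp; linarith) (by linarith)).trans ?_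
  rw [mul_assoc, ← Real.exp_add, ← mul_add]
  have : |(z + b).im| ≤ |b.im| + |z.im| := by
    rw [add_im, add_comm]; exact abs_add_le _ _
  gcongr

lemma integrable_of_norm_le_exp {f : ℝ → ℂ} {C δ : ℝ} (hf : Continuous f) (hδ : 0 < δ)
    (hb : ∀ x, ‖f x‖ ≤ C * Real.exp (-(δ * |x|))) : Integrable f :=
  ((integrable_exp_neg_mul_abs hδ).const_mul C).mono' hf.aestronglyMeasurable (ae_of_all _ hb)

/-! ### Barnes' first lemma -/

/-- The integrand of Barnes' first lemma. -/
noncomputable def barnes (a b c d z : ℂ) : ℂ :=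
  Complex.Gamma (a + I * z) * Complex.Gamma (b + I * z) * Complex.Gamma (c - I * z)
    * Complex.Gamma (d - I * z)

lemma continuous_barnes {a b c d : ℂ} (ha : 0 < a.re) (hb : 0 < b.re) (hc : 0 < c.re)
    (hd : 0 < d.re) : Continuous fun y : ℝ => barnes a b c d y := by
  unfold barnes
  refine ((Continuous.mul ?_ ?_).mul ?_).mul ?_ <;>
    exact continuous_Gamma_comp (by fun_prop) (by simpa)

lemma integrable_barnes {a b c d : ℂ} (ha : 0 < a.re) (hb : 0 < b.re) (hc : 0 < c.re)
    (hd : 0 < d.re) : Integrable fun y : ℝ => barnes a b c d y := by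
  obtain ⟨C₁, h₁, b₁⟩ := exists_norm_Gamma_add_le ha
  obtain ⟨C₂, h₂, b₂⟩ := exists_norm_Gamma_add_le hb
  obtain ⟨C₃, h₃, b₃⟩ := exists_norm_Gamma_sub_le hc
  obtain ⟨C₄, h₄, b₄⟩ := exists_norm_Gamma_sub_le hd
  refine integrable_of_norm_le_exp (C := C₁ * C₂ * C₃ * C₄) (δ := 4 * decayRate)
    (continuous_barnes ha hb hc hd) (by linarith [decayRate_pos]) fun y => ?_
  have he : Real.exp (-(4 * decayRate * |y|)) = Real.exp (-(decayRate * |y|))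
      * Real.exp (-(decayRate * |y|)) * Real.exp (-(decayRate * |y|))
      * Real.exp (-(decayRate * |y|)) := by
    simp only [← Real.exp_add]; ring_nf
  rw [barnes, norm_mul, norm_mul, norm_mul, he]
  calc _ ≤ (C₁ * Real.exp (-(decayRate * |y|))) * (C₂ * Real.exp (-(decayRate * |y|)))
        * (C₃ * Real.exp (-(decayRate * |y|))) * (C₄ * Real.exp (-(decayRate * |y|))) := by
        gcongr <;> first | exact b₁ y | exact b₂ y | exact b₃ y | exact b₄ y
    _ = _ := by ring

/-- Raise `c` and `d` by one and shift the contour by -i. This gives equal integrals of (c-iy)(d-iy)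
and (a+iy)(b+iy) against `barnes a b c d`, and the equation follows from (a+b+c+d)(a+iy) -
(a+c)(a+d) = (a+iy)(b+iy) - (c-iy)(d-iy). -/
lemma barnes_integral_add_one {a b c d : ℂ} (ha : 0 < a.re) (hb : 0 < b.re) (hc : 0 < c.re)
    (hd : 0 < d.re) :
    (a + b + c + d) * ∫ y : ℝ, barnes (a + 1) b c d y
      = (a + c) * (a + d) * ∫ y : ℝ, barnes a b c d y := by
  have hG : ∀ s : ℂ, 0 < s.re → Complex.Gamma (s + 1) = s * Complex.Gamma s := fun s hs =>
    Complex.Gamma_add_one s fun h => by simp [h] at hs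
  have hc1 : 0 < (c + 1).re := by simp; linarith
  have hd1 : 0 < (d + 1).re := by simp; linarith
  have ha1 : 0 < (a + 1).re := by simp; linarith
  have hb1 : 0 < (b + 1).re := by simp; linarith
  obtain ⟨C₁, h₁, b₁⟩ := exists_norm_Gamma_add_le_strip (h := -1) ha (by linarith)
  obtain ⟨C₂, h₂, b₂⟩ := exists_norm_Gamma_add_le_strip (h := -1) hb (by linarith)
  obtain ⟨C₃, h₃, b₃⟩ := exists_norm_Gamma_sub_le_strip (h := -1) hc1 (by simpa)
  obtain ⟨C₄, h₄, b₄⟩ := exists_norm_Gamma_sub_le_strip (h := -1) hd1 (by simpa)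
  have hshift := integral_horizontal_shift (f := barnes a b (c + 1) (d + 1)) (h := -1)
    (C := C₁ * C₂ * C₃ * C₄) (δ := 4 * decayRate) (by linarith [decayRate_pos]) ?_ ?_
  · have e0 : ∀ y : ℝ, barnes a b (c + 1) (d + 1) y
        = (c - I * y) * (d - I * y) * barnes a b c d y := fun y => by
      unfold barnes
      rw [show c + 1 - I * y = (c - I * y) + 1 by ring, show d + 1 - I * y = (d - I * y) + 1 by ring,
        hG _ (by simpa), hG _ (by simpa)]
      ring
    have e1 : ∀ y : ℝ, barnes a b (c + 1) (d + 1) (y + (-1 : ℝ) * I)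
        = (a + I * y) * (b + I * y) * barnes a b c d y := fun y => by
      unfold barnes
      have hI : I * ((y : ℂ) + (-1 : ℝ) * I) = I * y + 1 := by
        push_cast; linear_combination -I_mul_I
      rw [hI, show a + (I * y + 1) = (a + I * y) + 1 by ring,
        show b + (I * y + 1) = (b + I * y) + 1 by ring,
        show c + 1 - (I * y + 1) = c - I * y by ring, show d + 1 - (I * y + 1) = d - I * y by ring,
        hG _ (by simpa), hG _ (by simpa)]
      ring
    have e2 : ∀ y : ℝ, barnes (a + 1) b c d y = (a + I * y) * barnes a b c d y := fun y => by
      unfold barnes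
      rw [show a + 1 + I * y = (a + I * y) + 1 by ring, hG _ (by simpa)]
      ring
    have i0 : Integrable fun y : ℝ => barnes a b (c + 1) (d + 1) y :=
      integrable_barnes ha hb hc1 hd1
    have i1 : Integrable fun y : ℝ => barnes a b (c + 1) (d + 1) (y + (-1 : ℝ) * I) := by
      refine (integrable_barnes ha1 hb1 hc hd).congr (ae_of_all _ fun y => ?_)
      beta_reduce
      rw [e1]
      unfold barnes
      rw [show a + 1 + I * y = (a + I * y) + 1 by ring,
        show b + 1 + I * y = (b + I * y) + 1 by ring, hG _ (by simpa), hG _ (by simpa)]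
      ring
    rw [← sub_eq_zero, ← integral_const_mul, ← integral_const_mul, ← integral_sub
      ((integrable_barnes ha1 hb hc hd).const_mul _) ((integrable_barnes ha hb hc hd).const_mul _)]
    rw [← sub_eq_zero, ← integral_sub i1 i0] at hshift
    rw [← hshift]
    refine integral_congr_ae (ae_of_all _ fun y => ?_)
    simp only [e0, e1, e2]
    ring
  · intro z hz
    have hz' : -1 ≤ z.im ∧ z.im ≤ 0 := by simpa using hz
    unfold barnes
    refine DifferentiableAt.differentiableWithinAt ?_
    refine ((DifferentiableAt.mul ?_ ?_).mul ?_).mul ?_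
    · exact (differentiableAt_Gamma_of_re_pos (by simp; linarith)).comp z (by fun_prop)
    · exact (differentiableAt_Gamma_of_re_pos (by simp; linarith)).comp z (by fun_prop)
    · exact DifferentiableAt.comp z (f := fun z => c + 1 - I * z)
        (differentiableAt_Gamma_of_re_pos (by simp; linarith)) (by fun_prop)
    · exact DifferentiableAt.comp z (f := fun z => d + 1 - I * z)
        (differentiableAt_Gamma_of_re_pos (by simp; linarith)) (by fun_prop)
  · intro z hz
    have he : Real.exp (-(4 * decayRate * |z.re|)) = Real.exp (-(decayRate * |z.re|))
        * Real.exp (-(decayRate * |z.re|)) * Real.exp (-(decayRate * |z.re|))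
        * Real.exp (-(decayRate * |z.re|)) := by
      simp only [← Real.exp_add]; ring_nf
    rw [barnes, norm_mul, norm_mul, norm_mul, he]
    calc _ ≤ (C₁ * Real.exp (-(decayRate * |z.re|))) * (C₂ * Real.exp (-(decayRate * |z.re|)))
          * (C₃ * Real.exp (-(decayRate * |z.re|))) * (C₄ * Real.exp (-(decayRate * |z.re|))) := by
          gcongr <;> first | exact b₁ z hz | exact b₂ z hz | exact b₃ z hz | exact b₄ z hz
      _ = _ := by ring

lemma Gamma_half_add_mul_Gamma_half_sub (y : ℝ) :
    Complex.Gamma (1 / 2 + I * y) * Complex.Gamma (1 / 2 - I * y)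
      = Real.pi / Real.cosh (Real.pi * y) := by
  have h := Complex.Gamma_mul_Gamma_one_sub (1 / 2 + I * y)
  rw [show (1 : ℂ) - (1 / 2 + I * y) = 1 / 2 - I * y by ring] at h
  rw [h, show (Real.pi : ℂ) * (1 / 2 + I * y) = (Real.pi * y : ℝ) * I + Real.pi / 2 by
    push_cast; ring, Complex.sin_add_pi_div_two, Complex.cos_mul_I, ← Complex.ofReal_cosh]

/-- The constants may depend on the strip but the integrable majorant does not, so holomorphy on the
whole half-plane follows from one integrability check. -/
lemma differentiableOn_integral_of_locally_bound {F : ℂ → ℝ → ℂ} {bound : ℝ → ℝ}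
    (hint : Integrable bound)
    (hb : ∀ m M : ℝ, 0 < m → ∃ C : ℝ, ∀ a : ℂ, m ≤ a.re → a.re ≤ M → ∀ y, ‖F a y‖ ≤ C * bound y)
    (hd : ∀ y, ∀ a : ℂ, 0 < a.re → DifferentiableAt ℂ (fun a => F a y) a)
    (hm : ∀ a : ℂ, 0 < a.re → AEStronglyMeasurable (F a)) :
    DifferentiableOn ℂ (fun a => ∫ y, F a y) {a : ℂ | 0 < a.re} := by
  intro a ha
  have ha' : 0 < a.re := ha
  have hball : ∀ z ∈ Metric.ball a (a.re / 2), a.re / 2 ≤ z.re ∧ z.re ≤ 2 * a.re := fun z hz => by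
    have h2 := (abs_re_le_norm (z - a)).trans_lt (by simpa [dist_eq] using hz)
    rw [sub_re, abs_lt] at h2
    constructor <;> linarith
  obtain ⟨C, hC⟩ := hb (a.re / 2) (2 * a.re) (by linarith)
  refine (differentiableAt_integral_of_bound (R := a.re / 2) (by linarith)
    (bound := fun y => C * bound y) (fun z hz => hm z (by linarith [(hball z hz).1]))
    (ae_of_all _ fun y z hz => (hd y z (by linarith [(hball z hz).1])).differentiableWithinAt)
    (ae_of_all _ fun y z hz => hC z (hball z hz).1 (hball z hz).2 y)
    (hint.const_mul C)).differentiableWithinAt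

lemma exists_norm_integral_le_of_locally_bound {F : ℂ → ℝ → ℂ} {bound : ℝ → ℝ}
    (hint : Integrable bound)
    (hb : ∀ m M : ℝ, 0 < m → ∃ C : ℝ, ∀ a : ℂ, m ≤ a.re → a.re ≤ M → ∀ y, ‖F a y‖ ≤ C * bound y) :
    ∃ K : ℝ, ∀ a : ℂ, 1 ≤ a.re → a.re ≤ 2 → ‖∫ y, F a y‖ ≤ K := by
  obtain ⟨C, hC⟩ := hb 1 2 one_pos
  exact ⟨∫ y, C * bound y, fun a h1 h2 =>
    norm_integral_le_of_norm_le (hint.const_mul C) (ae_of_all _ (hC a h1 h2))⟩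

/-- Uniqueness for the difference equation `J (a + 1) = (a + p) (a + q) J a`. -/
lemma div_Gamma_mul_Gamma_eq {J : ℂ → ℂ} {p q : ℂ} (hp : 0 < p.re) (hq : 0 < q.re)
    (hd : DifferentiableOn ℂ J {a : ℂ | 0 < a.re})
    (hK : ∃ K : ℝ, ∀ a : ℂ, 1 ≤ a.re → a.re ≤ 2 → ‖J a‖ ≤ K)
    (hrec : ∀ a : ℂ, 0 < a.re → J (a + 1) = (a + p) * (a + q) * J a)
    {z w : ℂ} (hz : 0 < z.re) (hw : 0 < w.re) :
    J z / (Complex.Gamma (z + p) * Complex.Gamma (z + q))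
      = J w / (Complex.Gamma (w + p) * Complex.Gamma (w + q)) := by
  obtain ⟨K, hK⟩ := hK
  obtain ⟨C₁, Y₁, hC₁, hY₁, h₁⟩ := exists_norm_inv_Gamma_add_le p 2 hp
  obtain ⟨C₂, Y₂, hC₂, hY₂, h₂⟩ := exists_norm_inv_Gamma_add_le q 2 hq
  -- On 1 ≤ Re a ≤ 2 the numerator is bounded and each of the two reciprocal Gammas grows at rate at
  -- most `π - decayRate`; the sum of the two rates is below 2π.
  refine eq_of_periodic_of_growth
    (h := fun z => J z / (Complex.Gamma (z + p) * Complex.Gamma (z + q)))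
    (Y := max Y₁ Y₂) (C := K * (C₁ * C₂)) (c := 2 * (Real.pi - decayRate))
    (lt_max_of_lt_left hY₁) ?_ ?_ ?_ ?_ ?_ hz hw
  · unfold decayRate; linarith [Real.pi_pos]
  · linarith [decayRate_pos]
  · intro a ha
    have ha' : 0 < a.re := ha
    refine (hd a ha).div (DifferentiableAt.differentiableWithinAt ?_) ?_
    · refine DifferentiableAt.mul ?_ ?_
      · exact (differentiableAt_Gamma_of_re_pos (by simp; linarith)).comp a (by fun_prop)
      · exact (differentiableAt_Gamma_of_re_pos (by simp; linarith)).comp a (by fun_prop)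
    · exact mul_ne_zero (Complex.Gamma_ne_zero_of_re_pos (by simp; linarith))
        (Complex.Gamma_ne_zero_of_re_pos (by simp; linarith))
  · intro a ha
    have hap : 0 < (a + p).re := by simp; linarith
    have haq : 0 < (a + q).re := by simp; linarith
    have hap0 : a + p ≠ 0 := fun h => by simp [h] at hap
    have haq0 : a + q ≠ 0 := fun h => by simp [h] at haq
    rw [hrec a ha, show a + 1 + p = a + p + 1 by ring, show a + 1 + q = a + q + 1 by ring,
      Complex.Gamma_add_one _ hap0, Complex.Gamma_add_one _ haq0]
    have h1 := Complex.Gamma_ne_zero_of_re_pos hap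
    have h2 := Complex.Gamma_ne_zero_of_re_pos haq
    field_simp
  · intro a h1 h2 h3
    have hK0 := hK a h1 h2
    have e1 := h₁ a (by linarith) h2 ((le_max_left _ _).trans h3)
    have e2 := h₂ a (by linarith) h2 ((le_max_right _ _).trans h3)
    rw [div_eq_mul_inv, mul_inv, norm_mul, norm_mul]
    have hK' : 0 ≤ K := (norm_nonneg _).trans hK0
    calc _ ≤ K * (C₁ * Real.exp ((Real.pi - decayRate) * |a.im|)
          * (C₂ * Real.exp ((Real.pi - decayRate) * |a.im|))) := by gcongr
      _ = K * (C₁ * C₂) * (Real.exp ((Real.pi - decayRate) * |a.im|)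
          * Real.exp ((Real.pi - decayRate) * |a.im|)) := by ring
      _ = _ := by rw [← Real.exp_add]; ring_nf

lemma exists_norm_Gamma_le_const {m M : ℝ} (hm : 0 < m) :
    ∃ C : ℝ, ∀ s : ℂ, m ≤ s.re → s.re ≤ M → ‖Complex.Gamma s‖ ≤ C := by
  obtain ⟨C, hC, h⟩ := exists_norm_Gamma_le (M := M) hm
  refine ⟨C, fun s h1 h2 => (h s h1 h2).trans (mul_le_of_le_one_right hC.le ?_)⟩
  rw [Real.exp_le_one_iff]
  have := mul_nonneg decayRate_pos.le (abs_nonneg s.im)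
  linarith

lemma exists_norm_barnes_le {b c d : ℂ} {m M : ℝ} (hm : 0 < m) :
    ∃ C : ℝ, ∀ a : ℂ, m ≤ a.re → a.re ≤ M → ∀ y : ℝ, ‖barnes a b c d y‖ ≤
      C * ‖Complex.Gamma (b + I * y) * Complex.Gamma (c - I * y) * Complex.Gamma (d - I * y)‖ := by
  obtain ⟨C, hC⟩ := exists_norm_Gamma_le_const (M := M) hm
  refine ⟨C, fun a h1 h2 y => ?_⟩
  rw [barnes, mul_assoc, mul_assoc, ← mul_assoc (Complex.Gamma (b + I * y)), norm_mul]
  exact mul_le_mul_of_nonneg_right (hC _ (by simpa using h1) (by simpa using h2)) (norm_nonneg _)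

lemma integrable_norm_Gamma_mul_three {b c d : ℂ} (hb : 0 < b.re) (hc : 0 < c.re)
    (hd : 0 < d.re) : Integrable fun y : ℝ =>
      ‖Complex.Gamma (b + I * y) * Complex.Gamma (c - I * y) * Complex.Gamma (d - I * y)‖ := by
  obtain ⟨C₂, h₂, b₂⟩ := exists_norm_Gamma_add_le hb
  obtain ⟨C₃, h₃, b₃⟩ := exists_norm_Gamma_sub_le hc
  obtain ⟨C₄, h₄, b₄⟩ := exists_norm_Gamma_sub_le hd
  refine (integrable_of_norm_le_exp (C := C₂ * C₃ * C₄) (δ := 3 * decayRate)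
      ?_ (by linarith [decayRate_pos]) fun y => ?_).norm
  · refine (Continuous.mul ?_ ?_).mul ?_ <;> exact continuous_Gamma_comp (by fun_prop) (by simpa)
  have he : Real.exp (-(3 * decayRate * |y|)) = Real.exp (-(decayRate * |y|))
      * Real.exp (-(decayRate * |y|)) * Real.exp (-(decayRate * |y|)) := by
    simp only [← Real.exp_add]; ring_nf
  rw [norm_mul, norm_mul, he]
  calc _ ≤ (C₂ * Real.exp (-(decayRate * |y|)))
        * (C₃ * Real.exp (-(decayRate * |y|))) * (C₄ * Real.exp (-(decayRate * |y|))) := by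
        gcongr <;> first | exact b₂ y | exact b₃ y | exact b₄ y
    _ = _ := by ring

/-- The quotient of the two sides of Barnes' first lemma. -/
noncomputable def barnesRatio (a b c d : ℂ) : ℂ :=
  (∫ y : ℝ, barnes a b c d y) * Complex.Gamma (a + b + c + d)
    / (Complex.Gamma (a + c) * Complex.Gamma (a + d))
    / (Complex.Gamma (b + c) * Complex.Gamma (b + d))

/-- Multiplied by Γ(a+b+c+d), the Barnes integral satisfies J(a+1) = (a+c)(a+d) J(a), which is the
equation of Γ(a+c)Γ(a+d). -/
lemma barnesRatio_eq_left {a a' b c d : ℂ} (ha : 0 < a.re) (ha' : 0 < a'.re) (hb : 0 < b.re)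
    (hc : 0 < c.re) (hd : 0 < d.re) : barnesRatio a b c d = barnesRatio a' b c d := by
  unfold barnesRatio
  congr 1
  refine div_Gamma_mul_Gamma_eq
    (J := fun a => (∫ y : ℝ, barnes a b c d y) * Complex.Gamma (a + b + c + d)) hc hd
    ?_ ?_ ?_ ha ha'
  · refine DifferentiableOn.mul (differentiableOn_integral_of_locally_bound
      (F := fun a y => barnes a b c d y) (integrable_norm_Gamma_mul_three hb hc hd)
      (fun m M hm => exists_norm_barnes_le hm) (fun y a ha => ?_)
      (fun a ha => (continuous_barnes ha hb hc hd).aestronglyMeasurable)) ?_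
    · unfold barnes
      refine ((DifferentiableAt.mul_const ?_ _).mul_const _).mul_const _
      exact (differentiableAt_Gamma_of_re_pos (by simpa)).comp a (by fun_prop)
    · intro a ha
      have ha' : 0 < a.re := ha
      exact ((differentiableAt_Gamma_of_re_pos (by simp; linarith)).comp a
        (by fun_prop)).differentiableWithinAt
  · obtain ⟨K, hK⟩ := exists_norm_integral_le_of_locally_bound
      (F := fun a y => barnes a b c d y) (integrable_norm_Gamma_mul_three hb hc hd)
      (fun m M hm => exists_norm_barnes_le hm)
    obtain ⟨K', hK'⟩ := exists_norm_Gamma_le_const (m := 1) (M := 2 + b.re + c.re + d.re) one_pos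
    refine ⟨K * K', fun a h1 h2 => ?_⟩
    rw [norm_mul]
    have hK0 := hK a h1 h2
    exact mul_le_mul hK0 (hK' _ (by simp; linarith) (by simp; linarith)) (norm_nonneg _)
      ((norm_nonneg _).trans hK0)
  · intro a ha
    have h0 : 0 < (a + b + c + d).re := by simp; linarith
    have h0' : a + b + c + d ≠ 0 := fun h => by simp [h] at h0
    have := barnes_integral_add_one ha hb hc hd
    rw [show a + 1 + b + c + d = a + b + c + d + 1 by ring, Complex.Gamma_add_one _ h0']
    linear_combination Complex.Gamma (a + b + c + d) * this

lemma barnesRatio_swap (a b c d : ℂ) : barnesRatio a b c d = barnesRatio b a c d := by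
  unfold barnesRatio barnes
  rw [div_right_comm, add_comm a b]
  congr 4
  funext y
  ring

lemma barnesRatio_symm (a b c d : ℂ) : barnesRatio a b c d = barnesRatio c d a b := by
  have h : ∫ y : ℝ, barnes a b c d y = ∫ y : ℝ, barnes c d a b y := by
    rw [← integral_neg_eq_self]
    refine integral_congr_ae (ae_of_all _ fun y => ?_)
    simp only [barnes, ofReal_neg, mul_neg, sub_neg_eq_add, ← sub_eq_add_neg]
    ring
  unfold barnesRatio
  rw [h, div_div, div_div, add_comm c a, add_comm c b, add_comm d a, add_comm d b,
    show a + b + c + d = c + d + a + b by ring]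
  congr 1
  ring

/-- The normalization of Barnes' lemma: at parameters 1/2 the reflection formula turns the integrand
into this elementary one. -/
lemma integral_inv_cosh_sq :
    ∫ y : ℝ, (Real.pi / Real.cosh (Real.pi * y)) ^ 2 = 2 * Real.pi := by
  have hderiv : ∀ y : ℝ, HasDerivAt (fun y => -(2 * Real.pi) / (Real.exp (2 * Real.pi * y) + 1))
      ((Real.pi / Real.cosh (Real.pi * y)) ^ 2) y := fun y => by
    have h1 : HasDerivAt (fun y => Real.exp (2 * Real.pi * y) + 1)
        (Real.exp (2 * Real.pi * y) * (2 * Real.pi)) y := by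
      have := ((hasDerivAt_id y).const_mul (2 * Real.pi)).exp.add_const 1
      simpa using this
    have h0 : Real.exp (2 * Real.pi * y) + 1 ≠ 0 := by positivity
    refine ((hasDerivAt_const y (-(2 * Real.pi))).div h1 h0).congr_deriv ?_
    have e : Real.exp (2 * Real.pi * y) = Real.exp (Real.pi * y) ^ 2 := by
      rw [← Real.exp_nat_mul]; push_cast; ring_nf
    have hE := Real.exp_pos (Real.pi * y)
    rw [Real.cosh_eq, Real.exp_neg, e]
    field_simp
    ring
  have hbot : Tendsto (fun y : ℝ => -(2 * Real.pi) / (Real.exp (2 * Real.pi * y) + 1)) atBot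
      (𝓝 (-(2 * Real.pi))) := by
    have h1 : Tendsto (fun y : ℝ => Real.exp (2 * Real.pi * y) + 1) atBot (𝓝 (0 + 1)) :=
      (Real.tendsto_exp_atBot.comp
        (tendsto_id.const_mul_atBot (by positivity : 0 < 2 * Real.pi))).add_const 1
    have := (tendsto_const_nhds (x := -(2 * Real.pi))).div h1 (by norm_num)
    simpa [Pi.div_def] using this
  have htop : Tendsto (fun y : ℝ => -(2 * Real.pi) / (Real.exp (2 * Real.pi * y) + 1)) atTop
      (𝓝 0) := by
    refine tendsto_const_nhds.div_atTop (tendsto_atTop_add_const_right _ 1 ?_)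
    exact Real.tendsto_exp_atTop.comp (tendsto_id.const_mul_atTop (by positivity))
  have hint : Integrable fun y : ℝ => (Real.pi / Real.cosh (Real.pi * y)) ^ 2 := by
    have hre : (0 : ℝ) < (1 / 2 : ℂ).re := by norm_num
    have := (integrable_barnes hre hre hre hre).re
    refine this.congr (ae_of_all _ fun y => ?_)
    simp only [barnes]
    rw [show ∀ u v : ℂ, u * u * v * v = (u * v) ^ 2 by intros; ring,
      Gamma_half_add_mul_Gamma_half_sub, ← ofReal_div, ← ofReal_pow]
    rfl
  rw [integral_of_hasDerivAt_of_tendsto hderiv hint hbot htop]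
  ring

/-- Barnes' first lemma. -/
theorem integral_barnes {a b c d : ℂ} (ha : 0 < a.re) (hb : 0 < b.re) (hc : 0 < c.re)
    (hd : 0 < d.re) :
    ∫ y : ℝ, barnes a b c d y = 2 * Real.pi * (Complex.Gamma (a + c) * Complex.Gamma (a + d)
      * Complex.Gamma (b + c) * Complex.Gamma (b + d)) / Complex.Gamma (a + b + c + d) := by
  have hre : (0 : ℝ) < (1 / 2 : ℂ).re := by norm_num
  have hval : barnesRatio (1 / 2) (1 / 2) (1 / 2) (1 / 2) = 2 * Real.pi := by
    have h2 : Complex.Gamma (1 / 2 + 1 / 2 + 1 / 2 + 1 / 2) = 1 := by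
      rw [show (1 / 2 + 1 / 2 + 1 / 2 + 1 / 2 : ℂ) = 1 + 1 by norm_num,
        Complex.Gamma_add_one _ one_ne_zero, Complex.Gamma_one, one_mul]
    have h1 : Complex.Gamma (1 / 2 + 1 / 2) = 1 := by
      rw [show (1 / 2 + 1 / 2 : ℂ) = 1 by norm_num, Complex.Gamma_one]
    have hi : ∫ y : ℝ, barnes (1 / 2) (1 / 2) (1 / 2) (1 / 2) y = 2 * Real.pi := by
      rw [show (2 * Real.pi : ℂ) = ((2 * Real.pi : ℝ) : ℂ) by push_cast; rfl,
        ← integral_inv_cosh_sq, ← integral_complex_ofReal]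
      refine integral_congr_ae (ae_of_all _ fun y => ?_)
      simp only [barnes]
      rw [show ∀ u v : ℂ, u * u * v * v = (u * v) ^ 2 by intros; ring,
        Gamma_half_add_mul_Gamma_half_sub]
      push_cast
      rfl
    rw [barnesRatio, hi, h1, h2]
    simp
  -- The symmetries bring each parameter in turn to the first place, where it may be replaced by
  -- 1/2.
  have hratio : barnesRatio a b c d = 2 * Real.pi := by
    rw [barnesRatio_eq_left ha hre hb hc hd, barnesRatio_swap,
      barnesRatio_eq_left hb hre hre hc hd, barnesRatio_symm,
      barnesRatio_eq_left hc hre hd hre hre, barnesRatio_swap,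
      barnesRatio_eq_left hd hre hre hre hre, hval]
  have g1 := Complex.Gamma_ne_zero_of_re_pos (s := a + c) (by simp; linarith)
  have g2 := Complex.Gamma_ne_zero_of_re_pos (s := a + d) (by simp; linarith)
  have g3 := Complex.Gamma_ne_zero_of_re_pos (s := b + c) (by simp; linarith)
  have g4 := Complex.Gamma_ne_zero_of_re_pos (s := b + d) (by simp; linarith)
  have g5 := Complex.Gamma_ne_zero_of_re_pos (s := a + b + c + d) (by simp; linarith)
  unfold barnesRatio at hratio
  rw [eq_div_iff g5]
  field_simp at hratio
  linear_combination hratio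

/-! ### The integral for the continuous dual Hahn weight -/

/-- The product of Gamma functions in the continuous dual Hahn weight. -/
noncomputable def hahnGamma (a b c z : ℂ) : ℂ :=
  (Complex.Gamma (a + I * z) * Complex.Gamma (a - I * z))
  * (Complex.Gamma (b + I * z) * Complex.Gamma (b - I * z))
  * (Complex.Gamma (c + I * z) * Complex.Gamma (c - I * z))

/-- The continuous dual Hahn weight, up to a constant. -/
noncomputable def hahn (a b c z : ℂ) : ℂ := hahnGamma a b c z * (z * sinh (2 * Real.pi * z))

lemma norm_sinh_le (z : ℂ) : ‖sinh z‖ ≤ Real.exp |z.re| := by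
  have h1 : ‖exp z‖ ≤ Real.exp |z.re| := by
    rw [Complex.norm_exp]; exact Real.exp_le_exp.2 (le_abs_self _)
  have h2 : ‖exp (-z)‖ ≤ Real.exp |z.re| := by
    rw [Complex.norm_exp]; exact Real.exp_le_exp.2 (by simpa using neg_le_abs z.re)
  have := norm_sub_le (exp z) (exp (-z))
  rw [sinh, norm_div, div_le_iff₀ (by simp)]
  simp only [Complex.norm_ofNat]
  linarith

/-- The hyperbolic sine contributes 2π = 5 `decayRate`, and half a `decayRate` absorbs the factor
|y|. The total 11/2 is less than the 6 supplied by the six Gammas of the weight. -/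
lemma norm_mul_sinh_le (y : ℝ) :
    ‖(y : ℂ) * sinh (2 * Real.pi * y)‖ ≤ 2 / decayRate * Real.exp (11 / 2 * decayRate * |y|) := by
  have h1 : ‖sinh (2 * Real.pi * y)‖ ≤ Real.exp (2 * Real.pi * |y|) := by
    have h := norm_sinh_le (2 * Real.pi * y)
    rw [show (2 * Real.pi * y : ℂ) = ((2 * Real.pi * y : ℝ) : ℂ) by push_cast; rfl, ofReal_re,
      abs_mul, abs_of_pos (by positivity : 0 < 2 * Real.pi)] at h
    rw [show (2 * Real.pi * y : ℂ) = ((2 * Real.pi * y : ℝ) : ℂ) by push_cast; rfl]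
    exact h
  have hd := decayRate_pos
  have h2 : |y| ≤ 2 / decayRate * Real.exp (decayRate / 2 * |y|) := by
    have := Real.add_one_le_exp (decayRate / 2 * |y|)
    rw [div_mul_eq_mul_div, le_div_iff₀ hd]
    linarith
  rw [norm_mul, norm_real, Real.norm_eq_abs]
  calc _ ≤ (2 / decayRate * Real.exp (decayRate / 2 * |y|)) * Real.exp (2 * Real.pi * |y|) := by
        gcongr
    _ = _ := by
        rw [mul_assoc, ← Real.exp_add, ← add_mul]
        congr 3
        unfold decayRate; ring

lemma exists_norm_hahnGamma_le {b c : ℂ} {m M : ℝ} (hm : 0 < m) (hb : 0 < b.re) (hc : 0 < c.re) :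
    ∃ C : ℝ, 0 < C ∧ ∀ a : ℂ, m ≤ a.re → a.re ≤ M → ∀ y : ℝ,
      ‖hahnGamma a b c y‖ ≤ C * Real.exp (-(6 * decayRate * |y|)) := by
  obtain ⟨C, hC, hCb⟩ := exists_norm_Gamma_le (M := M) hm
  obtain ⟨C₁, h₁, b₁⟩ := exists_norm_Gamma_add_le hb
  obtain ⟨C₂, h₂, b₂⟩ := exists_norm_Gamma_sub_le hb
  obtain ⟨C₃, h₃, b₃⟩ := exists_norm_Gamma_add_le hc
  obtain ⟨C₄, h₄, b₄⟩ := exists_norm_Gamma_sub_le hc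
  refine ⟨C * C * (C₁ * C₂) * (C₃ * C₄), by positivity, fun a h1 h2 y => ?_⟩
  have ha : ‖Complex.Gamma (a + I * y) * Complex.Gamma (a - I * y)‖
      ≤ C * C * Real.exp (-(2 * decayRate * |y|)) := by
    rw [norm_mul]
    have e1 := hCb (a + I * y) (by simpa using h1) (by simpa using h2)
    have e2 := hCb (a - I * y) (by simpa using h1) (by simpa using h2)
    refine (mul_le_mul e1 e2 (norm_nonneg _) (by positivity)).trans ?_
    rw [mul_mul_mul_comm, ← Real.exp_add]
    gcongr
    have : 2 * |y| ≤ |(a + I * y).im| + |(a - I * y).im| := by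
      have := abs_sub (a + I * y).im (a - I * y).im
      have e : (a + I * y).im - (a - I * y).im = 2 * y := by simp; ring
      rw [e, abs_mul, abs_two] at this
      exact this
    nlinarith [decayRate_pos]
  have he : Real.exp (-(6 * decayRate * |y|)) = Real.exp (-(2 * decayRate * |y|))
      * (Real.exp (-(decayRate * |y|)) * Real.exp (-(decayRate * |y|)))
      * (Real.exp (-(decayRate * |y|)) * Real.exp (-(decayRate * |y|))) := by
    simp only [← Real.exp_add]; ring_nf
  rw [hahnGamma, norm_mul, norm_mul, he, norm_mul (Complex.Gamma (b + I * y)),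
    norm_mul (Complex.Gamma (c + I * y))]
  calc _ ≤ (C * C * Real.exp (-(2 * decayRate * |y|)))
        * ((C₁ * Real.exp (-(decayRate * |y|))) * (C₂ * Real.exp (-(decayRate * |y|))))
        * ((C₃ * Real.exp (-(decayRate * |y|))) * (C₄ * Real.exp (-(decayRate * |y|)))) := by
        gcongr <;> first | exact b₁ y | exact b₂ y | exact b₃ y | exact b₄ y
    _ = _ := by ring

lemma exists_norm_hahn_le {b c : ℂ} {m M : ℝ} (hm : 0 < m) (hb : 0 < b.re) (hc : 0 < c.re) :
    ∃ C : ℝ, ∀ a : ℂ, m ≤ a.re → a.re ≤ M → ∀ y : ℝ,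
      ‖hahn a b c y‖ ≤ C * Real.exp (-(decayRate / 2 * |y|)) := by
  obtain ⟨C, hC, h⟩ := exists_norm_hahnGamma_le (M := M) hm hb hc
  refine ⟨C * (2 / decayRate), fun a h1 h2 y => ?_⟩
  rw [hahn, norm_mul]
  refine (mul_le_mul (h a h1 h2 y) (norm_mul_sinh_le y) (norm_nonneg _) (by positivity)).trans
    (le_of_eq ?_)
  rw [mul_mul_mul_comm, ← Real.exp_add]
  ring_nf

lemma continuous_hahnGamma {a b c : ℂ} (ha : 0 < a.re) (hb : 0 < b.re) (hc : 0 < c.re) :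
    Continuous fun y : ℝ => hahnGamma a b c y := by
  unfold hahnGamma
  refine ((Continuous.mul ?_ ?_).mul (Continuous.mul ?_ ?_)).mul (Continuous.mul ?_ ?_) <;>
    exact continuous_Gamma_comp (by fun_prop) (by simpa)

lemma continuous_hahn {a b c : ℂ} (ha : 0 < a.re) (hb : 0 < b.re) (hc : 0 < c.re) :
    Continuous fun y : ℝ => hahn a b c y := by
  unfold hahn
  exact (continuous_hahnGamma ha hb hc).mul (by fun_prop)

lemma integrable_hahn {a b c : ℂ} (ha : 0 < a.re) (hb : 0 < b.re) (hc : 0 < c.re) :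
    Integrable fun y : ℝ => hahn a b c y := by
  obtain ⟨C, h⟩ := exists_norm_hahn_le (M := a.re) ha hb hc
  exact integrable_of_norm_le_exp (continuous_hahn ha hb hc) (half_pos decayRate_pos)
    (h a le_rfl le_rfl)

/-- With one Gamma of each pair raised, the integrand is holomorphic for 0 ≤ Im z ≤ 1/2. On the line
Im z = 1/2 the Gamma pairs are even in Re z, while the shift by πi only changes the sign of sinh;
the integrand is therefore odd there and its integral vanishes. -/
lemma integral_hahn_shift {a b c : ℂ} (ha : 0 < a.re) (hb : 0 < b.re) (hc : 0 < c.re) :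
    Integrable (fun y : ℝ => (a + I * y) * (b + I * y) * (c + I * y) * hahnGamma a b c y
      * sinh (2 * Real.pi * y)) ∧
    ∫ y : ℝ, (a + I * y) * (b + I * y) * (c + I * y) * hahnGamma a b c y
      * sinh (2 * Real.pi * y) = 0 := by
  have hG : ∀ s : ℂ, 0 < s.re → Complex.Gamma (s + 1) = s * Complex.Gamma s := fun s hs =>
    Complex.Gamma_add_one s fun h => by simp [h] at hs
  set V : ℂ → ℂ := fun z => (Complex.Gamma (a + 1 + I * z) * Complex.Gamma (a - I * z))
    * (Complex.Gamma (b + 1 + I * z) * Complex.Gamma (b - I * z))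
    * (Complex.Gamma (c + 1 + I * z) * Complex.Gamma (c - I * z)) * sinh (2 * Real.pi * z) with hV
  have hV0 : ∀ y : ℝ, V y = (a + I * y) * (b + I * y) * (c + I * y) * hahnGamma a b c y
      * sinh (2 * Real.pi * y) := fun y => by
    simp only [hV, hahnGamma]
    rw [show a + 1 + I * y = (a + I * y) + 1 by ring, show b + 1 + I * y = (b + I * y) + 1 by ring,
      show c + 1 + I * y = (c + I * y) + 1 by ring, hG _ (by simpa), hG _ (by simpa),
      hG _ (by simpa)]
    ring
  have hbound : ∀ a : ℂ, 0 < a.re → ∃ C : ℝ, 0 < C ∧ ∀ z : ℂ, z.im ∈ uIcc 0 (1 / 2 : ℝ) →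
      ‖Complex.Gamma (a + 1 + I * z) * Complex.Gamma (a - I * z)‖
        ≤ C * Real.exp (-(2 * decayRate * |z.re|)) := fun a ha => by
    obtain ⟨C₁, h₁, b₁⟩ := exists_norm_Gamma_add_le_strip (A := a + 1) (h := 1 / 2)
      (by simp; linarith) (by simp; linarith)
    obtain ⟨C₂, h₂, b₂⟩ := exists_norm_Gamma_sub_le_strip (h := 1 / 2) ha (by linarith)
    refine ⟨C₁ * C₂, by positivity, fun z hz => ?_⟩
    rw [norm_mul]
    refine (mul_le_mul (b₁ z hz) (b₂ z hz) (norm_nonneg _) (by positivity)).trans (le_of_eq ?_)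
    rw [mul_mul_mul_comm, ← Real.exp_add]
    ring_nf
  obtain ⟨C₁, h₁, b₁⟩ := hbound a ha
  obtain ⟨C₂, h₂, b₂⟩ := hbound b hb
  obtain ⟨C₃, h₃, b₃⟩ := hbound c hc
  have hVb : ∀ z : ℂ, z.im ∈ uIcc 0 (1 / 2 : ℝ) →
      ‖V z‖ ≤ C₁ * C₂ * C₃ * Real.exp (-(decayRate * |z.re|)) := fun z hz => by
    have hs : ‖sinh (2 * Real.pi * z)‖ ≤ Real.exp (5 * decayRate * |z.re|) := by
      refine (norm_sinh_le _).trans (Real.exp_le_exp.2 (le_of_eq ?_))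
      rw [show (2 * Real.pi * z : ℂ) = ((2 * Real.pi : ℝ) : ℂ) * z by push_cast; rfl,
        re_ofReal_mul, abs_mul, abs_of_pos (by positivity : 0 < 2 * Real.pi)]
      unfold decayRate; ring
    have he : Real.exp (-(decayRate * |z.re|)) = Real.exp (-(2 * decayRate * |z.re|))
        * Real.exp (-(2 * decayRate * |z.re|)) * Real.exp (-(2 * decayRate * |z.re|))
        * Real.exp (5 * decayRate * |z.re|) := by
      simp only [← Real.exp_add]; ring_nf
    simp only [hV]
    rw [norm_mul, norm_mul, norm_mul, he]
    calc _ ≤ (C₁ * Real.exp (-(2 * decayRate * |z.re|)))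
          * (C₂ * Real.exp (-(2 * decayRate * |z.re|)))
          * (C₃ * Real.exp (-(2 * decayRate * |z.re|))) * Real.exp (5 * decayRate * |z.re|) := by
          gcongr <;> first | exact b₁ z hz | exact b₂ z hz | exact b₃ z hz
      _ = _ := by ring
  have hVd : ∀ z : ℂ, z.im ∈ uIcc 0 (1 / 2 : ℝ) → DifferentiableAt ℂ V z := fun z hz => by
    have hz' : 0 ≤ z.im ∧ z.im ≤ 1 / 2 := by
      rwa [uIcc_of_le (by norm_num), mem_Icc] at hz
    have hd1 : ∀ a : ℂ, 0 < a.re → DifferentiableAt ℂ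
        (fun z => Complex.Gamma (a + 1 + I * z) * Complex.Gamma (a - I * z)) z := fun a ha => by
      refine DifferentiableAt.mul ?_ ?_
      · exact (differentiableAt_Gamma_of_re_pos (by simp; linarith)).comp z (by fun_prop)
      · exact DifferentiableAt.comp z (f := fun z => a - I * z)
          (differentiableAt_Gamma_of_re_pos (by simp; linarith)) (by fun_prop)
    exact (((hd1 a ha).mul (hd1 b hb)).mul (hd1 c hc)).mul (by fun_prop)
  have hVc : Continuous fun y : ℝ => V y := continuous_iff_continuousAt.2 fun y =>
    ((hVd y (by simp)).continuousAt).comp continuous_ofReal.continuousAt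
  have hVi : Integrable fun y : ℝ => V y :=
    integrable_of_norm_le_exp hVc decayRate_pos fun y => by simpa using hVb y (by simp)
  have hshift := integral_horizontal_shift (h := 1 / 2) decayRate_pos
    (fun z hz => (hVd z hz).differentiableWithinAt) hVb
  have hodd : ∀ y : ℝ, V ((-y : ℝ) + (1 / 2 : ℝ) * I) = - V (y + (1 / 2 : ℝ) * I) := fun y => by
    have hI : ∀ y : ℂ, I * (y + (1 / 2 : ℝ) * I) = I * y - 1 / 2 := fun y => by
      push_cast; linear_combination (1 / 2 : ℂ) * I_mul_I
    have hs : ∀ y : ℂ, sinh (2 * Real.pi * (y + (1 / 2 : ℝ) * I)) = -sinh (2 * Real.pi * y) :=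
      fun y => by
        rw [show (2 * Real.pi * (y + (1 / 2 : ℝ) * I) : ℂ) = 2 * Real.pi * y + Real.pi * I by
          push_cast; ring, sinh_add, sinh_mul_I, cosh_mul_I, Complex.sin_pi, Complex.cos_pi]
        ring
    have hx : ∀ a : ℂ, Complex.Gamma (a + 1 + (I * (-y : ℝ) - 1 / 2))
        * Complex.Gamma (a - (I * (-y : ℝ) - 1 / 2))
        = Complex.Gamma (a + 1 + (I * y - 1 / 2)) * Complex.Gamma (a - (I * y - 1 / 2)) :=
      fun a => by
        rw [mul_comm]
        push_cast
        congr 2 <;> ring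
    simp only [hV, hI, hs, hx]
    rw [show (2 * Real.pi * (-y : ℝ) : ℂ) = -(2 * Real.pi * y) by push_cast; ring, sinh_neg]
    ring
  have hzero : ∫ y : ℝ, V (y + (1 / 2 : ℝ) * I) = 0 := by
    have h := integral_neg_eq_self (fun y : ℝ => V (y + (1 / 2 : ℝ) * I)) volume
    simp only [hodd, integral_neg] at h
    linear_combination -(1 / 2 : ℂ) * h
  rw [hshift] at hzero
  simp only [hV0] at hzero hVi
  exact ⟨hVi, hzero⟩

/-- The weight at `a + 1` has the extra factor a² + y². After subtracting (a+b)(a+c), the factor y²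
- ab - ac - bc remains; times y sinh(2πy) it is the even part, up to the factor i, of the integrand
whose integral vanishes by `integral_hahn_shift`. -/
lemma integral_hahn_add_one {a b c : ℂ} (ha : 0 < a.re) (hb : 0 < b.re) (hc : 0 < c.re) :
    ∫ y : ℝ, hahn (a + 1) b c y = (a + b) * (a + c) * ∫ y : ℝ, hahn a b c y := by
  have hG : ∀ s : ℂ, 0 < s.re → Complex.Gamma (s + 1) = s * Complex.Gamma s := fun s hs =>
    Complex.Gamma_add_one s fun h => by simp [h] at hs
  have ha1 : 0 < (a + 1).re := by simp; linarith
  obtain ⟨hi, h0⟩ := integral_hahn_shift ha hb hc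
  set W : ℝ → ℂ := fun y => (a + I * y) * (b + I * y) * (c + I * y) * hahnGamma a b c y
      * sinh (2 * Real.pi * y) with hW
  have h0' : ∫ y : ℝ, W (-y) = 0 := by rw [integral_neg_eq_self W, h0]
  have hpt : ∀ y : ℝ, hahn (a + 1) b c y - (a + b) * (a + c) * hahn a b c y
      = I / 2 * (W y + W (-y)) := fun y => by
    have hneg : hahnGamma a b c ((-y : ℝ) : ℂ) = hahnGamma a b c y := by
      simp only [hahnGamma, ofReal_neg, mul_neg, sub_neg_eq_add, ← sub_eq_add_neg]
      ring
    have h1 : hahnGamma (a + 1) b c y = (a + I * y) * (a - I * y) * hahnGamma a b c y := by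
      unfold hahnGamma
      rw [show a + 1 + I * y = (a + I * y) + 1 by ring, show a + 1 - I * y = (a - I * y) + 1 by ring,
        hG _ (by simpa), hG _ (by simpa)]
      ring
    simp only [hW, hneg, hahn, h1]
    rw [show (2 * Real.pi * (-y : ℝ) : ℂ) = -(2 * Real.pi * y) by push_cast; ring, sinh_neg]
    push_cast
    ring_nf
    have h4 : I ^ 4 = 1 := I_pow_four
    simp only [I_sq, h4]
    ring
  rw [← sub_eq_zero, ← integral_const_mul, ← integral_sub (integrable_hahn ha1 hb hc)
    ((integrable_hahn ha hb hc).const_mul _)]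
  simp only [hpt]
  rw [integral_const_mul, integral_add hi hi.comp_neg, h0, h0']
  simp

/-- The quotient of the two sides of the dual Hahn integral. -/
noncomputable def hahnRatio (a b c : ℂ) : ℂ :=
  (∫ y : ℝ, hahn a b c y) / (Complex.Gamma (a + b) * Complex.Gamma (a + c))
    / Complex.Gamma (b + c)

lemma hahnRatio_eq_left {a a' b c : ℂ} (ha : 0 < a.re) (ha' : 0 < a'.re) (hb : 0 < b.re)
    (hc : 0 < c.re) : hahnRatio a b c = hahnRatio a' b c := by
  have hint := integrable_exp_neg_mul_abs (half_pos decayRate_pos)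
  unfold hahnRatio
  congr 1
  refine div_Gamma_mul_Gamma_eq (J := fun a => ∫ y : ℝ, hahn a b c y) hb hc
    (differentiableOn_integral_of_locally_bound (F := fun a y => hahn a b c y) hint
      (fun m M hm => exists_norm_hahn_le hm hb hc) (fun y a ha => ?_)
      (fun a ha => (continuous_hahn ha hb hc).aestronglyMeasurable))
    (exists_norm_integral_le_of_locally_bound (F := fun a y => hahn a b c y) hint
      (fun m M hm => exists_norm_hahn_le hm hb hc))
    (fun a ha => integral_hahn_add_one ha hb hc) ha ha'
  unfold hahn hahnGamma
  refine (((DifferentiableAt.mul ?_ ?_).mul_const _).mul_const _).mul_const _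
  · exact (differentiableAt_Gamma_of_re_pos (by simpa)).comp a (by fun_prop)
  · exact DifferentiableAt.comp a (f := fun a => a - I * y)
      (differentiableAt_Gamma_of_re_pos (by simpa)) (by fun_prop)

lemma hahnRatio_swap_left (a b c : ℂ) : hahnRatio a b c = hahnRatio b a c := by
  unfold hahnRatio hahn hahnGamma
  rw [div_div, div_div, add_comm b a]
  congr 1
  · refine integral_congr_ae (ae_of_all _ fun y => ?_)
    ring
  · ring

lemma hahnRatio_swap_right (a b c : ℂ) : hahnRatio a b c = hahnRatio a c b := by
  unfold hahnRatio hahn hahnGamma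
  rw [div_div, div_div, add_comm c b]
  congr 1
  · refine integral_congr_ae (ae_of_all _ fun y => ?_)
    ring
  · ring

lemma tendsto_div_cosh {l : Filter ℝ} (hl : Tendsto (fun y : ℝ => |y|) l atTop) :
    Tendsto (fun y : ℝ => y / Real.cosh (Real.pi * y)) l (𝓝 0) := by
  have h1 : Tendsto (fun y : ℝ => 2 * (|y| * Real.exp (-|y|))) l (𝓝 0) := by
    have := ((Real.tendsto_pow_mul_exp_neg_atTop_nhds_zero 1).comp hl).const_mul 2
    simpa using this
  refine squeeze_zero_norm (fun y => ?_) h1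
  have hc : Real.exp |y| / 2 ≤ Real.cosh (Real.pi * y) := by
    rw [← Real.cosh_abs, Real.cosh_eq, abs_mul, abs_of_pos Real.pi_pos]
    have : Real.exp |y| ≤ Real.exp (Real.pi * |y|) := Real.exp_le_exp.2
      (le_mul_of_one_le_left (abs_nonneg y) (by linarith [Real.pi_gt_three]))
    linarith [Real.exp_pos (-(Real.pi * |y|))]
  rw [Real.norm_eq_abs, abs_div, abs_of_pos (Real.cosh_pos _), div_le_iff₀ (Real.cosh_pos _)]
  have he := Real.exp_pos |y|
  have : |y| = 2 * (|y| * Real.exp (-|y|)) * (Real.exp |y| / 2) := by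
    rw [Real.exp_neg]; field_simp
  calc |y| = 2 * (|y| * Real.exp (-|y|)) * (Real.exp |y| / 2) := this
    _ ≤ _ := by gcongr

lemma hahn_half (y : ℝ) : hahn (1 / 2) (1 / 2) (1 / 2) y =
    (2 * Real.pi ^ 3 * (y * Real.sinh (Real.pi * y) / Real.cosh (Real.pi * y) ^ 2) : ℝ) := by
  have hc : (Real.cosh (Real.pi * y) : ℂ) ≠ 0 := by exact_mod_cast (Real.cosh_pos _).ne'
  unfold hahn hahnGamma
  rw [Gamma_half_add_mul_Gamma_half_sub,
    show (2 * Real.pi * y : ℂ) = 2 * (Real.pi * y : ℝ) by push_cast; ring, sinh_two_mul,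
    ← ofReal_sinh, ← ofReal_cosh]
  push_cast at hc ⊢
  field_simp

/-- The normalization of the dual Hahn integral. -/
lemma integral_hahn_half : ∫ y : ℝ, hahn (1 / 2) (1 / 2) (1 / 2) y = 2 * Real.pi ^ 2 := by
  have hre : (0 : ℝ) < (1 / 2 : ℂ).re := by norm_num
  have hpi := Real.pi_pos
  -- An antiderivative: integrate y against the derivative of -1/(π cosh πy) by parts; the remaining
  -- integral of 1/cosh is an arctangent of the exponential.
  set G : ℝ → ℝ := fun y => 2 * Real.pi ^ 3 * (-(1 / Real.pi) * (y / Real.cosh (Real.pi * y))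
    + 2 / Real.pi ^ 2 * Real.arctan (Real.exp (Real.pi * y))) with hG
  have hderiv : ∀ y : ℝ, HasDerivAt G (2 * Real.pi ^ 3 *
      (y * Real.sinh (Real.pi * y) / Real.cosh (Real.pi * y) ^ 2)) y := fun y => by
    have hc := Real.cosh_pos (Real.pi * y)
    have hlin : HasDerivAt (fun y : ℝ => Real.pi * y) Real.pi y := by
      simpa using (hasDerivAt_id y).const_mul Real.pi
    have h1 := ((hasDerivAt_id y).div hlin.cosh hc.ne').const_mul (-(1 / Real.pi))
    have h2 := hlin.exp.arctan.const_mul (2 / Real.pi ^ 2)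
    refine ((h1.add h2).const_mul (2 * Real.pi ^ 3)).congr_deriv ?_
    have hE := Real.exp_pos (Real.pi * y)
    have h3 : 1 / (1 + Real.exp (Real.pi * y) ^ 2) * (Real.exp (Real.pi * y) * Real.pi)
        = Real.pi / (2 * Real.cosh (Real.pi * y)) := by
      rw [Real.cosh_eq, Real.exp_neg]
      field_simp
      ring
    rw [h3]
    simp only [id]
    field_simp
    ring
  have hint : Integrable fun y : ℝ => 2 * Real.pi ^ 3 *
      (y * Real.sinh (Real.pi * y) / Real.cosh (Real.pi * y) ^ 2) := by
    refine (integrable_hahn hre hre hre).re.congr (ae_of_all _ fun y => ?_)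
    simp only [hahn_half]
    rfl
  have hlin_top : Tendsto (fun y : ℝ => Real.pi * y) atTop atTop :=
    tendsto_id.const_mul_atTop hpi
  have hlin_bot : Tendsto (fun y : ℝ => Real.pi * y) atBot atBot :=
    tendsto_id.const_mul_atBot hpi
  have htop : Tendsto G atTop (𝓝 (2 * Real.pi ^ 3 * (-(1 / Real.pi) * 0
      + 2 / Real.pi ^ 2 * (Real.pi / 2)))) := by
    refine (((tendsto_div_cosh tendsto_abs_atTop_atTop).const_mul _).add
      (Tendsto.const_mul _ ?_)).const_mul _
    exact (tendsto_nhds_of_tendsto_nhdsWithin Real.tendsto_arctan_atTop).comp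
      (Real.tendsto_exp_atTop.comp hlin_top)
  have hbot : Tendsto G atBot (𝓝 (2 * Real.pi ^ 3 * (-(1 / Real.pi) * 0
      + 2 / Real.pi ^ 2 * 0))) := by
    refine (((tendsto_div_cosh tendsto_abs_atBot_atTop).const_mul _).add
      (Tendsto.const_mul _ ?_)).const_mul _
    rw [← Real.arctan_zero]
    exact (Real.continuous_arctan.tendsto 0).comp (Real.tendsto_exp_atBot.comp hlin_bot)
  simp only [hahn_half]
  rw [integral_complex_ofReal, integral_of_hasDerivAt_of_tendsto hderiv hint hbot htop]
  push_cast
  have : (Real.pi : ℂ) ≠ 0 := by exact_mod_cast hpi.ne'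
  field_simp
  ring

/-- The total mass of the continuous dual Hahn weight with complex parameters. -/
theorem integral_hahn {a b c : ℂ} (ha : 0 < a.re) (hb : 0 < b.re) (hc : 0 < c.re) :
    ∫ y : ℝ, hahn a b c y = 2 * Real.pi ^ 2
      * (Complex.Gamma (a + b) * Complex.Gamma (a + c) * Complex.Gamma (b + c)) := by
  have hre : (0 : ℝ) < (1 / 2 : ℂ).re := by norm_num
  have hval : hahnRatio (1 / 2) (1 / 2) (1 / 2) = 2 * Real.pi ^ 2 := by
    rw [hahnRatio, integral_hahn_half, show (1 / 2 + 1 / 2 : ℂ) = 1 by norm_num, Complex.Gamma_one]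
    simp
  have hratio : hahnRatio a b c = 2 * Real.pi ^ 2 := by
    rw [hahnRatio_eq_left ha hre hb hc, hahnRatio_swap_left, hahnRatio_eq_left hb hre hre hc,
      hahnRatio_swap_right, hahnRatio_swap_left, hahnRatio_eq_left hc hre hre hre, hval]
  have g1 := Complex.Gamma_ne_zero_of_re_pos (s := a + b) (by simp; linarith)
  have g2 := Complex.Gamma_ne_zero_of_re_pos (s := a + c) (by simp; linarith)
  have g3 := Complex.Gamma_ne_zero_of_re_pos (s := b + c) (by simp; linarith)
  unfold hahnRatio at hratio
  field_simp at hratio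
  linear_combination hratio

/-! ### Explicit parameters and the factor 1/Γ(i(τ₂₁-τ₂₂))Γ(i(τ₂₂-τ₂₁)) -/

@[simp] lemma gam_zero (lam : Fin 3 → ℝ) (ε : ℝ) : gam lam ε 0 = lam 0 + I * ε := by
  simp [gam]

@[simp] lemma gam_one (lam : Fin 3 → ℝ) (ε : ℝ) : gam lam ε 1 = lam 1 - I * ε := by
  simp [gam, sub_eq_add_neg]

@[simp] lemma gam_two (lam : Fin 3 → ℝ) (ε : ℝ) : gam lam ε 2 = lam 2 := by
  simp [gam]

@[simp] lemma gamBar_zero (lam : Fin 3 → ℝ) (ε : ℝ) : gamBar lam ε 0 = lam 0 - I * ε := by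
  simp [gamBar, sub_eq_add_neg]

@[simp] lemma gamBar_one (lam : Fin 3 → ℝ) (ε : ℝ) : gamBar lam ε 1 = lam 1 + I * ε := by
  simp [gamBar]

@[simp] lemma gamBar_two (lam : Fin 3 → ℝ) (ε : ℝ) : gamBar lam ε 2 = lam 2 := by
  simp [gamBar]

/-- The reflection formula at the purely imaginary point i(u-v). It makes the measure an elementary
function, and the factor y sinh(2πy) of the Hahn weight comes from here. -/
lemma inv_Gamma_mul_inv_Gamma (u v : ℝ) :
    (Complex.Gamma (I * u - I * v))⁻¹ * (Complex.Gamma (-I * u + I * v))⁻¹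
      = ((u : ℂ) - v) * sinh (Real.pi * (u - v)) / Real.pi := by
  have hpi : (Real.pi : ℂ) ≠ 0 := by exact_mod_cast Real.pi_ne_zero
  -- On the diagonal the convention Γ(0) = 0, with 0⁻¹ = 0, gives the correct value 0 of the entire
  -- function 1/Γ.
  rcases eq_or_ne u v with rfl | huv
  · simp [Complex.Gamma_zero]
  set w : ℂ := I * u - I * v with hw
  have hw0 : w ≠ 0 := by
    rw [hw, ← mul_sub]
    exact mul_ne_zero I_ne_zero (sub_ne_zero.2 (by exact_mod_cast huv))
  rw [show -I * (u : ℂ) + I * v = -w by rw [hw]; ring]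
  have h1 := Complex.Gamma_mul_Gamma_one_sub w
  rw [show 1 - w = -w + 1 by ring, Complex.Gamma_add_one _ (neg_ne_zero.2 hw0),
    show (Real.pi : ℂ) * w = (Real.pi * (u - v)) * I by rw [hw]; ring, Complex.sin_mul_I] at h1
  have hsr : Real.sinh (Real.pi * (u - v)) ≠ 0 := by
    rw [Ne, Real.sinh_eq_zero]
    exact mul_ne_zero Real.pi_ne_zero (sub_ne_zero.2 huv)
  have hs : sinh ((Real.pi : ℂ) * (u - v)) ≠ 0 := by
    rw [show (Real.pi : ℂ) * (u - v) = ((Real.pi * (u - v) : ℝ) : ℂ) by push_cast; ring,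
      ← ofReal_sinh]
    exact_mod_cast hsr
  rw [eq_div_iff (mul_ne_zero hs I_ne_zero)] at h1
  have hne : Complex.Gamma w * Complex.Gamma (-w) ≠ 0 := fun h0 => by
    refine hpi ?_
    rw [← h1]
    linear_combination (-w * (sinh ((Real.pi : ℂ) * (u - v)) * I)) * h0
  rw [← mul_inv, inv_eq_one_div, div_eq_div_iff hne hpi]
  rw [hw] at h1 hne ⊢
  linear_combination -h1 - Complex.Gamma (I * u - I * v) * Complex.Gamma (-(I * u - I * v))
    * (u - v) * sinh ((Real.pi : ℂ) * (u - v)) * I_mul_I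

/-! ### The images of the Whittaker vectors under `B_R` and `B_L` -/

/-- Inserts G·G⁻¹ on one side, so that `ring` can close identities in which a nonvanishing factor
has to cancel. -/
lemma eq_of_eq_mul_mul_inv {G x y : ℂ} (hG : G ≠ 0) (h : x = y * (G * G⁻¹)) : x = y := by
  rw [h, mul_inv_cancel₀ hG, mul_one]

/-- Γ(1/2-is₂₁) cancels the denominator of the kernel, and Γ(1-is₁₁-is₂₂) is constant because the
second delta-function fixes s₁₁+s₂₂. Four Gammas depending on s₂₁ survive. -/
lemma BRint_phiR (lam : Fin 3 → ℝ) (ε ϰ : ℝ) (t u v b : ℝ) :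
    BRint lam ε ϰ phiR t u v b
      = 1 / (2 * Real.pi) * (exp (Real.pi * (t - I * ϰ) / 2) / Complex.Gamma (I * u - I * v))
        * cNorm * (Complex.Gamma (I * (u - t) - ϰ + 1 / 2) * Complex.Gamma (I * (v - t) - ϰ + 1 / 2))
        * (Complex.Gamma (I * (lam 2 - u) + 1 / 2) * Complex.Gamma (I * (lam 2 - v) + 1 / 2))
        * Complex.Gamma (1 - I * (u + v - lam 0 - lam 1))
        * barnes (I * (lam 1 - t) + ε - ϰ + 1 / 2) (I * (lam 0 - t) - ε - ϰ + 1 / 2)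
            (I * (t - u) + ϰ) (I * (t - v) + ϰ) b := by
  have hb : Complex.Gamma (1 / 2 - I * b) ≠ 0 := Complex.Gamma_ne_zero_of_re_pos (by simp)
  simp only [BRint, cdelta, kerR, phiR, barnes, gam_zero, gam_one, gam_two]
  rw [show (-I * b + 1 / 2 : ℂ) = 1 / 2 - I * b by ring,
    show I * ((lam 1 : ℂ) - I * ε - (lam 0 + I * ε) - (t - I * ϰ - (lam 0 + I * ε) - b)) + 1 / 2
      = I * (lam 1 - t) + ε - ϰ + 1 / 2 + I * b by
      linear_combination (ϰ - ε : ℂ) * I_mul_I,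
    show (1 / 2 : ℂ) - I * (t - I * ϰ - (lam 0 + I * ε) - b)
      = I * (lam 0 - t) - ε - ϰ + 1 / 2 + I * b by
      linear_combination (ϰ + ε : ℂ) * I_mul_I,
    show I * ((t : ℂ) - u - b) + ϰ = I * (t - u) + ϰ - I * b by ring,
    show I * ((t : ℂ) - v - b) + ϰ = I * (t - v) + ϰ - I * b by ring,
    show (1 : ℂ) - I * (t - I * ϰ - (lam 0 + I * ε) - b)
      - I * (u + v - (lam 0 + I * ε) - (lam 1 - I * ε) - (t - I * ϰ - (lam 0 + I * ε) - b))
      = 1 - I * (u + v - lam 0 - lam 1) by ring]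
  generalize Complex.Gamma (1 / 2 - I * b) = G at hb ⊢
  iterate 10 generalize Complex.Gamma _ = G
  generalize exp _ = E
  refine eq_of_eq_mul_mul_inv hb ?_
  ring

theorem integrable_BRint_phiR (lam : Fin 3 → ℝ) (ε ϰ : ℝ) (hε : 0 < ε) (hϰ : 0 < ϰ)
    (h : ϰ + ε < 1 / 2) (t u v : ℝ) :
    Integrable (BRint lam ε ϰ phiR t u v) ∧
      BR lam ε ϰ phiR t u v = psiRt lam ε (t - I * ϰ) u v := by
  -- The first two Barnes parameters have real parts 1/2 - ϰ ± ε; this is where ϰ + ε < 1/2 enters.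
  have r1 : 0 < (I * (lam 1 - t) + ε - ϰ + 1 / 2 : ℂ).re := by simp; linarith
  have r2 : 0 < (I * (lam 0 - t) - ε - ϰ + 1 / 2 : ℂ).re := by simp; linarith
  have r3 : 0 < (I * (t - u) + ϰ : ℂ).re := by simpa
  have r4 : 0 < (I * (t - v) + ϰ : ℂ).re := by simpa
  have r5 : Complex.Gamma (1 - I * (u + v - lam 0 - lam 1)) ≠ 0 :=
    Complex.Gamma_ne_zero_of_re_pos (by simp)
  have hpi : (Real.pi : ℂ) ≠ 0 := by exact_mod_cast Real.pi_ne_zero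
  have hfun : BRint lam ε ϰ phiR t u v = _ := funext (BRint_phiR lam ε ϰ t u v)
  constructor
  · rw [hfun]
    exact (integrable_barnes r1 r2 r3 r4).const_mul _
  · rw [BR, hfun, integral_const_mul, integral_barnes r1 r2 r3 r4]
    simp only [psiRt, Fin.prod_univ_three, gam_zero, gam_one, gam_two]
    -- The sum of the four parameters is the argument of the constant Gamma, which therefore cancels
    -- the denominator in Barnes' lemma; the pairwise sums produce the Gammas of γ₁ and γ₂ in
    -- `psiRt`.
    rw [show I * ((lam 1 : ℂ) - t) + ε - ϰ + 1 / 2 + (I * (lam 0 - t) - ε - ϰ + 1 / 2)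
        + (I * (t - u) + ϰ) + (I * (t - v) + ϰ) = 1 - I * (u + v - lam 0 - lam 1) by ring,
      show I * ((lam 1 : ℂ) - t) + ε - ϰ + 1 / 2 + (I * (t - u) + ϰ)
        = I * (lam 1 - I * ε - u) + 1 / 2 by linear_combination (ε : ℂ) * I_mul_I,
      show I * ((lam 1 : ℂ) - t) + ε - ϰ + 1 / 2 + (I * (t - v) + ϰ)
        = I * (lam 1 - I * ε - v) + 1 / 2 by linear_combination (ε : ℂ) * I_mul_I,
      show I * ((lam 0 : ℂ) - t) - ε - ϰ + 1 / 2 + (I * (t - u) + ϰ)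
        = I * (lam 0 + I * ε - u) + 1 / 2 by linear_combination -(ε : ℂ) * I_mul_I,
      show I * ((lam 0 : ℂ) - t) - ε - ϰ + 1 / 2 + (I * (t - v) + ϰ)
        = I * (lam 0 + I * ε - v) + 1 / 2 by linear_combination -(ε : ℂ) * I_mul_I,
      show I * ((u : ℂ) - (t - I * ϰ)) + 1 / 2 = I * (u - t) - ϰ + 1 / 2 by
        linear_combination (ϰ : ℂ) * I_mul_I,
      show I * ((v : ℂ) - (t - I * ϰ)) + 1 / 2 = I * (v - t) - ϰ + 1 / 2 by
        linear_combination (ϰ : ℂ) * I_mul_I]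
    generalize Complex.Gamma (1 - I * (u + v - lam 0 - lam 1)) = G at r5 ⊢
    iterate 9 generalize Complex.Gamma _ = G
    rw [show Real.pi * ((t : ℂ) - I * ϰ) / 2 = Real.pi / 2 * (t - I * ϰ) by ring]
    generalize exp _ = E
    refine eq_of_eq_mul_mul_inv r5 ?_
    refine eq_of_eq_mul_mul_inv hpi ?_
    ring

/-- Here the Gamma of γ̄₁-γ̄₂+s₁₁ cancels, and the one of γ̄₁-γ̄₃+s₁₁+s₂₁ is fixed by the first
delta-function. The latter will cancel the denominator of Barnes' lemma, and the four Gammas of the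
numerator will cancel those of the kernel, so that only an exponential and 1/Γ are left. -/
lemma BLint_phiL (lam : Fin 3 → ℝ) (ε ϰ : ℝ) (hε : 0 < ε) (t u v a : ℝ) :
    BLint lam ε ϰ (phiL lam ε) t u v a
      = 1 / (2 * Real.pi) * (exp (-(Real.pi * (t - I * ϰ) / 2)) / Complex.Gamma (I * u - I * v))
        * cNorm * Complex.Gamma (I * (t - lam 2) + ϰ + 1)
        / (Complex.Gamma (I * (t - u) + ϰ + 1 / 2) * Complex.Gamma (I * (u - lam 2) + 1 / 2))
        / (Complex.Gamma (I * (t - v) + ϰ + 1 / 2) * Complex.Gamma (I * (v - lam 2) + 1 / 2))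
        * barnes (I * (lam 0 - u) + ε) (I * (lam 0 - v) + ε)
            (I * (t - lam 0) + ϰ - ε + 1 / 2) (I * (u + v - lam 0 - lam 2) - ε + 1 / 2) a := by
  have hb : Complex.Gamma (I * (lam 0 - I * ε - (lam 1 + I * ε) + a) + 1 / 2) ≠ 0 :=
    Complex.Gamma_ne_zero_of_re_pos (by simp; linarith)
  simp only [BLint, cdelta, kerL, phiL, barnes, gamBar_zero, gamBar_one, gamBar_two, gam_two]
  rw [show I * ((t : ℂ) - I * ϰ - (lam 0 - I * ε) - a) + 1 / 2
      = I * (t - lam 0) + ϰ - ε + 1 / 2 - I * a by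
      linear_combination (ε - ϰ : ℂ) * I_mul_I,
    show I * ((t : ℂ) - u - (t - I * ϰ - (lam 0 - I * ε) - a)) + ϰ
      = I * (lam 0 - u) + ε + I * a by
      linear_combination (ϰ - ε : ℂ) * I_mul_I,
    show I * ((t : ℂ) - v - (t - I * ϰ - (lam 0 - I * ε) - a)) + ϰ
      = I * (lam 0 - v) + ε + I * a by
      linear_combination (ϰ - ε : ℂ) * I_mul_I,
    show I * ((lam 1 : ℂ) + I * ε - lam 2 + (u + v - (lam 0 - I * ε) - (lam 1 + I * ε) - a)) + 1 / 2
      = I * (u + v - lam 0 - lam 2) - ε + 1 / 2 - I * a by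
      linear_combination (ε : ℂ) * I_mul_I,
    show I * ((lam 0 : ℂ) - I * ε - lam 2 + a + (t - I * ϰ - (lam 0 - I * ε) - a)) + 1
      = I * (t - lam 2) + ϰ + 1 by
      linear_combination (-ϰ : ℂ) * I_mul_I]
  generalize Complex.Gamma (I * (lam 0 - I * ε - (lam 1 + I * ε) + a) + 1 / 2) = G at hb ⊢
  iterate 10 generalize Complex.Gamma _ = G
  generalize exp _ = E
  refine eq_of_eq_mul_mul_inv hb ?_
  ring

theorem integrable_BLint_phiL (lam : Fin 3 → ℝ) (ε ϰ : ℝ) (hε : 0 < ε) (hε' : ε < 1 / 2)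
    (hϰ : 0 < ϰ) (t u v : ℝ) :
    Integrable (BLint lam ε ϰ (phiL lam ε) t u v) ∧
      BL lam ε ϰ (phiL lam ε) t u v = psiLt (t - I * ϰ) u v := by
  -- Positivity of ε keeps these poles off the contour; the remaining two parameters only need ε <
  -- 1/2.
  have r1 : 0 < (I * (lam 0 - u) + ε : ℂ).re := by simpa
  have r2 : 0 < (I * (lam 0 - v) + ε : ℂ).re := by simpa
  have r3 : 0 < (I * (t - lam 0) + ϰ - ε + 1 / 2 : ℂ).re := by simp; linarith
  have r4 : 0 < (I * (u + v - lam 0 - lam 2) - ε + 1 / 2 : ℂ).re := by simp; linarith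
  have hpi : (Real.pi : ℂ) ≠ 0 := by exact_mod_cast Real.pi_ne_zero
  have hfun : BLint lam ε ϰ (phiL lam ε) t u v = _ := funext (BLint_phiL lam ε ϰ hε t u v)
  constructor
  · rw [hfun]
    exact (integrable_barnes r1 r2 r3 r4).const_mul _
  · rw [BL, hfun, integral_const_mul, integral_barnes r1 r2 r3 r4]
    simp only [psiLt]
    rw [show I * ((lam 0 : ℂ) - u) + ε + (I * (t - lam 0) + ϰ - ε + 1 / 2)
        = I * (t - u) + ϰ + 1 / 2 by ring,
      show I * ((lam 0 : ℂ) - u) + ε + (I * (u + v - lam 0 - lam 2) - ε + 1 / 2)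
        = I * (v - lam 2) + 1 / 2 by ring,
      show I * ((lam 0 : ℂ) - v) + ε + (I * (t - lam 0) + ϰ - ε + 1 / 2)
        = I * (t - v) + ϰ + 1 / 2 by ring,
      show I * ((lam 0 : ℂ) - v) + ε + (I * (u + v - lam 0 - lam 2) - ε + 1 / 2)
        = I * (u - lam 2) + 1 / 2 by ring,
      show I * ((lam 0 : ℂ) - u) + ε + (I * (lam 0 - v) + ε) + (I * (t - lam 0) + ϰ - ε + 1 / 2)
        + (I * (u + v - lam 0 - lam 2) - ε + 1 / 2) = I * (t - lam 2) + ϰ + 1 by ring]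
    have g1 : Complex.Gamma (I * (t - u) + ϰ + 1 / 2) ≠ 0 :=
      Complex.Gamma_ne_zero_of_re_pos (by simp; linarith)
    have g2 : Complex.Gamma (I * (v - lam 2) + 1 / 2) ≠ 0 :=
      Complex.Gamma_ne_zero_of_re_pos (by simp)
    have g3 : Complex.Gamma (I * (t - v) + ϰ + 1 / 2) ≠ 0 :=
      Complex.Gamma_ne_zero_of_re_pos (by simp; linarith)
    have g4 : Complex.Gamma (I * (u - lam 2) + 1 / 2) ≠ 0 :=
      Complex.Gamma_ne_zero_of_re_pos (by simp)
    have g5 : Complex.Gamma (I * (t - lam 2) + ϰ + 1) ≠ 0 :=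
      Complex.Gamma_ne_zero_of_re_pos (by simp; linarith)
    generalize Complex.Gamma (I * (t - u) + ϰ + 1 / 2) = G₁ at g1 ⊢
    generalize Complex.Gamma (I * (v - lam 2) + 1 / 2) = G₂ at g2 ⊢
    generalize Complex.Gamma (I * (t - v) + ϰ + 1 / 2) = G₃ at g3 ⊢
    generalize Complex.Gamma (I * (u - lam 2) + 1 / 2) = G₄ at g4 ⊢
    generalize Complex.Gamma (I * (t - lam 2) + ϰ + 1) = G₅ at g5 ⊢
    generalize Complex.Gamma _ = G
    generalize exp _ = E
    refine eq_of_eq_mul_mul_inv g1 ?_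
    refine eq_of_eq_mul_mul_inv g2 ?_
    refine eq_of_eq_mul_mul_inv g3 ?_
    refine eq_of_eq_mul_mul_inv g4 ?_
    refine eq_of_eq_mul_mul_inv g5 ?_
    refine eq_of_eq_mul_mul_inv hpi ?_
    ring

/-! ### `B_L†` on rising-factorial multiples of the right Whittaker vector -/

/-- The rising factorial `x (x + 1) ⋯ (x + n - 1)`. -/
noncomputable def rising (n : ℕ) (x : ℂ) : ℂ := ∏ i ∈ Finset.range n, (x + i)

@[simp] lemma rising_zero (x : ℂ) : rising 0 x = 1 := by simp [rising]

lemma rising_succ (n : ℕ) (x : ℂ) : rising (n + 1) x = rising n x * (x + n) := by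
  simp [rising, Finset.prod_range_succ]

lemma rising_succ' (n : ℕ) (x : ℂ) : rising (n + 1) x = x * rising n (x + 1) := by
  rw [rising, Finset.prod_range_succ', rising, mul_comm, Nat.cast_zero, add_zero]
  refine congrArg (x * ·) (Finset.prod_congr rfl fun i _ => ?_)
  push_cast
  ring

lemma rising_mul_Gamma (n : ℕ) {x : ℂ} (hx : 0 < x.re) :
    rising n x * Complex.Gamma x = Complex.Gamma (x + n) := by
  induction n with
  | zero => simp
  | succ n ih =>
    have h0 : x + n ≠ 0 := fun h => by
      have := congrArg re h
      simp at this
      have hn : (0 : ℝ) ≤ n := n.cast_nonneg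
      linarith
    push_cast
    rw [rising_succ, ← add_assoc, Complex.Gamma_add_one _ h0, ← ih]
    ring

/-- The function `(Y(u))_n (Y(v))_n` with `Y(w) = i (γ₂ - w) + 1/2`. -/
noncomputable def gtBasis (lam : Fin 3 → ℝ) (ε : ℝ) (n : ℕ) (u v : ℂ) : ℂ :=
  rising n (I * (gam lam ε 1 - u) + 1 / 2) * rising n (I * (gam lam ε 1 - v) + 1 / 2)

/-- At the shifted argument t - iϰ of `psiRt` the exponentials cancel, and so do the Gammas
containing t - τ₂ⱼ and γ₃. What is left are the kernel Gammas, the Gammas of γ₁ and γ₂, and the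
reciprocal Gammas of ±i(u-v): a dual Hahn weight. The rising factorials raise the parameter
belonging to γ₂ by `n`. -/
lemma kerLdag_mul_psiRt (lam : Fin 3 → ℝ) (ε ϰ : ℝ) (hε : 0 < ε) (n : ℕ) (a b d u : ℝ) :
    kerLdag lam ε ϰ a b (gam lam ε 0 + a + b + I * ϰ) u ((lam 0 + lam 1 + a + d - u : ℝ) : ℂ)
      * (psiRt lam ε (gam lam ε 0 + a + b) u ((lam 0 + lam 1 + a + d - u : ℝ) : ℂ)
        * gtBasis lam ε n u ((lam 0 + lam 1 + a + d - u : ℝ) : ℂ))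
      = cNorm * Complex.Gamma (1 / 2 - I * b) / (2 * Real.pi ^ 2)
        / Complex.Gamma (1 / 2 - I * (gam lam ε 0 - gam lam ε 1 + a))
        * hahn (I * ((lam 1 + d - lam 0 - a) / 2) + ε) (I * ((lam 0 - lam 1 - a - d) / 2) - ε + 1 / 2)
          (I * ((lam 1 - lam 0 - a - d) / 2) + ε + 1 / 2 + n)
          ((u - (lam 0 + lam 1 + a + d) / 2 : ℝ) : ℂ) := by
  set v : ℝ := lam 0 + lam 1 + a + d - u with hv
  -- The sum u+v is fixed by the delta-function, so u and v are its half plus and minus `y`, and the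
  -- Gammas pair up as Γ(A+iy)Γ(A-iy).
  set y : ℝ := u - (lam 0 + lam 1 + a + d) / 2 with hy
  have hu : (u : ℂ) = (lam 0 + lam 1 + a + d) / 2 + y := by rw [hy]; push_cast; ring
  have hv' : (v : ℂ) = (lam 0 + lam 1 + a + d) / 2 - y := by rw [hv, hy]; push_cast; ring
  have hrec := inv_Gamma_mul_inv_Gamma u v
  have hG₁ : ∀ w : ℝ, Complex.Gamma (-I * ((lam 0 + I * ε) + a + b - w) + 1 / 2) ≠ 0 := fun w =>
    Complex.Gamma_ne_zero_of_re_pos (by simp; linarith)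
  have hG₂ : ∀ w : ℝ, Complex.Gamma (I * ((lam 2 : ℂ) - w) + 1 / 2) ≠ 0 := fun w =>
    Complex.Gamma_ne_zero_of_re_pos (by simp)
  have hY : ∀ w : ℝ, rising n (I * ((lam 1 - I * ε : ℂ) - w) + 1 / 2)
      * Complex.Gamma (I * ((lam 1 - I * ε : ℂ) - w) + 1 / 2)
      = Complex.Gamma (I * ((lam 1 - I * ε : ℂ) - w) + 1 / 2 + n) := fun w =>
    rising_mul_Gamma n (by simp; linarith)
  have hexp : exp (-(Real.pi * ((lam 0 + I * ε) + a + b + I * ϰ - I * ϰ) / 2))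
      * exp (Real.pi * ((lam 0 + I * ε) + a + b) / 2) = 1 := by
    rw [← exp_add, ← exp_zero]; congr 1; ring
  simp only [kerLdag, psiRt, gtBasis, hahn, hahnGamma, Fin.prod_univ_three, gam_zero, gam_one,
    gam_two]
  have k1 : ∀ w : ℝ, -I * ((lam 0 : ℂ) + I * ε + a + b + I * ϰ - w - b) - ϰ
      = -I * (lam 0 + a - w) + ε := fun w => by
    linear_combination (-ϰ - ε : ℂ) * I_mul_I
  have k2 : ∀ w : ℝ, -I * ((lam 0 : ℂ) + I * ε + a + b + I * ϰ - w) - ϰ + 1 / 2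
      = -I * (lam 0 + I * ε + a + b - w) + 1 / 2 := fun w => by
    linear_combination (-ϰ : ℂ) * I_mul_I
  have k3 : ∀ w : ℝ, -I * ((w : ℂ) - lam 2) + 1 / 2 = I * (lam 2 - w) + 1 / 2 := fun w => by ring
  have k4 : ∀ w : ℝ, I * ((w : ℂ) - (lam 0 + I * ε + a + b)) + 1 / 2
      = -I * (lam 0 + I * ε + a + b - w) + 1 / 2 := fun w => by ring
  rw [k1, k1, k2, k2, k3, k3, k4, k4,
    show (-I * b + 1 / 2 : ℂ) = 1 / 2 - I * b by ring,
    show -I * ((lam 0 : ℂ) + I * ε - (lam 1 - I * ε) + a) + 1 / 2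
      = 1 / 2 - I * (lam 0 + I * ε - (lam 1 - I * ε) + a) by ring]
  have m1 : I * (((lam 1 : ℂ) + d - lam 0 - a) / 2) + ε + I * y = -I * (lam 0 + a - u) + ε := by
    rw [hu]; ring
  have m2 : I * (((lam 1 : ℂ) + d - lam 0 - a) / 2) + ε - I * y = -I * (lam 0 + a - v) + ε := by
    rw [hv']; ring
  have m3 : I * (((lam 0 : ℂ) - lam 1 - a - d) / 2) - ε + 1 / 2 + I * y
      = I * (lam 0 + I * ε - v) + 1 / 2 := by
    rw [hv']; linear_combination -(ε : ℂ) * I_mul_I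
  have m4 : I * (((lam 0 : ℂ) - lam 1 - a - d) / 2) - ε + 1 / 2 - I * y
      = I * (lam 0 + I * ε - u) + 1 / 2 := by
    rw [hu]; linear_combination -(ε : ℂ) * I_mul_I
  have m5 : I * (((lam 1 : ℂ) - lam 0 - a - d) / 2) + ε + 1 / 2 + n + I * y
      = I * (lam 1 - I * ε - v) + 1 / 2 + n := by
    rw [hv']; linear_combination (ε : ℂ) * I_mul_I
  have m6 : I * (((lam 1 : ℂ) - lam 0 - a - d) / 2) + ε + 1 / 2 + n - I * y
      = I * (lam 1 - I * ε - u) + 1 / 2 + n := by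
    rw [hu]; linear_combination (ε : ℂ) * I_mul_I
  have m7 : (y : ℂ) * sinh (2 * Real.pi * y) = ((u : ℂ) - v) * sinh (Real.pi * (u - v)) / 2 := by
    rw [show (Real.pi * (u - v) : ℂ) = 2 * Real.pi * y by rw [hu, hv']; ring,
      show (u : ℂ) - v = 2 * y by rw [hu, hv']; ring]
    ring
  rw [m1, m2, m3, m4, m5, m6, m7, ← hY u, ← hY v]
  have g1 := hG₁ u
  have g2 := hG₁ v
  have g3 := hG₂ u
  have g4 := hG₂ v
  have hpi : (Real.pi : ℂ) ≠ 0 := by exact_mod_cast Real.pi_ne_zero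
  generalize Complex.Gamma (-I * ((lam 0 + I * ε) + a + b - u) + 1 / 2) = G₁ at g1 ⊢
  generalize Complex.Gamma (-I * ((lam 0 + I * ε) + a + b - v) + 1 / 2) = G₂ at g2 ⊢
  generalize Complex.Gamma (I * ((lam 2 : ℂ) - u) + 1 / 2) = G₃ at g3 ⊢
  generalize Complex.Gamma (I * ((lam 2 : ℂ) - v) + 1 / 2) = G₄ at g4 ⊢
  generalize Complex.Gamma (I * u - I * v) = G₅ at hrec ⊢
  generalize Complex.Gamma (-I * u + I * v) = G₆ at hrec ⊢
  generalize Complex.Gamma _ = b1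
  generalize Complex.Gamma _ = b2
  generalize Complex.Gamma _ = b3
  generalize Complex.Gamma _ = b4
  generalize Complex.Gamma _ = b5
  generalize Complex.Gamma _ = b6
  generalize Complex.Gamma _ = b7
  generalize Complex.Gamma _ = b8
  generalize rising _ _ = r1
  generalize rising _ _ = r2
  generalize exp (-(Real.pi * ((lam 0 + I * ε) + a + b + I * ϰ - I * ϰ) / 2)) = E₁ at hexp ⊢
  generalize exp (Real.pi * ((lam 0 + I * ε) + a + b) / 2) = E₂ at hexp ⊢
  generalize sinh (Real.pi * (u - v : ℂ)) = S at hrec ⊢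
  refine eq_of_eq_mul_mul_inv g1 (eq_of_eq_mul_mul_inv g2 (eq_of_eq_mul_mul_inv g3
    (eq_of_eq_mul_mul_inv g4 ?_)))
  linear_combination (1 / (4 * Real.pi) * (b1 / b2) * b3 * b4 * cNorm * (b5 * b6 * (b7 * b8))
    * (r1 * r2) * (G₁ * G₁⁻¹) * (G₂ * G₂⁻¹) * (G₃ * G₃⁻¹) * (G₄ * G₄⁻¹))
    * (E₁ * E₂ * hrec + ((u : ℂ) - v) * S / Real.pi * hexp)

/-- `α = 1/2 - i (γ₁ - γ₂ + s₁₁)` and `q = 1 - i s₁₁ - i s₂₂` -/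
noncomputable def ggBasis (lam : Fin 3 → ℝ) (ε : ℝ) (n : ℕ) (a d : ℂ) : ℂ :=
  rising n (1 / 2 - I * (gam lam ε 0 - gam lam ε 1 + a)) * rising n (1 - I * a - I * d)

/-- `B_L†` on the vectors `ψ̃_R h(τ₁₁, τ₂₁ + τ₂₂) (Y(τ₂₁))_n (Y(τ₂₂))_n`. -/
theorem integrable_kerLdag_mul_psiRt (lam : Fin 3 → ℝ) (ε ϰ : ℝ) (hε : 0 < ε) (hε' : ε < 1 / 2)
    (n : ℕ) (a b d : ℝ) :
    Integrable (fun u : ℝ =>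
      kerLdag lam ε ϰ a b (gam lam ε 0 + a + b + I * ϰ) u ((lam 0 + lam 1 + a + d - u : ℝ) : ℂ)
      * (psiRt lam ε (gam lam ε 0 + a + b) u ((lam 0 + lam 1 + a + d - u : ℝ) : ℂ)
        * gtBasis lam ε n u ((lam 0 + lam 1 + a + d - u : ℝ) : ℂ))) ∧
    ∫ u : ℝ,
      kerLdag lam ε ϰ a b (gam lam ε 0 + a + b + I * ϰ) u ((lam 0 + lam 1 + a + d - u : ℝ) : ℂ)
      * (psiRt lam ε (gam lam ε 0 + a + b) u ((lam 0 + lam 1 + a + d - u : ℝ) : ℂ)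
        * gtBasis lam ε n u ((lam 0 + lam 1 + a + d - u : ℝ) : ℂ))
      = phiR a b d * ggBasis lam ε n a d := by
  simp only [kerLdag_mul_psiRt lam ε ϰ hε n a b d]
  -- The real parts are ε, 1/2 - ε and 1/2 + ε + n: both bounds on ε are used, and ϰ has
  -- disappeared.
  have r1 : 0 < (I * ((lam 1 + d - lam 0 - a) / 2) + ε : ℂ).re := by simpa
  have r2 : 0 < (I * ((lam 0 - lam 1 - a - d) / 2) - ε + 1 / 2 : ℂ).re := by simp; linarith
  have r3 : 0 < (I * ((lam 1 - lam 0 - a - d) / 2) + ε + 1 / 2 + n : ℂ).re := by simp; positivity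
  have hi := integrable_hahn r1 r2 r3
  refine ⟨(hi.comp_sub_right _).const_mul _, ?_⟩
  rw [integral_const_mul, integral_sub_right_eq_self (fun y : ℝ => hahn _ _ _ (y : ℂ)),
    integral_hahn r1 r2 r3]
  have hα : 0 < (1 / 2 - I * (gam lam ε 0 - gam lam ε 1 + a) : ℂ).re := by simp; linarith
  have hq : 0 < (1 - I * a - I * d : ℂ).re := by simp
  -- The pairwise sums are 1/2 - is₁₁, α + n and q + n. The first and third give Gammas of `phiR`,
  -- while Γ(α) cancels; (α)_n and (q)_n split off.
  rw [show I * (((lam 1 : ℂ) + d - lam 0 - a) / 2) + ε + (I * ((lam 0 - lam 1 - a - d) / 2) - ε + 1 / 2)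
      = 1 / 2 - I * a by ring,
    show I * (((lam 1 : ℂ) + d - lam 0 - a) / 2) + ε
      + (I * ((lam 1 - lam 0 - a - d) / 2) + ε + 1 / 2 + n)
      = 1 / 2 - I * (gam lam ε 0 - gam lam ε 1 + a) + n by
      rw [gam_zero, gam_one]; linear_combination (2 * ε : ℂ) * I_mul_I,
    show I * (((lam 0 : ℂ) - lam 1 - a - d) / 2) - ε + 1 / 2
      + (I * ((lam 1 - lam 0 - a - d) / 2) + ε + 1 / 2 + n)
      = 1 - I * a - I * d + n by ring,
    ← rising_mul_Gamma n hα, ← rising_mul_Gamma n hq, phiR, ggBasis]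
  have g := Complex.Gamma_ne_zero_of_re_pos hα
  have hpi : (Real.pi : ℂ) ≠ 0 := by exact_mod_cast Real.pi_ne_zero
  generalize Complex.Gamma (1 / 2 - I * (gam lam ε 0 - gam lam ε 1 + a)) = G at g ⊢
  iterate 3 generalize Complex.Gamma _ = G
  iterate 2 generalize rising _ _ = r
  refine eq_of_eq_mul_mul_inv g (eq_of_eq_mul_mul_inv hpi (eq_of_eq_mul_mul_inv hpi ?_))
  ring

/-! ### Analytic continuation in the first variable -/

lemma differentiableAt_psiRt (lam : Fin 3 → ℝ) (ε : ℝ) (u v : ℝ) {t : ℂ} (ht : -(1 / 2) < t.im) :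
    DifferentiableAt ℂ (fun t => psiRt lam ε t u v) t := by
  have hG : ∀ w : ℝ, DifferentiableAt ℂ (fun t => Complex.Gamma (I * (w - t) + 1 / 2)) t :=
    fun w => DifferentiableAt.comp t (f := fun t => I * (w - t) + 1 / 2)
      (differentiableAt_Gamma_of_re_pos (by simp; linarith)) (by fun_prop)
  unfold psiRt
  exact (DifferentiableAt.mul (by fun_prop) ((hG u).mul (hG v))).mul_const _

lemma ext1_BR (lam : Fin 3 → ℝ) (ε ϰ : ℝ) (hε : 0 < ε) (hϰ : 0 < ϰ) (h : ϰ + ε < 1 / 2)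
    {t : ℂ} (ht : 0 ≤ t.im) (u v : ℝ) :
    ext1 (BR lam ε ϰ phiR) t u v = psiRt lam ε (t - I * ϰ) u v := by
  refine stripExt_eq (Φ := fun t => psiRt lam ε (t - I * ϰ) u v) ⟨?_, fun x => ?_⟩
  -- The Gammas Γ(i(τ₂ⱼ-t) - ϰ + 1/2) have their first poles on Im t = ϰ - 1/2 < 0, so the
  -- continuation reaches every point of the closed upper half-plane.
  · have hopen : IsOpen {z : ℂ | ϰ - 1 / 2 < z.im} := isOpen_lt continuous_const continuous_im
    have hd : DifferentiableOn ℂ (fun t => psiRt lam ε (t - I * ϰ) u v)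
        {z : ℂ | ϰ - 1 / 2 < z.im} := fun z hz =>
      (DifferentiableAt.comp z (f := fun t => t - I * ϰ) (differentiableAt_psiRt lam ε u v
        (by simp; linarith [show ϰ - 1 / 2 < z.im from hz])) (by fun_prop)).differentiableWithinAt
    refine (hd.analyticOnNhd hopen).mono fun z hz => ?_
    have hz' : z.im ∈ uIcc 0 t.im := hz
    rw [uIcc_of_le ht] at hz'
    show ϰ - 1 / 2 < z.im
    linarith [hz'.1]
  · exact (integrable_BRint_phiR lam ε ϰ hε hϰ h x u v).2.symm

lemma ext1_BL (lam : Fin 3 → ℝ) (ε ϰ : ℝ) (hε : 0 < ε) (hε' : ε < 1 / 2) (hϰ : 0 < ϰ)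
    (t : ℂ) (u v : ℝ) :
    ext1 (BL lam ε ϰ (phiL lam ε)) t u v = psiLt (t - I * ϰ) u v := by
  refine stripExt_eq (Φ := fun t => psiLt (t - I * ϰ) u v) ⟨?_, fun x => ?_⟩
  · have hd : Differentiable ℂ (fun t => psiLt (t - I * ϰ) u v) := by
      unfold psiLt
      fun_prop
    exact (hd.differentiableOn.analyticOnNhd isOpen_univ).mono (subset_univ _)
  · exact (integrable_BLint_phiL lam ε ϰ hε hε' hϰ x u v).2.symm

/-- The Cartan generators of the two realizations agree on the support of the kernel. -/
lemma gtCartan_eq_ggCartan (lam : Fin 3 → ℝ) (ε : ℝ) (i : Fin 3) (a b d u : ℂ) :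
    gtCartan lam ε i (gam lam ε 0 + a + b) u (lam 0 + lam 1 + a + d - u)
      = ggCartan lam ε i a b d := by
  fin_cases i <;> simp [gtCartan, ggCartan] <;> ring

/-- The Cartan generators depend only on τ₁₁ and τ₂₁+τ₂₂, both fixed by the delta-functions, so the
exponential leaves the integral. -/
theorem BLdag_expGTShift (lam : Fin 3 → ℝ) (ε ϰ : ℝ) (x : Fin 3 → ℝ) (f : ℂ → ℝ → ℝ → ℂ) :
    BLdag lam ε ϰ (expGTShift lam ε ϰ x f) = expGG lam ε x (BLdag lam ε ϰ f) := by
  funext a b d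
  rw [expGG, BLdag, BLdag, ← integral_const_mul]
  refine integral_congr_ae (ae_of_all _ fun u => ?_)
  simp only [BLdagInt, cdelta, expGTShift]
  rw [show gam lam ε 0 + a + b + I * ϰ - I * ϰ = gam lam ε 0 + a + b by ring]
  push_cast
  simp only [gtCartan_eq_ggCartan]
  ring

lemma BLdagInt_ext1_BR (lam : Fin 3 → ℝ) (ε ϰ : ℝ) (hε : 0 < ε) (hϰ : 0 < ϰ) (h : ϰ + ε < 1 / 2)
    (a b d u : ℝ) :
    BLdagInt lam ε ϰ (ext1 (BR lam ε ϰ phiR)) a b d u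
      = kerLdag lam ε ϰ a b (gam lam ε 0 + a + b + I * ϰ) u ((lam 0 + lam 1 + a + d - u : ℝ) : ℂ)
      * psiRt lam ε (gam lam ε 0 + a + b) u ((lam 0 + lam 1 + a + d - u : ℝ) : ℂ) := by
  rw [BLdagInt, cdelta, ext1_BR lam ε ϰ hε hϰ h (by simp; linarith), add_sub_cancel_right]

theorem integrable_BLdagInt_BR (lam : Fin 3 → ℝ) (ε ϰ : ℝ) (hε : 0 < ε) (hϰ : 0 < ϰ)
    (h : ϰ + ε < 1 / 2) (a b d : ℝ) :
    Integrable (BLdagInt lam ε ϰ (ext1 (BR lam ε ϰ phiR)) a b d) ∧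
      BLdag lam ε ϰ (ext1 (BR lam ε ϰ phiR)) a b d = phiR a b d := by
  have := integrable_kerLdag_mul_psiRt lam ε ϰ hε (by linarith) 0 a b d
  simp only [gtBasis, ggBasis, rising_zero, mul_one] at this
  have hf : BLdagInt lam ε ϰ (ext1 (BR lam ε ϰ phiR)) a b d = _ :=
    funext (BLdagInt_ext1_BR lam ε ϰ hε hϰ h a b d)
  rw [BLdag, hf]
  exact this

/-! ### Regular points and the generators conjugated by the Whittaker vectors -/

/-- `x` is not an integer. -/
def NonInt (x : ℂ) : Prop := ∀ n : ℤ, x ≠ n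

lemma NonInt.of_eq {x y : ℂ} (h : NonInt x) (k : ℤ) (e : y = x + k) : NonInt y := fun n hn =>
  h (n - k) (by push_cast; linear_combination hn - e)

lemma NonInt.ne_zero {x : ℂ} (h : NonInt x) : x ≠ 0 := by simpa using h 0

lemma NonInt.Gamma_eq {x y : ℂ} (h : NonInt x) (e : y = x + 1) :
    Complex.Gamma y = x * Complex.Gamma x := by
  rw [e, Complex.Gamma_add_one _ h.ne_zero]

lemma nonInt_of_im_ne_zero {x : ℂ} (h : x.im ≠ 0) : NonInt x := fun n hn => h (by simp [hn])

/-- The points where all factors of the Gelfand-Tsetlin vectors are regular. -/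
structure GoodGT (lam : Fin 3 → ℝ) (ε : ℝ) (t u v : ℂ) : Prop where
  uv : NonInt (I * u - I * v)
  ut : NonInt (I * (u - t) + 1 / 2)
  vt : NonInt (I * (v - t) + 1 / 2)
  hu (k : Fin 3) : NonInt (I * (gam lam ε k - u) + 1 / 2)
  hv (k : Fin 3) : NonInt (I * (gam lam ε k - v) + 1 / 2)

/-- The points where all factors of the Gauss-Givental vectors are regular. -/
structure GoodGG (a b d : ℂ) : Prop where
  hb : NonInt (1 / 2 - I * b)
  ha : NonInt (1 / 2 - I * a)
  had : NonInt (1 - I * a - I * d)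

section shifts

variable {lam : Fin 3 → ℝ} {ε : ℝ} {t u v a b d : ℂ}

/-- A shift of a variable by ±i changes each of the listed quantities by an integer, so the regular
points are stable under all difference operators. -/
lemma GoodGT.t_sub (h : GoodGT lam ε t u v) : GoodGT lam ε (t - I) u v :=
  ⟨h.uv, h.ut.of_eq (-1) (by push_cast; linear_combination I_mul_I),
    h.vt.of_eq (-1) (by push_cast; linear_combination I_mul_I), h.hu, h.hv⟩

lemma GoodGT.t_add (h : GoodGT lam ε t u v) : GoodGT lam ε (t + I) u v :=
  ⟨h.uv, h.ut.of_eq 1 (by push_cast; linear_combination -I_mul_I),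
    h.vt.of_eq 1 (by push_cast; linear_combination -I_mul_I), h.hu, h.hv⟩

lemma GoodGT.u_sub (h : GoodGT lam ε t u v) : GoodGT lam ε t (u - I) v :=
  ⟨h.uv.of_eq 1 (by push_cast; linear_combination -I_mul_I),
    h.ut.of_eq 1 (by push_cast; linear_combination -I_mul_I), h.vt,
    fun k => (h.hu k).of_eq (-1) (by push_cast; linear_combination I_mul_I), h.hv⟩

lemma GoodGT.u_add (h : GoodGT lam ε t u v) : GoodGT lam ε t (u + I) v :=
  ⟨h.uv.of_eq (-1) (by push_cast; linear_combination I_mul_I),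
    h.ut.of_eq (-1) (by push_cast; linear_combination I_mul_I), h.vt,
    fun k => (h.hu k).of_eq 1 (by push_cast; linear_combination -I_mul_I), h.hv⟩

lemma GoodGT.v_sub (h : GoodGT lam ε t u v) : GoodGT lam ε t u (v - I) :=
  ⟨h.uv.of_eq (-1) (by push_cast; linear_combination I_mul_I), h.ut,
    h.vt.of_eq 1 (by push_cast; linear_combination -I_mul_I), h.hu,
    fun k => (h.hv k).of_eq (-1) (by push_cast; linear_combination I_mul_I)⟩

lemma GoodGT.v_add (h : GoodGT lam ε t u v) : GoodGT lam ε t u (v + I) :=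
  ⟨h.uv.of_eq 1 (by push_cast; linear_combination -I_mul_I), h.ut,
    h.vt.of_eq (-1) (by push_cast; linear_combination I_mul_I), h.hu,
    fun k => (h.hv k).of_eq 1 (by push_cast; linear_combination -I_mul_I)⟩

lemma GoodGG.b_sub (h : GoodGG a b d) : GoodGG a (b - I) d :=
  ⟨h.hb.of_eq (-1) (by push_cast; linear_combination I_mul_I), h.ha, h.had⟩

lemma GoodGG.b_add (h : GoodGG a b d) : GoodGG a (b + I) d :=
  ⟨h.hb.of_eq 1 (by push_cast; linear_combination -I_mul_I), h.ha, h.had⟩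

lemma GoodGG.a_sub (h : GoodGG a b d) : GoodGG (a - I) b d :=
  ⟨h.hb, h.ha.of_eq (-1) (by push_cast; linear_combination I_mul_I),
    h.had.of_eq (-1) (by push_cast; linear_combination I_mul_I)⟩

lemma GoodGG.a_add (h : GoodGG a b d) : GoodGG (a + I) b d :=
  ⟨h.hb, h.ha.of_eq 1 (by push_cast; linear_combination -I_mul_I),
    h.had.of_eq 1 (by push_cast; linear_combination -I_mul_I)⟩

lemma GoodGG.d_sub (h : GoodGG a b d) : GoodGG a b (d - I) :=
  ⟨h.hb, h.ha, h.had.of_eq (-1) (by push_cast; linear_combination I_mul_I)⟩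

lemma GoodGG.d_add (h : GoodGG a b d) : GoodGG a b (d + I) :=
  ⟨h.hb, h.ha, h.had.of_eq 1 (by push_cast; linear_combination -I_mul_I)⟩

/-- Each shift multiplies `psiRt` by a rational function, by the functional equation of Γ and
exp(±iπ/2) = ±i. This and the five relations below convert the generators into operators on the
coefficient of `psiRt`. -/
lemma psiRt_t_sub (h : GoodGT lam ε t u v) :
    psiRt lam ε (t - I) u v * (-I * (I * (t - u) + 1 / 2) * (I * (t - v) + 1 / 2))
      = -psiRt lam ε t u v := by
  have he : exp (Real.pi * (t - I) / 2) = exp (Real.pi * t / 2) * (-I) := by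
    rw [show (Real.pi : ℂ) * (t - I) / 2 = Real.pi * t / 2 + -Real.pi / 2 * I by ring, exp_add,
      Complex.exp_neg_pi_div_two_mul_I]
  simp only [psiRt, he]
  rw [h.t_sub.ut.Gamma_eq (y := I * (u - t) + 1 / 2) (by linear_combination -I_mul_I),
    h.t_sub.vt.Gamma_eq (y := I * (v - t) + 1 / 2) (by linear_combination -I_mul_I),
    show I * (u - (t - I)) + 1 / 2 = -(I * (t - u) + 1 / 2) by linear_combination I_mul_I,
    show I * (v - (t - I)) + 1 / 2 = -(I * (t - v) + 1 / 2) by linear_combination I_mul_I]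
  generalize Complex.Gamma (-(I * (t - u) + 1 / 2)) = G₁
  generalize Complex.Gamma (-(I * (t - v) + 1 / 2)) = G₂
  generalize Complex.Gamma (I * u - I * v) = G₃
  generalize I * (t - u) + 1 / 2 = X
  generalize I * (t - v) + 1 / 2 = X'
  generalize ∏ i, (Complex.Gamma (I * (gam lam ε i - u) + 1 / 2)
        * Complex.Gamma (I * (gam lam ε i - v) + 1 / 2)) = P
  linear_combination (cNorm * exp (Real.pi * t / 2) / G₃ * (G₁ * G₂) * P * X * X') * I_mul_I

lemma psiRt_t_add (h : GoodGT lam ε t u v) :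
    psiRt lam ε (t + I) u v * (-I)
      = psiRt lam ε t u v * ((I * (u - t) + 1 / 2) * (I * (v - t) + 1 / 2)) := by
  have he : exp (Real.pi * (t + I) / 2) = exp (Real.pi * t / 2) * I := by
    rw [show (Real.pi : ℂ) * (t + I) / 2 = Real.pi * t / 2 + Real.pi / 2 * I by ring, exp_add,
      Complex.exp_pi_div_two_mul_I]
  simp only [psiRt, he]
  rw [h.ut.Gamma_eq (y := I * (u - (t + I)) + 1 / 2) (by linear_combination -I_mul_I),
    h.vt.Gamma_eq (y := I * (v - (t + I)) + 1 / 2) (by linear_combination -I_mul_I)]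
  generalize Complex.Gamma (I * (u - t) + 1 / 2) = G₁
  generalize Complex.Gamma (I * (v - t) + 1 / 2) = G₂
  generalize Complex.Gamma (I * u - I * v) = G₃
  generalize I * (u - t) + 1 / 2 = X
  generalize I * (v - t) + 1 / 2 = X'
  generalize ∏ i, (Complex.Gamma (I * (gam lam ε i - u) + 1 / 2)
        * Complex.Gamma (I * (gam lam ε i - v) + 1 / 2)) = P
  linear_combination -(cNorm * exp (Real.pi * t / 2) / G₃ * (G₁ * G₂) * P * X * X') * I_mul_I

lemma psiRt_u_sub (h : GoodGT lam ε t u v) :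
    psiRt lam ε t (u - I) v * ∏ i, (I * (u - gam lam ε i) + 1 / 2)
      = -(psiRt lam ε t u v * ((I * (u - t) + 1 / 2) / (I * u - I * v))) := by
  have hk : ∀ k, Complex.Gamma (I * (gam lam ε k - u) + 1 / 2)
      = -(I * (u - gam lam ε k) + 1 / 2)
        * Complex.Gamma (I * (gam lam ε k - (u - I)) + 1 / 2) := fun k => by
    rw [(h.u_sub.hu k).Gamma_eq (y := I * (gam lam ε k - u) + 1 / 2)
      (by linear_combination -I_mul_I)]
    congr 1
    linear_combination I_mul_I
  simp only [psiRt, Fin.prod_univ_three, hk]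
  rw [h.ut.Gamma_eq (y := I * (u - I - t) + 1 / 2) (by linear_combination -I_mul_I),
    h.uv.Gamma_eq (y := I * (u - I) - I * v) (by linear_combination -I_mul_I)]
  generalize I * u - I * v = w
  iterate 9 generalize Complex.Gamma _ = G
  ring

lemma psiRt_v_sub (h : GoodGT lam ε t u v) :
    psiRt lam ε t u (v - I) * ((∏ i, (I * (v - gam lam ε i) + 1 / 2))
        / (I * (v - u) * (I * (u - v) - 1)))
      = psiRt lam ε t u v * ((I * (v - t) + 1 / 2) / (I * u - I * v)) := by
  have hk : ∀ k, Complex.Gamma (I * (gam lam ε k - v) + 1 / 2)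
      = -(I * (v - gam lam ε k) + 1 / 2)
        * Complex.Gamma (I * (gam lam ε k - (v - I)) + 1 / 2) := fun k => by
    rw [(h.v_sub.hv k).Gamma_eq (y := I * (gam lam ε k - v) + 1 / 2)
      (by linear_combination -I_mul_I)]
    congr 1
    linear_combination I_mul_I
  simp only [psiRt, Fin.prod_univ_three, hk]
  rw [h.vt.Gamma_eq (y := I * (v - I - t) + 1 / 2) (by linear_combination -I_mul_I),
    h.v_sub.uv.Gamma_eq (y := I * u - I * v) (by linear_combination -I_mul_I),
    show I * (v - u) = -(I * u - I * v) by ring, show I * (u - v) = I * u - I * v by ring,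
    show I * u - I * (v - I) = I * u - I * v - 1 by linear_combination I_mul_I]
  generalize I * u - I * v = w
  generalize w - 1 = w'
  iterate 9 generalize Complex.Gamma _ = G
  ring

lemma psiRt_u_add (h : GoodGT lam ε t u v) :
    psiRt lam ε t (u + I) v * ((I * (t - u) + 1 / 2) / (I * (u - v) * (I * (u - v) - 1)))
      = -(psiRt lam ε t u v * ((∏ i, (I * (gam lam ε i - u) + 1 / 2)) / (I * u - I * v))) := by
  have hk : ∀ k, Complex.Gamma (I * (gam lam ε k - (u + I)) + 1 / 2)
      = (I * (gam lam ε k - u) + 1 / 2)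
        * Complex.Gamma (I * (gam lam ε k - u) + 1 / 2) := fun k =>
    (h.hu k).Gamma_eq (by linear_combination -I_mul_I)
  simp only [psiRt, Fin.prod_univ_three, hk]
  rw [h.u_add.ut.Gamma_eq (y := I * (u - t) + 1 / 2) (by linear_combination -I_mul_I),
    h.u_add.uv.Gamma_eq (y := I * u - I * v) (by linear_combination -I_mul_I),
    show I * (u - v) = I * u - I * v by ring,
    show I * (u + I) - I * v = I * u - I * v - 1 by linear_combination I_mul_I,
    show I * (u + I - t) + 1 / 2 = -(I * (t - u) + 1 / 2) by linear_combination I_mul_I]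
  generalize I * u - I * v = w
  generalize w - 1 = w'
  iterate 9 generalize Complex.Gamma _ = G
  ring

lemma psiRt_v_add (h : GoodGT lam ε t u v) :
    psiRt lam ε t u (v + I) * (I * (t - v) + 1 / 2)
      = -(psiRt lam ε t u v * ((∏ i, (I * (gam lam ε i - v) + 1 / 2)) / (I * u - I * v))) := by
  have hk : ∀ k, Complex.Gamma (I * (gam lam ε k - (v + I)) + 1 / 2)
      = (I * (gam lam ε k - v) + 1 / 2)
        * Complex.Gamma (I * (gam lam ε k - v) + 1 / 2) := fun k =>
    (h.hv k).Gamma_eq (by linear_combination -I_mul_I)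
  simp only [psiRt, Fin.prod_univ_three, hk]
  rw [h.v_add.vt.Gamma_eq (y := I * (v - t) + 1 / 2) (by linear_combination -I_mul_I),
    h.uv.Gamma_eq (y := I * u - I * (v + I)) (by linear_combination -I_mul_I),
    show I * (v + I - t) + 1 / 2 = -(I * (t - v) + 1 / 2) by linear_combination I_mul_I]
  generalize I * u - I * v = w
  iterate 9 generalize Complex.Gamma _ = G
  ring

end shifts

/-- Pairs of coefficient functions of `ψ̃_R` and `φ̂_R` that `B_L†` carries into each other. -/
inductive Rel (lam : Fin 3 → ℝ) (ε : ℝ) : Fn → Fn → Prop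
  | basis (h : ℂ → ℂ → ℂ) (n : ℕ) :
      Rel lam ε (fun t u v => h t (u + v) * gtBasis lam ε n u v)
        (fun a b d => h (gam lam ε 0 + a + b) (lam 0 + lam 1 + a + d) * ggBasis lam ε n a d)
  | add (p q P Q : Fn) : Rel lam ε p P → Rel lam ε q Q → Rel lam ε (p + q) (P + Q)

/-- `f = ψ̃_R p` at the regular points. -/
def IsGT (lam : Fin 3 → ℝ) (ε : ℝ) (f p : Fn) : Prop :=
  ∀ t u v, GoodGT lam ε t u v → f t u v = psiRt lam ε t u v * p t u v

/-- `g = φ̂_R P` at the regular points. -/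
def IsGG (g P : Fn) : Prop := ∀ a b d, GoodGG a b d → g a b d = phiR a b d * P a b d

/-- `f` and `g` have corresponding coefficient functions. -/
def Matched (lam : Fin 3 → ℝ) (ε : ℝ) (f g : Fn) : Prop :=
  ∃ p P, Rel lam ε p P ∧ IsGT lam ε f p ∧ IsGG g P

/-! The operators conjugated by `ψ̃_R` and by `φ̂_R`. -/

noncomputable def coefE12 (p : Fn) : Fn := fun t u v => -p (t - I) u v

noncomputable def coefE21 (p : Fn) : Fn := fun t u v =>
  (I * (u - t) + 1 / 2) * (I * (v - t) + 1 / 2) * p (t + I) u v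

noncomputable def coefE23 (p : Fn) : Fn := fun t u v =>
  -(((I * (u - t) + 1 / 2) * p t (u - I) v - (I * (v - t) + 1 / 2) * p t u (v - I))
    / (I * u - I * v))

noncomputable def coefE32 (lam : Fin 3 → ℝ) (ε : ℝ) (p : Fn) : Fn := fun t u v =>
  -(((∏ i, (I * (gam lam ε i - u) + 1 / 2)) * p t (u + I) v
    - (∏ i, (I * (gam lam ε i - v) + 1 / 2)) * p t u (v + I)) / (I * u - I * v))

noncomputable def coefGGE12 (p : Fn) : Fn := fun a b d => -p a (b - I) d

noncomputable def coefGGE21 (lam : Fin 3 → ℝ) (ε : ℝ) (p : Fn) : Fn := fun a b d =>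
  (I * (gam lam ε 1 - gam lam ε 0 - a) + 1 / 2) * (1 / 2 - I * a) * p (a + I) b (d - I)
  + (I * (gam lam ε 1 - gam lam ε 0 - a - b + d) + 1 / 2) * (1 / 2 - I * b) * p a (b + I) d

noncomputable def coefGGE23 (p : Fn) : Fn := fun a b d =>
  (-(1 / 2 - I * b) * p (a - I) (b + I) d + (I * (a - b + d) + 1 / 2) * p a b (d - I))
    / (-I * a - I * d)

noncomputable def coefGGE32 (lam : Fin 3 → ℝ) (ε : ℝ) (p : Fn) : Fn := fun a b d =>
  (I * (gam lam ε 2 - gam lam ε 1 - d) + 1 / 2) * (1 - I * a - I * d) * p a b (d + I)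

section conj

variable {lam : Fin 3 → ℝ} {ε : ℝ} {f g p P : Fn}

lemma IsGT.gtE12 (h : IsGT lam ε f p) : IsGT lam ε (gtE12 f) (coefE12 p) := fun t u v hg => by
  rw [Gl3Whittaker.gtE12, coefE12, h _ _ _ hg.t_sub]
  linear_combination p (t - I) u v * psiRt_t_sub hg

lemma IsGT.gtE21 (h : IsGT lam ε f p) : IsGT lam ε (gtE21 f) (coefE21 p) := fun t u v hg => by
  rw [Gl3Whittaker.gtE21, coefE21, h _ _ _ hg.t_add]
  linear_combination p (t + I) u v * psiRt_t_add hg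

lemma IsGT.gtE23 (h : IsGT lam ε f p) : IsGT lam ε (gtE23 lam ε f) (coefE23 p) :=
  fun t u v hg => by
  rw [Gl3Whittaker.gtE23, coefE23, h _ _ _ hg.u_sub, h _ _ _ hg.v_sub]
  linear_combination p t (u - I) v * psiRt_u_sub hg + p t u (v - I) * psiRt_v_sub hg

lemma IsGT.gtE32 (h : IsGT lam ε f p) : IsGT lam ε (gtE32 f) (coefE32 lam ε p) :=
  fun t u v hg => by
  rw [Gl3Whittaker.gtE32, coefE32, h _ _ _ hg.u_add, h _ _ _ hg.v_add]
  linear_combination p t (u + I) v * psiRt_u_add hg - p t u (v + I) * psiRt_v_add hg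

lemma IsGG.ggE12 (h : IsGG g P) : IsGG (ggE12 g) (coefGGE12 P) := fun a b d hg => by
  rw [Gl3Whittaker.ggE12, coefGGE12, h _ _ _ hg.b_sub, phiR, phiR,
    hg.b_sub.hb.Gamma_eq (y := 1 / 2 - I * b) (by linear_combination -I_mul_I),
    show 1 / 2 - I * (b - I) = -(I * b + 1 / 2) by linear_combination I_mul_I]
  ring

lemma IsGG.ggE21 (h : IsGG g P) : IsGG (ggE21 lam ε g) (coefGGE21 lam ε P) := fun a b d hg => by
  rw [Gl3Whittaker.ggE21, coefGGE21, h _ _ _ hg.b_add, h _ _ _ hg.a_add.d_sub, phiR, phiR, phiR,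
    hg.hb.Gamma_eq (y := 1 / 2 - I * (b + I)) (by linear_combination -I_mul_I),
    hg.ha.Gamma_eq (y := 1 / 2 - I * (a + I)) (by linear_combination -I_mul_I),
    show 1 - I * (a + I) - I * (d - I) = 1 - I * a - I * d by ring]
  ring

lemma IsGG.ggE23 (h : IsGG g P) : IsGG (ggE23 g) (coefGGE23 P) := fun a b d hg => by
  -- Lowering s₂₂ or s₁₁ by i divides the third Gamma of `phiR` by this quantity: the source of the
  -- poles on s₁₁+s₂₂ = 0.
  have h1 : -I * a - I * d ≠ 0 := (hg.had.of_eq (-1) (by push_cast; ring)).ne_zero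
  rw [Gl3Whittaker.ggE23, coefGGE23, h _ _ _ hg.d_sub, h _ _ _ hg.a_sub.b_add, phiR, phiR, phiR,
    hg.hb.Gamma_eq (y := 1 / 2 - I * (b + I)) (by linear_combination -I_mul_I),
    hg.a_sub.ha.Gamma_eq (y := 1 / 2 - I * a) (by linear_combination -I_mul_I),
    show 1 - I * (a - I) - I * d = 1 - I * a - I * (d - I) by ring,
    hg.d_sub.had.Gamma_eq (y := 1 - I * a - I * d) (by linear_combination -I_mul_I),
    show 1 / 2 - I * (a - I) = -(I * a + 1 / 2) by linear_combination I_mul_I,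
    show 1 - I * a - I * (d - I) = -I * a - I * d by linear_combination I_mul_I]
  generalize Complex.Gamma _ = G
  generalize Complex.Gamma _ = G
  generalize Complex.Gamma _ = G
  generalize -I * a - I * d = w at h1
  field_simp
  ring

lemma IsGG.ggE32 (h : IsGG g P) : IsGG (ggE32 lam ε g) (coefGGE32 lam ε P) := fun a b d hg => by
  rw [Gl3Whittaker.ggE32, coefGGE32, h _ _ _ hg.d_add, phiR, phiR,
    hg.had.Gamma_eq (y := 1 - I * a - I * (d + I)) (by linear_combination -I_mul_I)]
  ring

lemma IsGT.add {f' p' : Fn} (h : IsGT lam ε f p) (h' : IsGT lam ε f' p') :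
    IsGT lam ε (f + f') (p + p') := fun t u v hg => by
  simp only [Pi.add_apply, h _ _ _ hg, h' _ _ _ hg]; ring

lemma IsGG.add {g' P' : Fn} (h : IsGG g P) (h' : IsGG g' P') :
    IsGG (g + g') (P + P') := fun a b d hg => by
  simp only [Pi.add_apply, h _ _ _ hg, h' _ _ _ hg]; ring

lemma gam_zero_add_gam_one (lam : Fin 3 → ℝ) (ε : ℝ) :
    gam lam ε 0 + gam lam ε 1 = lam 0 + lam 1 := by
  simp

/-- The operators `A` and `B` preserve the correspondence of coefficient functions. -/
def RelOp (lam : Fin 3 → ℝ) (ε : ℝ) (A B : Fn → Fn) : Prop :=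
  ∀ p P, Rel lam ε p P → ∃ q Q, Rel lam ε q Q ∧
    (∀ t u v, GoodGT lam ε t u v → A p t u v = q t u v) ∧
    ∀ a b d, GoodGG a b d → B P a b d = Q a b d

/-- Pairs in `Rel` are finite sums of basis pairs, so additive operators need only be compared on
the latter. -/
lemma RelOp.of_basis {A B : Fn → Fn} (hA : ∀ p q, A (p + q) = A p + A q)
    (hB : ∀ p q, B (p + q) = B p + B q)
    (hb : ∀ (h : ℂ → ℂ → ℂ) (n : ℕ), ∃ q Q, Rel lam ε q Q ∧
      (∀ t u v, GoodGT lam ε t u v →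
        A (fun t u v => h t (u + v) * gtBasis lam ε n u v) t u v = q t u v) ∧
      ∀ a b d, GoodGG a b d → B (fun a b d => h (gam lam ε 0 + a + b) (lam 0 + lam 1 + a + d)
        * ggBasis lam ε n a d) a b d = Q a b d) : RelOp lam ε A B := by
  intro p P h
  induction h with
  | basis h n => exact hb h n
  | add p q P Q _ _ ih ih' =>
    obtain ⟨p₁, P₁, h₁, hp₁, hP₁⟩ := ih
    obtain ⟨p₂, P₂, h₂, hp₂, hP₂⟩ := ih'
    refine ⟨_, _, h₁.add _ _ _ _ h₂, fun t u v hg => ?_, fun a b d hg => ?_⟩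
    · simp only [hA, Pi.add_apply, hp₁ t u v hg, hp₂ t u v hg]
    · simp only [hB, Pi.add_apply, hP₁ a b d hg, hP₂ a b d hg]

lemma relOp_mul (c : ℂ → ℂ → ℂ) : RelOp lam ε (fun p t u v => c t (u + v) * p t u v)
    (fun P a b d => c (gam lam ε 0 + a + b) (lam 0 + lam 1 + a + d) * P a b d) := by
  refine .of_basis (fun p q => ?_) (fun p q => ?_) fun h n =>
    ⟨_, _, .basis (fun t s => c t s * h t s) n, fun t u v hg => by ring, fun a b d hg => by ring⟩
  all_goals
    funext t u v
    simp only [Pi.add_apply]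
    ring

lemma relOp_E12 : RelOp lam ε coefE12 coefGGE12 := by
  refine .of_basis (fun p q => ?_) (fun p q => ?_) fun h n =>
    ⟨_, _, .basis (fun t s => -h (t - I) s) n, fun t u v hg => ?_, fun a b d hg => ?_⟩
  · funext t u v
    simp only [coefE12, Pi.add_apply]
    ring
  · funext t u v
    simp only [coefGGE12, Pi.add_apply]
    ring
  · simp only [coefE12]
    ring
  · simp only [coefGGE12, add_sub_assoc]
    ring

/-- Put x = Y(u)+n, x' = Y(v)+n and c = n + i(γ₂-t) + 1. The coefficient is (c-x)(c-x') = c² -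
c(x+x') + xx'; the sum x+x' depends only on u+v, and xx' raises the index by one. On the
Gauss-Givental side the identity is α(α+1)_n = (α)_n(α+n). -/
lemma relOp_E21 : RelOp lam ε coefE21 (coefGGE21 lam ε) := by
  refine .of_basis (fun p q => ?_) (fun p q => ?_) fun h n =>
    ⟨_, _, .add _ _ _ _ (.basis (fun t s => h (t + I) s *
      ((n + I * (gam lam ε 1 - t) + 1) ^ 2 - (n + I * (gam lam ε 1 - t) + 1)
        * (2 * I * gam lam ε 1 - I * s + 1 + 2 * n))) n)
      (.basis (fun t s => h (t + I) s) (n + 1)), fun t u v hg => ?_, fun a b d hg => ?_⟩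
  · funext t u v
    simp only [coefE21, Pi.add_apply]
    ring
  · funext t u v
    simp only [coefGGE21, Pi.add_apply]
    ring
  · simp only [coefE21, Pi.add_apply, gtBasis, rising_succ]
    ring
  · have hr := rising_succ' n (1 / 2 - I * (gam lam ε 0 - gam lam ε 1 + a))
    rw [rising_succ] at hr
    simp only [coefGGE21, Pi.add_apply, ggBasis, rising_succ]
    rw [show gam lam ε 0 + (a + I) + b = gam lam ε 0 + a + b + I by ring,
      show gam lam ε 0 + a + (b + I) = gam lam ε 0 + a + b + I by ring,
      show (lam 0 + lam 1 + (a + I) + (d - I) : ℂ) = lam 0 + lam 1 + a + d by ring,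
      show 1 / 2 - I * (gam lam ε 0 - gam lam ε 1 + (a + I))
        = 1 / 2 - I * (gam lam ε 0 - gam lam ε 1 + a) + 1 by linear_combination -I_mul_I,
      show 1 - I * (a + I) - I * (d - I) = 1 - I * a - I * d by ring]
    rw [← gam_zero_add_gam_one lam ε]
    generalize gam lam ε 0 = g₀ at *
    generalize gam lam ε 1 = g₁ at *
    linear_combination -(1 / 2 - I * a) * h (g₀ + a + b + I) (g₀ + g₁ + a + d)
      * rising n (1 - I * a - I * d) * hr

/-- Since Y (Y+1)_n = (Y)_n (Y+n), the operator takes the divided difference of the cubic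
x(x+A)(x+B) at x = Y(u)+n and x' = Y(v)+n, where A = i(γ₁-γ₂)-n and B = i(γ₃-γ₂)-n. With S = x+x'
this is (S+A)(S+B) - xx'; the last term raises the index. -/
lemma relOp_E32 : RelOp lam ε (coefE32 lam ε) (coefGGE32 lam ε) := by
  refine .of_basis (fun p q => ?_) (fun p q => ?_) fun h n =>
    ⟨_, _, .add _ _ _ _ (.basis (fun t s => h t (s + I) *
      ((2 * I * gam lam ε 1 - I * s + 1 + n + I * (gam lam ε 0 - gam lam ε 1))
        * (2 * I * gam lam ε 1 - I * s + 1 + n + I * (gam lam ε 2 - gam lam ε 1)))) n)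
      (.basis (fun t s => -h t (s + I)) (n + 1)), fun t u v hg => ?_, fun a b d hg => ?_⟩
  · funext t u v
    simp only [coefE32, Pi.add_apply]
    ring
  · funext t u v
    simp only [coefGGE32, Pi.add_apply]
    ring
  · have hw := hg.uv.ne_zero
    have hr := fun w => rising_succ' n (I * (gam lam ε 1 - w) + 1 / 2)
    simp only [rising_succ] at hr
    simp only [coefE32, Pi.add_apply, gtBasis, rising_succ, Fin.prod_univ_three]
    have hu := hr u
    have hv := hr v
    rw [show u + I + v = u + v + I by ring, ← add_assoc u v I,
      show I * (gam lam ε 1 - (u + I)) + 1 / 2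
        = I * (gam lam ε 1 - u) + 1 / 2 + 1 by linear_combination -I_mul_I,
      show I * (gam lam ε 1 - (v + I)) + 1 / 2
        = I * (gam lam ε 1 - v) + 1 / 2 + 1 by linear_combination -I_mul_I]
    generalize rising n (I * (gam lam ε 1 - u) + 1 / 2 + 1) = R₁ at *
    generalize rising n (I * (gam lam ε 1 - v) + 1 / 2 + 1) = R₂ at *
    generalize rising n (I * (gam lam ε 1 - u) + 1 / 2) = R₃ at *
    generalize rising n (I * (gam lam ε 1 - v) + 1 / 2) = R₄ at *
    generalize gam lam ε 0 = g₀ at *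
    generalize gam lam ε 1 = g₁ at *
    generalize gam lam ε 2 = g₂ at *
    generalize h t (u + v + I) = H
    rw [← neg_div, div_eq_iff hw]
    linear_combination (I * (g₀ - u) + 1 / 2) * (I * (g₂ - u) + 1 / 2) * H * R₄ * hu
      - (I * (g₀ - v) + 1 / 2) * (I * (g₂ - v) + 1 / 2) * H * R₃ * hv
  · have hr := rising_succ' n (1 - I * a - I * d)
    rw [rising_succ] at hr
    simp only [coefGGE32, Pi.add_apply, ggBasis, rising_succ]
    rw [← add_assoc _ d I,
      show 1 - I * a - I * (d + I) = 1 - I * a - I * d + 1 by linear_combination -I_mul_I]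
    rw [← gam_zero_add_gam_one lam ε]
    generalize gam lam ε 0 = g₀ at *
    generalize gam lam ε 1 = g₁ at *
    generalize gam lam ε 2 = g₂ at *
    linear_combination -(I * (g₂ - g₁ - d) + 1 / 2) * h (g₀ + a + b) (g₀ + g₁ + a + d + I)
      * rising n (1 / 2 - I * (g₀ - g₁ + a)) * hr

/-- The lowering case. Using (Y-1)_{m+1} = (Y-1)(Y)_m and (Y)_{m+1} = (Y)_m(Y+m), the numerator is
(Y(u))_m(Y(v))_m times an antisymmetric polynomial. Its quotient by u-v is a multiple of
(Y(u)+m)(Y(v)+m) plus a function of t. For index 0 there is nothing to lower, hence the case split.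
-/
lemma relOp_E23 : RelOp lam ε coefE23 coefGGE23 := by
  refine .of_basis (fun p q => ?_) (fun p q => ?_) fun h n => ?_
  · funext t u v
    simp only [coefE23, Pi.add_apply]
    ring
  · funext t u v
    simp only [coefGGE23, Pi.add_apply]
    ring
  rcases n with - | m
  · refine ⟨_, _, .basis (fun t s => -h t (s - I)) 0, fun t u v hg => ?_, fun a b d hg => ?_⟩
    · have hw := hg.uv.ne_zero
      simp only [coefE23, gtBasis, rising_zero, mul_one]
      rw [show u - I + v = u + v - I by ring, ← add_sub_assoc u v I, ← neg_div, div_eq_iff hw]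
      ring
    · have h1 : -I * a - I * d ≠ 0 := (hg.had.of_eq (-1) (by push_cast; ring)).ne_zero
      simp only [coefGGE23, ggBasis, rising_zero, mul_one]
      rw [show (lam 0 + lam 1 + (a - I) + d : ℂ) = lam 0 + lam 1 + a + d - I by ring,
        show gam lam ε 0 + (a - I) + (b + I) = gam lam ε 0 + a + b by ring, ← add_sub_assoc _ d I,
        div_eq_iff h1]
      ring
  · refine ⟨_, _, .add _ _ _ _ (.basis (fun t s => -h t (s - I)) (m + 1))
      (.basis (fun t s => h t (s - I) * ((m + 1) * (m + (I * (gam lam ε 1 - t) + 1)))) m),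
      fun t u v hg => ?_, fun a b d hg => ?_⟩
    · have hw := hg.uv.ne_zero
      have hr := fun w => rising_succ' m (I * (gam lam ε 1 - w) + 1 / 2 - 1)
      simp only [sub_add_cancel] at hr
      simp only [coefE23, Pi.add_apply, gtBasis]
      rw [show u - I + v = u + v - I by ring, ← add_sub_assoc u v I,
        show I * (gam lam ε 1 - (u - I)) + 1 / 2
          = I * (gam lam ε 1 - u) + 1 / 2 - 1 by linear_combination I_mul_I,
        show I * (gam lam ε 1 - (v - I)) + 1 / 2
          = I * (gam lam ε 1 - v) + 1 / 2 - 1 by linear_combination I_mul_I, hr, hr, rising_succ,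
        rising_succ, ← neg_div, div_eq_iff hw]
      ring
    · have h1 : -I * a - I * d ≠ 0 := (hg.had.of_eq (-1) (by push_cast; ring)).ne_zero
      have hr := rising_succ' m (-I * a - I * d)
      have hr' := rising_succ' m (1 / 2 - I * (gam lam ε 0 - gam lam ε 1 + a) - 1)
      rw [sub_add_cancel] at hr'
      rw [show -I * a - I * d + 1 = 1 - I * a - I * d by ring] at hr
      simp only [coefGGE23, Pi.add_apply, ggBasis]
      rw [show (lam 0 + lam 1 + (a - I) + d : ℂ) = lam 0 + lam 1 + a + d - I by ring,
        show gam lam ε 0 + (a - I) + (b + I) = gam lam ε 0 + a + b by ring, ← add_sub_assoc _ d I,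
        show 1 - I * (a - I) - I * d = -I * a - I * d by linear_combination I_mul_I,
        show 1 - I * a - I * (d - I) = -I * a - I * d by linear_combination I_mul_I,
        show 1 / 2 - I * (gam lam ε 0 - gam lam ε 1 + (a - I))
          = 1 / 2 - I * (gam lam ε 0 - gam lam ε 1 + a) - 1 by linear_combination I_mul_I,
        hr, hr', rising_succ, rising_succ, div_eq_iff h1]
      ring

end conj

/-! ### Uniqueness of the meromorphic continuation of vectors of the Gauss-Givental space -/

lemma isOpen_nonInt : IsOpen {z : ℂ | NonInt z} := by
  have : {z : ℂ | NonInt z} = (range ((↑) : ℤ → ℂ))ᶜ := by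
    ext z
    simp only [NonInt, mem_ofPred_eq, mem_compl_iff, mem_range, not_exists]
    exact forall_congr' fun n => ne_comm
  rw [this]
  exact Complex.isClosedEmbedding_intCast.isClosed_range.isOpen_compl

lemma countable_not_nonInt (α : ℂ) : {z : ℂ | ¬NonInt (α - I * z)}.Countable := by
  have : {z : ℂ | ¬NonInt (α - I * z)} ⊆ range fun n : ℤ => I * (n - α) := by
    intro z hz
    simp only [NonInt, mem_ofPred_eq, not_forall, not_not] at hz
    obtain ⟨n, hn⟩ := hz
    exact ⟨n, by linear_combination -I * hn - z * I_mul_I⟩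
  exact (countable_range _).mono this

/-- The complement of a countable set in the plane is connected, and `U` contains a real point
because the reals are uncountable; zeros accumulate there, so the identity theorem applies. -/
lemma eqOn_zero_of_real {U : Set ℂ} (hU : IsOpen U) (hc : Uᶜ.Countable) {f : ℂ → ℂ}
    (hf : ∀ z ∈ U, DifferentiableAt ℂ f z) (h0 : ∀ x : ℝ, (x : ℂ) ∈ U → f x = 0) :
    ∀ z ∈ U, f z = 0 := by
  have hconn : IsPreconnected U := by
    have := (hc.isPathConnected_compl_of_one_lt_rank
      (by rw [Complex.rank_real_complex]; norm_num)).isConnected.isPreconnected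
    rwa [compl_compl] at this
  obtain ⟨x₀, hx₀⟩ : ∃ x : ℝ, (x : ℂ) ∈ U := by
    by_contra! h
    have h1 : ((↑) ⁻¹' Uᶜ : Set ℝ).Countable := hc.preimage ofReal_injective
    rw [show ((↑) ⁻¹' Uᶜ : Set ℝ) = univ from eq_univ_of_forall fun x => h x] at h1
    exact Cardinal.not_countable_real h1
  have hA : AnalyticOnNhd ℂ f U :=
    DifferentiableOn.analyticOnNhd (fun z hz => (hf z hz).differentiableWithinAt) hU
  have hfreq : ∃ᶠ z in 𝓝[≠] (x₀ : ℂ), f z = 0 := by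
    have ht : Tendsto (fun n : ℕ => ((x₀ + 1 / ((n : ℝ) + 1) : ℝ) : ℂ)) atTop (𝓝 (x₀ : ℂ)) := by
      have := (tendsto_one_div_add_atTop_nhds_zero_nat (𝕜 := ℝ)).const_add x₀
      rw [add_zero] at this
      exact (Complex.continuous_ofReal.tendsto x₀).comp this
    have ht' : Tendsto (fun n : ℕ => ((x₀ + 1 / ((n : ℝ) + 1) : ℝ) : ℂ)) atTop (𝓝[≠] (x₀ : ℂ)) := by
      refine tendsto_nhdsWithin_iff.2 ⟨ht, Eventually.of_forall fun n => ?_⟩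
      have hn : (1 : ℝ) / ((n : ℝ) + 1) ≠ 0 := by positivity
      simpa only [mem_compl_iff, mem_singleton_iff, ofReal_inj, add_eq_left] using hn
    exact ht'.frequently ((ht.eventually (hU.mem_nhds hx₀)).mono fun n hn => h0 _ hn).frequently
  exact fun z hz => hA.eqOn_zero_of_preconnected_of_frequently_eq_zero hconn hx₀ hfreq hz

/-- Holomorphy in each variable at the regular points. -/
def SepHol (g : Fn) : Prop := ∀ a b d, GoodGG a b d →
  DifferentiableAt ℂ (fun z => g z b d) a ∧ DifferentiableAt ℂ (fun z => g a z d) b ∧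
    DifferentiableAt ℂ (fun z => g a b z) d

lemma NonInt.differentiableAt_Gamma {x : ℂ} (h : NonInt x) : DifferentiableAt ℂ Complex.Gamma x :=
  Complex.differentiableAt_Gamma x fun m => by simpa using h (-m)

lemma sepHol_phiR : SepHol phiR := by
  intro a b d hg
  have h1 := hg.hb.differentiableAt_Gamma.comp b (f := fun b => 1 / 2 - I * b) (by fun_prop)
  have h2 := hg.ha.differentiableAt_Gamma.comp a (f := fun a => 1 / 2 - I * a) (by fun_prop)
  have h3 := hg.had.differentiableAt_Gamma.comp a (f := fun a => 1 - I * a - I * d) (by fun_prop)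
  have h4 := hg.had.differentiableAt_Gamma.comp d (f := fun d => 1 - I * a - I * d) (by fun_prop)
  refine ⟨(h2.const_mul (cNorm * Complex.Gamma (1 / 2 - I * b))).mul h3, ?_, h4.const_mul _⟩
  exact ((h1.const_mul cNorm).mul_const _).mul_const _

lemma SepHol.add {f g : Fn} (hf : SepHol f) (hg : SepHol g) : SepHol (f + g) := fun a b d h =>
  have h1 := hf a b d h
  have h2 := hg a b d h
  ⟨h1.1.add h2.1, h1.2.1.add h2.2.1, h1.2.2.add h2.2.2⟩

lemma SepHol.mul {c f : Fn} (hc : SepHol c) (hf : SepHol f) :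
    SepHol (fun a b d => c a b d * f a b d) := fun a b d h =>
  have h1 := hf a b d h
  have h2 := hc a b d h
  ⟨h2.1.mul h1.1, h2.2.1.mul h1.2.1, h2.2.2.mul h1.2.2⟩

lemma SepHol.translate {f : Fn} (hf : SepHol f) (α β δ : ℂ)
    (hg : ∀ a b d, GoodGG a b d → GoodGG (a + α) (b + β) (d + δ)) :
    SepHol (fun a b d => f (a + α) (b + β) (d + δ)) := fun a b d h => by
  obtain ⟨h1, h2, h3⟩ := hf _ _ _ (hg a b d h)
  exact ⟨h1.comp a (f := fun z => z + α) (by fun_prop),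
    h2.comp b (f := fun z => z + β) (by fun_prop), h3.comp d (f := fun z => z + δ) (by fun_prop)⟩

lemma SepHol.of_differentiable {c : Fn} (h1 : ∀ b d, Differentiable ℂ fun z => c z b d)
    (h2 : ∀ a d, Differentiable ℂ fun z => c a z d)
    (h3 : ∀ a b, Differentiable ℂ fun z => c a b z) : SepHol c :=
  fun _ _ _ _ => ⟨h1 _ _ _, h2 _ _ _, h3 _ _ _⟩

section

variable {lam : Fin 3 → ℝ} {ε : ℝ} {f : Fn}

lemma SepHol.opE12 (hf : SepHol f) : SepHol (ggE12 f) := by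
  have h := hf.translate 0 (-I) 0 fun a b d h => by simpa [← sub_eq_add_neg] using h.b_sub
  simp only [add_zero, ← sub_eq_add_neg] at h
  exact SepHol.mul (c := fun a b d => I * b + 1 / 2)
    (.of_differentiable (by fun_prop) (by fun_prop) (by fun_prop)) h

lemma SepHol.opE32 (hf : SepHol f) : SepHol (ggE32 lam ε f) := by
  have h := hf.translate 0 0 I fun a b d h => by simpa using h.d_add
  simp only [add_zero] at h
  exact SepHol.mul (c := fun a b d => I * (gam lam ε 2 - gam lam ε 1 - d) + 1 / 2)
    (.of_differentiable (by fun_prop) (by fun_prop) (by fun_prop)) h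

lemma SepHol.opE23 (hf : SepHol f) : SepHol (ggE23 f) := by
  have h := hf.translate (-I) I 0 fun a b d h => by
    simpa [← sub_eq_add_neg] using h.b_add.a_sub
  have h' := hf.translate 0 0 (-I) fun a b d h => by simpa [← sub_eq_add_neg] using h.d_sub
  simp only [add_zero, ← sub_eq_add_neg] at h h'
  exact (SepHol.mul (c := fun a b d => I * a + 1 / 2)
    (.of_differentiable (by fun_prop) (by fun_prop) (by fun_prop)) h).add
    (SepHol.mul (c := fun a b d => I * (a - b + d) + 1 / 2)
    (.of_differentiable (by fun_prop) (by fun_prop) (by fun_prop)) h')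

lemma SepHol.opE21 (hf : SepHol f) : SepHol (ggE21 lam ε f) := by
  have h := hf.translate I 0 (-I) fun a b d h => by
    simpa [← sub_eq_add_neg] using h.a_add.d_sub
  have h' := hf.translate 0 I 0 fun a b d h => by simpa using h.b_add
  simp only [add_zero, ← sub_eq_add_neg] at h h'
  exact (SepHol.mul (c := fun a b d => I * (gam lam ε 1 - gam lam ε 0 - a) + 1 / 2)
    (.of_differentiable (by fun_prop) (by fun_prop) (by fun_prop)) h).add
    (SepHol.mul (c := fun a b d => I * (gam lam ε 1 - gam lam ε 0 - a - b + d) + 1 / 2)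
    (.of_differentiable (by fun_prop) (by fun_prop) (by fun_prop)) h')

lemma SepHol.sub {f g : Fn} (hf : SepHol f) (hg : SepHol g) :
    SepHol (fun a b d => f a b d - g a b d) := fun a b d h =>
  have h1 := hf a b d h
  have h2 := hg a b d h
  ⟨h1.1.sub h2.1, h1.2.1.sub h2.2.1, h1.2.2.sub h2.2.2⟩

lemma SepHol.ggOp (hf : SepHol f) (i j : Fin 3) : SepHol (ggOp lam ε i j f) := by
  fin_cases i <;> fin_cases j
  · exact SepHol.mul (c := ggCartan lam ε 0) (.of_differentiable
      (by unfold ggCartan; fun_prop) (by unfold ggCartan; fun_prop) (by unfold ggCartan; fun_prop)) hf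
  · exact hf.opE12
  · exact hf.opE23.opE12.sub hf.opE12.opE23
  · exact hf.opE21
  · exact SepHol.mul (c := ggCartan lam ε 1) (.of_differentiable
      (by unfold ggCartan; fun_prop) (by unfold ggCartan; fun_prop) (by unfold ggCartan; fun_prop)) hf
  · exact hf.opE23
  · exact hf.opE21.opE32.sub hf.opE32.opE21
  · exact hf.opE32
  · exact SepHol.mul (c := ggCartan lam ε 2) (.of_differentiable
      (by unfold ggCartan; fun_prop) (by unfold ggCartan; fun_prop) (by unfold ggCartan; fun_prop)) hf

lemma GGSpace.sepHol {g : Fn} (h : GGSpace lam ε g) : SepHol g := by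
  induction h with
  | base => exact sepHol_phiR
  | add f g _ _ hf hg => exact hf.add hg
  | smul c f _ hf =>
    exact SepHol.mul (c := fun _ _ _ => c)
      (.of_differentiable (by fun_prop) (by fun_prop) (by fun_prop)) hf
  | act i j f _ hf => exact hf.ggOp i j

end

lemma nonInt_of_re {x : ℂ} (h0 : 0 < x.re) (h1 : x.re < 1) : NonInt x := fun n hn => by
  rw [hn] at h0 h1
  simp only [intCast_re] at h0 h1
  have : 0 < n := by exact_mod_cast h0
  have : n < 1 := by exact_mod_cast h1
  omega

lemma nonInt_half_sub_real (x : ℝ) : NonInt (1 / 2 - I * x) :=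
  nonInt_of_re (by simp) (by simp; norm_num)

lemma goodGG_real {a b d : ℝ} (h : a + d ≠ 0) : GoodGG a b d :=
  ⟨nonInt_half_sub_real b, nonInt_half_sub_real a, nonInt_of_im_ne_zero (by
    simp only [sub_im, one_im, mul_im, I_re, I_im, ofReal_im, ofReal_re]
    intro h'
    exact h (by linarith))⟩

/-- The real variables are freed one at a time: first `b`, then `a`, then `d`. For fixed values of
the others the singular points are countable, so `eqOn_zero_of_real` applies to each slice. -/
theorem SepHol.eq_zero_of_real {g : Fn} (hg : SepHol g)
    (h0 : ∀ a b d : ℝ, a + d ≠ 0 → g a b d = 0) (a b d : ℂ) (h : GoodGG a b d) : g a b d = 0 := by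
  have hopen : ∀ α : ℂ, IsOpen {z : ℂ | NonInt (α - I * z)} := fun α =>
    isOpen_nonInt.preimage (f := fun z => α - I * z) (by fun_prop)
  have step1 : ∀ a d : ℝ, a + d ≠ 0 → ∀ b, NonInt (1 / 2 - I * b) → g a b d = 0 := by
    intro a d had b hb
    refine eqOn_zero_of_real (f := fun b => g a b d) (hopen _) (countable_not_nonInt _)
      (fun z hz => (hg a z d ?_).2.1) (fun x _ => h0 a x d had) b hb
    exact ⟨hz, (goodGG_real (b := 0) had).ha, (goodGG_real (b := 0) had).had⟩
  have step2 : ∀ d : ℝ, ∀ b, NonInt (1 / 2 - I * b) → ∀ a, NonInt (1 / 2 - I * a) →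
      NonInt (1 - I * a - I * d) → g a b d = 0 := by
    intro d b hb a ha had
    refine eqOn_zero_of_real (f := fun a => g a b d)
      -- In the variable `a` two Gammas are singular. The second condition also excludes the real
      -- point with a + d = 0, where nothing is known.
      (U := {z | NonInt (1 / 2 - I * z)} ∩ {z | NonInt (1 - I * d - I * z)})
      ((hopen _).inter (hopen _)) ?_ (fun z hz => (hg z b d ⟨hb, hz.1, ?_⟩).1) (fun x hx => ?_)
      a ⟨ha, ?_⟩
    · rw [compl_inter]
      exact (countable_not_nonInt _).union (countable_not_nonInt _)
    · simpa only [mem_ofPred_eq, sub_right_comm] using hz.2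
    · refine step1 x d (fun hxd => ?_) b hb
      refine hx.2 1 ?_
      have : (x : ℂ) + d = 0 := by exact_mod_cast hxd
      push_cast
      linear_combination -I * this
    · simpa only [mem_ofPred_eq, sub_right_comm] using had
  refine eqOn_zero_of_real (f := fun d => g a b d) (hopen (1 - I * a))
    (countable_not_nonInt _) (fun z hz => (hg a b z ⟨h.hb, h.ha, hz⟩).2.2)
    (fun x hx => step2 x b h.hb a h.ha hx) d h.had

/-! ### The intertwining property -/

section

variable {lam : Fin 3 → ℝ} {ε : ℝ} {f g : Fn}

lemma Rel.smul {p P : Fn} (c : ℂ) (h : Rel lam ε p P) : Rel lam ε (c • p) (c • P) := by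
  induction h with
  | basis h n =>
    convert Rel.basis (fun t s => c * h t s) n using 1 <;>
    · funext t u v
      simp only [Pi.smul_apply, smul_eq_mul]
      ring
  | add p q P Q _ _ ih ih' => rw [smul_add, smul_add]; exact .add _ _ _ _ ih ih'

lemma Matched.add {f' g' : Fn} (h : Matched lam ε f g) (h' : Matched lam ε f' g') :
    Matched lam ε (f + f') (g + g') := by
  obtain ⟨p, P, hr, hf, hg⟩ := h
  obtain ⟨p', P', hr', hf', hg'⟩ := h'
  exact ⟨_, _, hr.add _ _ _ _ hr', hf.add hf', hg.add hg'⟩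

lemma Matched.smul (c : ℂ) (h : Matched lam ε f g) : Matched lam ε (c • f) (c • g) := by
  obtain ⟨p, P, hr, hf, hg⟩ := h
  refine ⟨_, _, hr.smul c, fun t u v h => ?_, fun a b d h => ?_⟩
  · simp only [Pi.smul_apply, smul_eq_mul, hf t u v h]; ring
  · simp only [Pi.smul_apply, smul_eq_mul, hg a b d h]; ring

lemma matched_base : Matched lam ε (psiRt lam ε) phiR :=
  ⟨_, _, .basis (fun _ _ => 1) 0, fun t u v _ => by simp [gtBasis], fun a b d _ => by
    simp [ggBasis]⟩

lemma Matched.of_relOp {A B A' B' : Fn → Fn} (hr : RelOp lam ε A' B')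
    (hA : ∀ f p, IsGT lam ε f p → IsGT lam ε (A f) (A' p))
    (hB : ∀ g P, IsGG g P → IsGG (B g) (B' P)) (h : Matched lam ε f g) :
    Matched lam ε (A f) (B g) := by
  obtain ⟨p, P, hrel, hf, hg⟩ := h
  obtain ⟨q, Q, hrel', hq, hQ⟩ := hr p P hrel
  exact ⟨q, Q, hrel', fun t u v h => by rw [hA f p hf t u v h, hq t u v h],
    fun a b d h => by rw [hB g P hg a b d h, hQ a b d h]⟩

lemma Matched.opE12 (h : Matched lam ε f g) : Matched lam ε (gtE12 f) (ggE12 g) :=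
  h.of_relOp relOp_E12 (fun _ _ => .gtE12) (fun _ _ => .ggE12)

lemma Matched.opE21 (h : Matched lam ε f g) : Matched lam ε (gtE21 f) (ggE21 lam ε g) :=
  h.of_relOp relOp_E21 (fun _ _ => .gtE21) (fun _ _ => .ggE21)

lemma Matched.opE23 (h : Matched lam ε f g) : Matched lam ε (gtE23 lam ε f) (ggE23 g) :=
  h.of_relOp relOp_E23 (fun _ _ => .gtE23) (fun _ _ => .ggE23)

lemma Matched.opE32 (h : Matched lam ε f g) : Matched lam ε (gtE32 f) (ggE32 lam ε g) :=
  h.of_relOp relOp_E32 (fun _ _ => .gtE32) (fun _ _ => .ggE32)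

/-- A Cartan function depends on t and u+v only, so it can be absorbed into `h` by evaluating it at
(t, u+v, 0). -/
lemma Matched.opCartan (i : Fin 3) (h : Matched lam ε f g) :
    Matched lam ε (fun t u v => gtCartan lam ε i t u v * f t u v)
      (fun a b d => ggCartan lam ε i a b d * g a b d) := by
  refine h.of_relOp (A := fun f t u v => gtCartan lam ε i t u v * f t u v)
    (B := fun g a b d => ggCartan lam ε i a b d * g a b d)
    (relOp_mul fun t s => gtCartan lam ε i t s 0) (fun f p hf t u v hg => ?_)
    fun g P hg' a b d hg => ?_
  · have : gtCartan lam ε i t (u + v) 0 = gtCartan lam ε i t u v := by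
      fin_cases i <;> simp [gtCartan]
    simp only [hf t u v hg, this]
    ring
  · have : gtCartan lam ε i (gam lam ε 0 + a + b) (lam 0 + lam 1 + a + d) 0
        = ggCartan lam ε i a b d := by
      have := gtCartan_eq_ggCartan lam ε i a b d (lam 0 + lam 1 + a + d)
      rwa [sub_self] at this
    simp only [hg' a b d hg, this]
    ring

lemma Matched.comm {A B A' B' : Fn → Fn} (h : Matched lam ε (A (B f)) (A' (B' g)))
    (h' : Matched lam ε (B (A f)) (B' (A' g))) :
    Matched lam ε (opComm A B f) (opComm A' B' g) := by
  have := h.add (h'.smul (-1))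
  rwa [neg_one_smul, neg_one_smul, ← sub_eq_add_neg, ← sub_eq_add_neg] at this

lemma Matched.op (h : Matched lam ε f g) (i j : Fin 3) :
    Matched lam ε (gtOp lam ε i j f) (ggOp lam ε i j g) := by
  fin_cases i <;> fin_cases j
  · exact h.opCartan 0
  · exact h.opE12
  · exact h.opE23.opE12.comm h.opE12.opE23
  · exact h.opE21
  · exact h.opCartan 1
  · exact h.opE23
  · exact h.opE21.opE32.comm h.opE32.opE21
  · exact h.opE32
  · exact h.opCartan 2

lemma Matched.exists_of_cyclic {F : Fn} (h : Cyclic (gtOp lam ε) (psiRt lam ε) F) :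
    ∃ g, GGSpace lam ε g ∧ Matched lam ε F g := by
  induction h with
  | base => exact ⟨phiR, .base, matched_base⟩
  | add f f' _ _ ih ih' =>
    obtain ⟨g, hg, hm⟩ := ih
    obtain ⟨g', hg', hm'⟩ := ih'
    exact ⟨_, .add _ _ hg hg', hm.add hm'⟩
  | smul c f _ ih =>
    obtain ⟨g, hg, hm⟩ := ih
    exact ⟨_, .smul c _ hg, hm.smul c⟩
  | act i j f _ ih =>
    obtain ⟨g, hg, hm⟩ := ih
    exact ⟨_, .act i j _ hg, hm.op i j⟩

lemma shift1_neg_shift1 (c : ℂ) (F : Fn) : shift1 c (shift1 (-c) F) = F := by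
  funext t u v
  simp [shift1]

lemma gtOpShift_shift1 (lam : Fin 3 → ℝ) (ε ϰ : ℝ) (i j : Fin 3) (F : Fn) :
    gtOpShift lam ε ϰ i j (shift1 (-(I * ϰ)) F) = shift1 (-(I * ϰ)) (gtOp lam ε i j F) := by
  rw [gtOpShift, shift1_neg_shift1]

/-- The translation by iϰ conjugates the shifted generators to the original ones, so ϰ can be
removed before the algebra starts. -/
lemma GTSpace.exists_cyclic {ϰ : ℝ} (h : GTSpace lam ε ϰ f) :
    ∃ F, f = shift1 (-(I * ϰ)) F ∧ Cyclic (gtOp lam ε) (psiRt lam ε) F := by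
  induction h with
  | base => exact ⟨_, rfl, .base⟩
  | add f g _ _ hf hg =>
    obtain ⟨F, rfl, hF⟩ := hf
    obtain ⟨G, rfl, hG⟩ := hg
    exact ⟨F + G, rfl, .add _ _ hF hG⟩
  | smul c f _ hf =>
    obtain ⟨F, rfl, hF⟩ := hf
    exact ⟨c • F, rfl, .smul c _ hF⟩
  | act i j f _ hf =>
    obtain ⟨F, rfl, hF⟩ := hf
    exact ⟨_, gtOpShift_shift1 .., .act i j _ hF⟩

/-- Along the integration t and u+v are fixed, so `h` is a constant and each basis pair reduces to
the dual Hahn integral. -/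
lemma Rel.integral_kerLdag {p P : Fn} (h : Rel lam ε p P) (ϰ : ℝ) (hε : 0 < ε) (hε' : ε < 1 / 2)
    (a b d : ℝ) :
    Integrable (fun u : ℝ =>
      kerLdag lam ε ϰ a b (gam lam ε 0 + a + b + I * ϰ) u ((lam 0 + lam 1 + a + d - u : ℝ) : ℂ)
      * (psiRt lam ε (gam lam ε 0 + a + b) u ((lam 0 + lam 1 + a + d - u : ℝ) : ℂ)
        * p (gam lam ε 0 + a + b) u ((lam 0 + lam 1 + a + d - u : ℝ) : ℂ))) ∧
    ∫ u : ℝ,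
      kerLdag lam ε ϰ a b (gam lam ε 0 + a + b + I * ϰ) u ((lam 0 + lam 1 + a + d - u : ℝ) : ℂ)
      * (psiRt lam ε (gam lam ε 0 + a + b) u ((lam 0 + lam 1 + a + d - u : ℝ) : ℂ)
        * p (gam lam ε 0 + a + b) u ((lam 0 + lam 1 + a + d - u : ℝ) : ℂ))
      = phiR a b d * P a b d := by
  induction h with
  | basis h n =>
    have hs : ∀ u : ℝ, (u : ℂ) + ((lam 0 + lam 1 + a + d - u : ℝ) : ℂ)
        = lam 0 + lam 1 + a + d := fun u => by push_cast; ring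
    obtain ⟨hi, he⟩ := integrable_kerLdag_mul_psiRt lam ε ϰ hε hε' n a b d
    simp only [hs]
    generalize h (gam lam ε 0 + a + b) (lam 0 + lam 1 + a + d) = H
    have hc : ∀ u : ℝ, kerLdag lam ε ϰ a b (gam lam ε 0 + a + b + I * ϰ) u
          ((lam 0 + lam 1 + a + d - u : ℝ) : ℂ)
        * (psiRt lam ε (gam lam ε 0 + a + b) u ((lam 0 + lam 1 + a + d - u : ℝ) : ℂ)
          * (H * gtBasis lam ε n u ((lam 0 + lam 1 + a + d - u : ℝ) : ℂ)))
        = H * (kerLdag lam ε ϰ a b (gam lam ε 0 + a + b + I * ϰ) u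
          ((lam 0 + lam 1 + a + d - u : ℝ) : ℂ)
        * (psiRt lam ε (gam lam ε 0 + a + b) u ((lam 0 + lam 1 + a + d - u : ℝ) : ℂ)
          * gtBasis lam ε n u ((lam 0 + lam 1 + a + d - u : ℝ) : ℂ))) := fun u => by ring
    simp only [hc]
    refine ⟨hi.const_mul H, ?_⟩
    rw [integral_const_mul, he]
    ring
  | add p q P Q _ _ ih ih' =>
    simp only [Pi.add_apply, mul_add]
    refine ⟨ih.1.add ih'.1, ?_⟩
    rw [integral_add ih.1 ih'.1, ih.2, ih'.2]

/-- Here Im t = ε, so the real parts of the Gamma arguments are 1/2 or 1/2 ± ε, strictly between 0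
and 1; only u = v has to be avoided. -/
lemma goodGT_real (hε : 0 < ε) (hε' : ε < 1 / 2) (a b : ℝ) {u v : ℝ} (h : u ≠ v) :
    GoodGT lam ε (gam lam ε 0 + a + b) u v := by
  have hk : ∀ (k : Fin 3) (w : ℝ), NonInt (I * (gam lam ε k - w) + 1 / 2) := fun k w => by
    refine nonInt_of_re ?_ ?_ <;> fin_cases k <;> simp <;> linarith
  refine ⟨nonInt_of_im_ne_zero ?_, nonInt_of_re ?_ ?_, nonInt_of_re ?_ ?_, fun k => hk k u,
    fun k => hk k v⟩
  · simpa [sub_eq_zero] using h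
  all_goals simp; linarith

lemma Matched.integral (h : Matched lam ε f g) (ϰ : ℝ) (hε : 0 < ε) (hε' : ε < 1 / 2)
    (a b d : ℝ) :
    Integrable (BLdagInt lam ε ϰ (mixed (shift1 (-(I * ϰ)) f)) a b d) ∧
      (a + d ≠ 0 → g a b d = BLdag lam ε ϰ (mixed (shift1 (-(I * ϰ)) f)) a b d) := by
  obtain ⟨p, P, hr, hf, hg⟩ := h
  obtain ⟨hi, he⟩ := hr.integral_kerLdag ϰ hε hε' a b d
  have hae : BLdagInt lam ε ϰ (mixed (shift1 (-(I * ϰ)) f)) a b d =ᵐ[volume] fun u : ℝ =>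
      kerLdag lam ε ϰ a b (gam lam ε 0 + a + b + I * ϰ) u ((lam 0 + lam 1 + a + d - u : ℝ) : ℂ)
      * (psiRt lam ε (gam lam ε 0 + a + b) u ((lam 0 + lam 1 + a + d - u : ℝ) : ℂ)
        * p (gam lam ε 0 + a + b) u ((lam 0 + lam 1 + a + d - u : ℝ) : ℂ)) := by
    -- The midpoint is the only place where u = v, and it has measure zero.
    filter_upwards [compl_mem_ae_iff.2 (measure_singleton ((lam 0 + lam 1 + a + d) / 2))] with u hu
    have huv : u ≠ lam 0 + lam 1 + a + d - u := fun h => hu (by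
      rw [mem_singleton_iff]; linarith)
    rw [BLdagInt, cdelta, mixed, shift1, ← sub_eq_add_neg, add_sub_cancel_right,
      hf _ _ _ (goodGT_real hε hε' a b huv)]
  refine ⟨hi.congr hae.symm, fun had => ?_⟩
  rw [BLdag, integral_congr_ae hae, he, hg a b d (goodGG_real had)]

theorem BLdag_intertwines (lam : Fin 3 → ℝ) (ε ϰ : ℝ) (hε : 0 < ε) (hε' : ε < 1 / 2)
    (f : Fn) (hf : GTSpace lam ε ϰ f) :
    (∀ a b d : ℝ, Integrable (BLdagInt lam ε ϰ (mixed f) a b d)) ∧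
    (∃ g : Fn, GGSpace lam ε g ∧ RestrictsTo g (BLdag lam ε ϰ (mixed f))) ∧
    ∀ g : Fn, GGSpace lam ε g → RestrictsTo g (BLdag lam ε ϰ (mixed f)) → ∀ i j : Fin 3,
      RestrictsTo (ggOp lam ε i j g) (BLdag lam ε ϰ (mixed (gtOpShift lam ε ϰ i j f))) := by
  obtain ⟨F, rfl, hF⟩ := hf.exists_cyclic
  obtain ⟨g₀, hg₀, hm⟩ := Matched.exists_of_cyclic hF
  have hres : RestrictsTo g₀ (BLdag lam ε ϰ (mixed (shift1 (-(I * ϰ)) F))) :=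
    fun a b d => (hm.integral ϰ hε hε' a b d).2
  refine ⟨fun a b d => (hm.integral ϰ hε hε' a b d).1, ⟨g₀, hg₀, hres⟩, fun g hg hgr i j => ?_⟩
  -- Any two representatives of the image agree at all regular points, also complex ones. This is
  -- needed because the generators evaluate `g` at points shifted by ±i.
  have heq : ∀ a b d, GoodGG a b d → g a b d = g₀ a b d := fun a b d h =>
    sub_eq_zero.1 ((hg.sepHol.sub hg₀.sepHol).eq_zero_of_real (fun a b d had => by
      simp only [hgr a b d had, hres a b d had, sub_self]) a b d h)
  obtain ⟨p, P, hr, hFp, hgP⟩ := hm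
  have hm' : Matched lam ε F g :=
    ⟨p, P, hr, hFp, fun a b d h => by rw [heq a b d h, hgP a b d h]⟩
  rw [gtOpShift_shift1]
  exact fun a b d => ((hm'.op i j).integral ϰ hε hε' a b d).2

end

/-! ### Convergence and contour shifts of the Gelfand-Tsetlin integrand -/

lemma integrable_prod_of_norm_le_exp {f : ℝ × ℝ → ℂ} {C δ : ℝ} (hf : Continuous f) (hδ : 0 < δ)
    (hb : ∀ x y, ‖f (x, y)‖ ≤ C * Real.exp (-(δ * (|x| + |y|)))) : Integrable f := by
  have h := integrable_exp_neg_mul_abs hδ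
  refine ((h.mul_prod h).const_mul C).mono' hf.aestronglyMeasurable (ae_of_all _ fun p => ?_)
  refine (hb p.1 p.2).trans_eq ?_
  rw [← Real.exp_add]
  ring_nf

lemma integrable_prod_prod_of_norm_le_exp {f : ℝ × ℝ × ℝ → ℂ} {C δ : ℝ} (hf : Continuous f)
    (hδ : 0 < δ) (hb : ∀ x y z, ‖f (x, y, z)‖ ≤ C * Real.exp (-(δ * (|x| + |y| + |z|)))) :
    Integrable f := by
  have h := integrable_exp_neg_mul_abs hδ
  refine ((h.mul_prod (h.mul_prod h)).const_mul C).mono' hf.aestronglyMeasurable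
    (ae_of_all _ fun p => ?_)
  refine (hb p.1 p.2.1 p.2.2).trans_eq ?_
  rw [← Real.exp_add, ← Real.exp_add]
  ring_nf

lemma integrable_prod_prod_prod_of_norm_le_exp {f : ℝ × ℝ × ℝ × ℝ → ℂ} {C δ : ℝ}
    (hf : Continuous f) (hδ : 0 < δ)
    (hb : ∀ x y z w, ‖f (x, y, z, w)‖ ≤ C * Real.exp (-(δ * (|x| + |y| + |z| + |w|)))) :
    Integrable f := by
  have h := integrable_exp_neg_mul_abs hδ
  refine ((h.mul_prod (h.mul_prod (h.mul_prod h))).const_mul C).mono' hf.aestronglyMeasurable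
    (ae_of_all _ fun p => ?_)
  refine (hb p.1 p.2.1 p.2.2.1 p.2.2.2).trans_eq ?_
  rw [← Real.exp_add, ← Real.exp_add, ← Real.exp_add]
  ring_nf

lemma norm_mul_sinh_pi_mul_le (y : ℝ) :
    ‖(y : ℂ) * sinh (Real.pi * y)‖ ≤ 10 / Real.pi * Real.exp (11 / 10 * Real.pi * |y|) := by
  have h := norm_mul_sinh_le (y / 2)
  rw [show (2 * Real.pi * ((y / 2 : ℝ) : ℂ)) = Real.pi * y by push_cast; ring, abs_div, abs_two] at h
  calc ‖(y : ℂ) * sinh (Real.pi * y)‖ = 2 * ‖((y / 2 : ℝ) : ℂ) * sinh (Real.pi * y)‖ := by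
        rw [ofReal_div, div_mul_eq_mul_div, norm_div]
        simp
        ring
    _ ≤ 2 * (2 / decayRate * Real.exp (11 / 2 * decayRate * (|y| / 2))) := by gcongr
    _ = _ := by
        unfold decayRate
        rw [show 11 / 2 * (2 * Real.pi / 5) * (|y| / 2) = 11 / 10 * Real.pi * |y| by ring]
        ring

lemma norm_exp_gtCartan (lam : Fin 3 → ℝ) (ε : ℝ) (x : Fin 3 → ℝ) (t : ℂ) (u v : ℝ) :
    ‖exp (-∑ i, (x i : ℂ) * gtCartan lam ε i t u v)‖ = Real.exp ((x 1 - x 0) * t.im) := by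
  rw [norm_exp]
  congr 1
  simp [Fin.sum_univ_three, gtCartan]
  ring

/-- The integrand of the Gelfand-Tsetlin matrix element, continued analytically in `τ₁₁`. -/
noncomputable def gtForm (lam : Fin 3 → ℝ) (ε : ℝ) (x : Fin 3 → ℝ) (t : ℂ) (u v : ℝ) : ℂ :=
  cNorm ^ 2 / Real.pi * (((u - v : ℝ) : ℂ) * sinh (Real.pi * ((u - v : ℝ) : ℂ)))
  * exp (-∑ i, (x i : ℂ) * gtCartan lam ε i t u v)
  * (Complex.Gamma (I * (u - t) + 1 / 2) * Complex.Gamma (I * (v - t) + 1 / 2))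
  * ∏ i, (Complex.Gamma (I * (gam lam ε i - u) + 1 / 2)
        * Complex.Gamma (I * (gam lam ε i - v) + 1 / 2))

lemma cNorm_sq : cNorm ^ 2 = 1 / (2 * Real.pi) ^ 3 := by
  rw [cNorm, ← ofReal_pow, ← Real.rpow_natCast, ← Real.rpow_mul (by positivity)]
  rw [show -(3 / 2 : ℝ) * ((2 : ℕ) : ℝ) = -((3 : ℕ) : ℝ) by norm_num,
    Real.rpow_neg (by positivity), Real.rpow_natCast]
  push_cast
  ring

lemma gtMatInt_eq (lam : Fin 3 → ℝ) (ε : ℝ) (x : Fin 3 → ℝ) (p : ℝ × ℝ × ℝ) :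
    gtMatInt lam ε x p = gtForm lam ε x p.1 p.2.1 p.2.2 := by
  obtain ⟨t, u, v⟩ := p
  have h := inv_Gamma_mul_inv_Gamma u v
  simp only [gtMatInt, gtMeasure, psiL, psiR, gtForm, cNorm_sq]
  rw [← exp_conj]
  have he : exp (Real.pi * ((u : ℂ) + v)) * exp (starRingEnd ℂ (-(Real.pi / 2) * ((t : ℂ) + u + v)))
      * exp (Real.pi / 2 * ((t : ℂ) - u - v)) = 1 := by
    rw [← exp_add, ← exp_add, ← exp_zero]
    congr 1
    simp only [map_mul, map_neg, map_div₀, map_add, conj_ofReal, map_ofNat]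
    ring
  rw [show I * (v : ℂ) - I * u = -I * u + I * v by ring]
  push_cast
  generalize exp (starRingEnd ℂ (-(Real.pi / 2) * ((t : ℂ) + u + v))) = E₂ at he ⊢
  generalize exp (Real.pi * ((u : ℂ) + v)) = E₁ at he ⊢
  generalize exp (Real.pi / 2 * ((t : ℂ) - u - v)) = E₃ at he ⊢
  generalize exp (-∑ i, (x i : ℂ) * gtCartan lam ε i t u v) = E₄
  generalize Complex.Gamma (I * u - I * v) = G₁ at h ⊢
  generalize Complex.Gamma (-I * u + I * v) = G₂ at h ⊢
  generalize ∏ i, (Complex.Gamma (I * (gam lam ε i - u) + 1 / 2)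
        * Complex.Gamma (I * (gam lam ε i - v) + 1 / 2)) = P
  generalize Complex.Gamma (I * (u - t) + 1 / 2) = G₃
  generalize Complex.Gamma (I * (v - t) + 1 / 2) = G₄
  generalize 1 / (2 * (Real.pi : ℂ)) ^ 3 = c
  linear_combination c * G₁⁻¹ * G₂⁻¹ * E₄ * G₃ * G₄ * P * he + c * E₄ * G₃ * G₄ * P * h

/-- Conjugating `psiLt` at the conjugate point gives a function holomorphic in `t`, whose
exponential cancels that of `psiRt`. Thus the deformed pairing and the undeformed matrix element are
integrals of the same holomorphic function over different lines. -/
lemma conj_psiLt_mul_psiRt (lam : Fin 3 → ℝ) (ε : ℝ) (x : Fin 3 → ℝ) (t : ℂ) (u v : ℝ) :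
    starRingEnd ℂ (psiLt (starRingEnd ℂ t) u v)
      * (exp (-∑ i, (x i : ℂ) * gtCartan lam ε i t u v) * psiRt lam ε t u v)
      = gtForm lam ε x t u v := by
  have h := inv_Gamma_mul_inv_Gamma u v
  have hc : starRingEnd ℂ (psiLt (starRingEnd ℂ t) u v)
      = cNorm * exp (-(Real.pi * t / 2)) / Complex.Gamma (-I * u + I * v) := by
    simp only [psiLt, map_div₀, map_mul, ← exp_conj, ← Complex.Gamma_conj]
    simp only [cNorm, conj_ofReal, map_neg, map_mul, map_div₀, map_sub, conj_I, conj_conj, map_ofNat]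
    rw [show -I * (u : ℂ) - -I * v = -I * u + I * v by ring]
  rw [hc]
  simp only [psiRt, gtForm]
  have he : exp (-(Real.pi * t / 2)) * exp (Real.pi * t / 2) = 1 := by
    rw [← exp_add, ← exp_zero]; congr 1; ring
  push_cast
  generalize exp (-(Real.pi * t / 2)) = E₁ at he ⊢
  generalize exp (Real.pi * t / 2) = E₂ at he ⊢
  generalize exp (-∑ i, (x i : ℂ) * gtCartan lam ε i t u v) = E₄
  generalize Complex.Gamma (I * u - I * v) = G₁ at h ⊢
  generalize Complex.Gamma (-I * u + I * v) = G₂ at h ⊢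
  generalize ∏ i, (Complex.Gamma (I * (gam lam ε i - u) + 1 / 2)
        * Complex.Gamma (I * (gam lam ε i - v) + 1 / 2)) = P
  generalize Complex.Gamma (I * (u - t) + 1 / 2) = G₃
  generalize Complex.Gamma (I * (v - t) + 1 / 2) = G₄
  linear_combination cNorm ^ 2 * G₁⁻¹ * G₂⁻¹ * E₄ * G₃ * G₄ * P * he
    + cNorm ^ 2 * E₄ * G₃ * G₄ * P * h

lemma gtPairInt_eq (lam : Fin 3 → ℝ) (ε ϰ : ℝ) (hε : 0 < ε) (hϰ : 0 < ϰ) (h : ϰ + ε < 1 / 2)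
    (x : Fin 3 → ℝ) (p : ℝ × ℝ × ℝ) :
    gtPairInt ϰ (ext1 (BL lam ε ϰ (phiL lam ε)))
      (expGTShift lam ε ϰ x (ext1 (BR lam ε ϰ phiR))) p
      = gtForm lam ε x (p.1 + (-ϰ : ℝ) * I) p.2.1 p.2.2 := by
  obtain ⟨t, u, v⟩ := p
  simp only [gtPairInt, expGTShift]
  rw [ext1_BL lam ε ϰ hε (by linarith) hϰ, ext1_BR lam ε ϰ hε hϰ h (by simp),
    ← conj_psiLt_mul_psiRt]
  have h1 : (t : ℂ) + 2 * I * ϰ - I * ϰ = starRingEnd ℂ (t + (-ϰ : ℝ) * I) := by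
    simp; ring
  have h2 : (t : ℂ) - I * ϰ = t + (-ϰ : ℝ) * I := by push_cast; ring
  rw [h1, h2]

lemma re_gam_pos (lam : Fin 3 → ℝ) {ε : ℝ} (hε : 0 < ε) (hε' : ε < 1 / 2) (i : Fin 3) :
    0 < (I * gam lam ε i + 1 / 2).re := by
  fin_cases i <;> simp <;> linarith

lemma continuous_gtForm (lam : Fin 3 → ℝ) {ε : ℝ} (hε : 0 < ε) (hε' : ε < 1 / 2) (x : Fin 3 → ℝ)
    {η : ℝ} (hη : -(1 / 2) < η) :
    Continuous fun p : ℝ × ℝ × ℝ => gtForm lam ε x (p.1 + η * I) p.2.1 p.2.2 := by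
  have hre : ∀ (i : Fin 3) (w : ℝ), 0 < (I * (gam lam ε i - w) + 1 / 2).re := fun i w => by
    have := re_gam_pos lam hε hε' i
    simp at this ⊢
    exact this
  unfold gtForm
  refine (((Continuous.mul (by fun_prop) ?_).mul (.mul ?_ ?_)).mul ?_)
  · simp only [Fin.sum_univ_three, gtCartan]
    fun_prop
  · exact continuous_Gamma_comp (by fun_prop) fun p => by simp; linarith
  · exact continuous_Gamma_comp (by fun_prop) fun p => by simp; linarith
  · refine continuous_finsetProd _ fun i _ => .mul ?_ ?_
    · exact continuous_Gamma_comp (by fun_prop) fun p => hre i _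
    · exact continuous_Gamma_comp (by fun_prop) fun p => hre i _

lemma exists_norm_prod_Gamma_gam_le (lam : Fin 3 → ℝ) {ε : ℝ} (hε : 0 < ε) (hε' : ε < 1 / 2) :
    ∃ C : ℝ, 0 < C ∧ ∀ w : ℝ, ‖∏ i, Complex.Gamma (I * (gam lam ε i - w) + 1 / 2)‖
      ≤ C * Real.exp (-(3 * decayRate * |w|)) := by
  choose C hC hb using fun i => exists_norm_Gamma_sub_le (re_gam_pos lam hε hε' i)
  refine ⟨∏ i, C i, Finset.prod_pos fun i _ => hC i, fun w => ?_⟩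
  rw [norm_prod]
  calc ∏ i, ‖Complex.Gamma (I * (gam lam ε i - w) + 1 / 2)‖
      ≤ ∏ i, (C i * Real.exp (-(decayRate * |w|))) := by
        refine Finset.prod_le_prod (fun _ _ => norm_nonneg _) fun i _ => ?_
        rw [show I * (gam lam ε i - w) + 1 / 2 = I * gam lam ε i + 1 / 2 - I * w by ring]
        exact hb i w
    _ = _ := by
      rw [Finset.prod_mul_distrib, Finset.prod_const, ← Real.exp_nat_mul]
      simp [mul_assoc]

/-- In units of π, sinh costs 11/10 per |u-v| (with its linear factor), the Gammas of γ give 6/5 for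
each of |u| and |v|, and those of t give 2/5 for each |τ₂ⱼ-t|. A surplus of 1/10 in |u| and |v|
remains, and half of it together with |u-t| controls |t|. -/
lemma exists_norm_gtForm_le (lam : Fin 3 → ℝ) {ε : ℝ} (hε : 0 < ε) (hε' : ε < 1 / 2)
    (x : Fin 3 → ℝ) {η : ℝ} (hη : -(1 / 2) < η) :
    ∃ C : ℝ, ∀ t u v : ℝ, ‖gtForm lam ε x (t + η * I) u v‖
      ≤ C * Real.exp (-(Real.pi / 20 * (|t| + |u| + |v|))) := by
  obtain ⟨C, hC, hb⟩ := exists_norm_prod_Gamma_gam_le lam hε hε'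
  obtain ⟨D, hD, hb'⟩ := exists_norm_Gamma_add_le (A := (1 / 2 + η : ℝ))
    (by rw [ofReal_re]; linarith)
  refine ⟨‖cNorm ^ 2 / (Real.pi : ℂ)‖ * (10 / Real.pi) * Real.exp ((x 1 - x 0) * η)
    * (D * D) * (C * C), fun t u v => ?_⟩
  have hG : ∀ w : ℝ, ‖Complex.Gamma (I * (w - (t + η * I)) + 1 / 2)‖
      ≤ D * Real.exp (-(decayRate * |w - t|)) := fun w => by
    rw [show I * ((w : ℂ) - (t + η * I)) + 1 / 2 = (1 / 2 + η : ℝ) + I * ((w - t : ℝ) : ℂ) by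
      push_cast; linear_combination -(η : ℂ) * I_mul_I]
    exact hb' (w - t)
  rw [gtForm, norm_mul, norm_mul, norm_mul, norm_mul, norm_mul (Complex.Gamma _),
    norm_exp_gtCartan, Finset.prod_mul_distrib, norm_mul (∏ i, _),
    show ((t : ℂ) + η * I).im = η by simp]
  calc _ ≤ ‖cNorm ^ 2 / (Real.pi : ℂ)‖ * (10 / Real.pi * Real.exp (11 / 10 * Real.pi * |u - v|))
        * Real.exp ((x 1 - x 0) * η)
        * (D * Real.exp (-(decayRate * |u - t|)) * (D * Real.exp (-(decayRate * |v - t|))))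
        * (C * Real.exp (-(3 * decayRate * |u|)) * (C * Real.exp (-(3 * decayRate * |v|)))) := by
        gcongr
        · exact norm_mul_sinh_pi_mul_le _
        · exact hG u
        · exact hG v
        · exact hb u
        · exact hb v
    _ = ‖cNorm ^ 2 / (Real.pi : ℂ)‖ * (10 / Real.pi) * Real.exp ((x 1 - x 0) * η)
        * (D * D) * (C * C) * Real.exp (11 / 10 * Real.pi * |u - v| + -(decayRate * |u - t|)
          + -(decayRate * |v - t|) + -(3 * decayRate * |u|) + -(3 * decayRate * |v|)) := by
        rw [Real.exp_add, Real.exp_add, Real.exp_add, Real.exp_add]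
        ring
    _ ≤ _ := by
        gcongr
        have h1 : |u - v| ≤ |u| + |v| := abs_sub u v
        have h2 : |t| ≤ |u| + |u - t| := by
          have := abs_sub u (u - t)
          rwa [sub_sub_cancel] at this
        have h3 := abs_nonneg (u - t)
        have h4 := abs_nonneg (v - t)
        have h5 := abs_nonneg u
        have h6 := abs_nonneg v
        have := mul_le_mul_of_nonneg_left (show 11 / 10 * |u - v| - 2 / 5 * |u - t|
          - 2 / 5 * |v - t| - 6 / 5 * |u| - 6 / 5 * |v| ≤ -(1 / 20 * (|t| + |u| + |v|)) by linarith)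
          Real.pi_pos.le
        unfold decayRate
        linarith

lemma integrable_gtForm (lam : Fin 3 → ℝ) {ε : ℝ} (hε : 0 < ε) (hε' : ε < 1 / 2)
    (x : Fin 3 → ℝ) {η : ℝ} (hη : -(1 / 2) < η) :
    Integrable fun p : ℝ × ℝ × ℝ => gtForm lam ε x (p.1 + η * I) p.2.1 p.2.2 := by
  obtain ⟨C, hC⟩ := exists_norm_gtForm_le lam hε hε' x hη
  exact integrable_prod_prod_of_norm_le_exp (continuous_gtForm lam hε hε' x hη)
    (by positivity) hC

/-- Only the two Gammas with argument i(τ₂ⱼ-t)+1/2 depend on `t` apart from the exponential. Their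
real part 1/2 + Im t stays positive between the two lines, and the modulus of the exponential
depends only on Im t. -/
lemma integral_gtForm_horizontal (lam : Fin 3 → ℝ) (ε : ℝ) (x : Fin 3 → ℝ) {η : ℝ}
    (hη : -(1 / 2) < η) (u v : ℝ) :
    ∫ t : ℝ, gtForm lam ε x (t + η * I) u v = ∫ t : ℝ, gtForm lam ε x t u v := by
  have him : ∀ z : ℂ, z.im ∈ uIcc 0 η → -(1 / 2) < z.im := fun z hz =>
    (lt_min (by norm_num) hη).trans_le (mem_Icc.1 hz).1
  have hA : ∀ w : ℝ, 0 < (I * w + 1 / 2 : ℂ).re := fun w => by simp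
  have hA' : ∀ w : ℝ, 0 < (I * w + 1 / 2 : ℂ).re + η := fun w => by simp; linarith
  obtain ⟨M, hx⟩ : ∃ M, ∀ z : ℂ, z.im ∈ uIcc 0 η → (x 1 - x 0) * z.im ≤ M := by
    refine ⟨|x 1 - x 0| * |η|, fun z hz => ?_⟩
    refine (le_abs_self _).trans ?_
    rw [abs_mul]
    have := abs_sub_left_of_mem_uIcc hz
    simp only [sub_zero] at this
    gcongr
  obtain ⟨C₁, hC₁, h₁⟩ := exists_norm_Gamma_sub_le_strip (h := η) (hA u) (hA' u)
  obtain ⟨C₂, hC₂, h₂⟩ := exists_norm_Gamma_sub_le_strip (h := η) (hA v) (hA' v)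
  set c : ℂ := cNorm ^ 2 / Real.pi * (((u - v : ℝ) : ℂ) * sinh (Real.pi * ((u - v : ℝ) : ℂ)))
    with hc
  set P : ℂ := ∏ i, (Complex.Gamma (I * (gam lam ε i - u) + 1 / 2)
        * Complex.Gamma (I * (gam lam ε i - v) + 1 / 2)) with hP
  refine integral_horizontal_shift (f := fun t => gtForm lam ε x t u v) (δ := 2 * decayRate)
    (C := ‖c‖ * Real.exp M * (C₁ * C₂) * ‖P‖)
    (by have := decayRate_pos; positivity) (fun z hz => ?_) fun z hz => ?_
  · have hG : ∀ w : ℝ, DifferentiableAt ℂ (fun t => Complex.Gamma (I * (w - t) + 1 / 2)) z :=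
      fun w => DifferentiableAt.comp z (f := fun t => I * (w - t) + 1 / 2)
        (differentiableAt_Gamma_of_re_pos (by simp; linarith [him z hz])) (by fun_prop)
    unfold gtForm
    refine (DifferentiableAt.mul_const (.mul (.const_mul ?_ _) ((hG u).mul (hG v))) _
      ).differentiableWithinAt
    simp only [Fin.sum_univ_three, gtCartan]
    fun_prop
  · rw [gtForm, ← hc, ← hP, norm_mul, norm_mul, norm_mul, norm_mul (Complex.Gamma _),
      norm_exp_gtCartan]
    calc _ ≤ ‖c‖ * Real.exp M * (C₁ * Real.exp (-(decayRate * |z.re|))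
          * (C₂ * Real.exp (-(decayRate * |z.re|)))) * ‖P‖ := by
          gcongr
          · exact hx z hz
          · rw [show I * (u - z) + 1 / 2 = I * u + 1 / 2 - I * z by ring]
            exact h₁ z hz
          · rw [show I * (v - z) + 1 / 2 = I * v + 1 / 2 - I * z by ring]
            exact h₂ z hz
      _ = _ := by
        rw [show -(2 * decayRate * |z.re|) = -(decayRate * |z.re|) + -(decayRate * |z.re|) by ring,
          Real.exp_add]
        ring

lemma integral_gtForm_shift (lam : Fin 3 → ℝ) {ε : ℝ} (hε : 0 < ε) (hε' : ε < 1 / 2)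
    (x : Fin 3 → ℝ) {η : ℝ} (hη : -(1 / 2) < η) :
    ∫ p : ℝ × ℝ × ℝ, gtForm lam ε x (p.1 + η * I) p.2.1 p.2.2
      = ∫ p : ℝ × ℝ × ℝ, gtForm lam ε x p.1 p.2.1 p.2.2 := by
  have h0 := integrable_gtForm lam hε hε' x (η := 0) (by norm_num)
  simp only [ofReal_zero, zero_mul, add_zero] at h0
  rw [Measure.volume_eq_prod, integral_prod_symm _ (integrable_gtForm lam hε hε' x hη),
    integral_prod_symm _ h0]
  simp only [integral_gtForm_horizontal lam ε x hη]

/-! ### The joint integral over (s₁₁, s₂₁, s₂₂, τ₂₁) -/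

lemma conj_Gamma_eq {s w : ℂ} (h : starRingEnd ℂ s = w) :
    starRingEnd ℂ (Complex.Gamma s) = Complex.Gamma w := by
  rw [← Complex.Gamma_conj, h]

lemma conj_cNorm : starRingEnd ℂ cNorm = cNorm := conj_ofReal _

lemma conj_phiL (lam : Fin 3 → ℝ) (ε a b d : ℝ) :
    starRingEnd ℂ (phiL lam ε a b d)
      = cNorm * Complex.Gamma (1 / 2 - I * (gam lam ε 0 - gam lam ε 1 + a))
        * Complex.Gamma (1 / 2 - I * (gam lam ε 1 - gam lam ε 2 + d))
        * Complex.Gamma (1 - I * (gam lam ε 0 - gam lam ε 2 + a + b)) := by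
  rw [phiL, map_mul, map_mul, map_mul, conj_cNorm,
    conj_Gamma_eq (w := 1 / 2 - I * (gam lam ε 0 - gam lam ε 1 + a)) (by simp [map_ofNat]; ring),
    conj_Gamma_eq (w := 1 / 2 - I * (gam lam ε 1 - gam lam ε 2 + d)) (by simp [map_ofNat]; ring),
    conj_Gamma_eq (w := 1 - I * (gam lam ε 0 - gam lam ε 2 + a + b)) (by simp; ring)]

/-- The choice ϰ = ε makes s₂₁ = τ₁₁ - iϰ - γ̄₁ - s₁₁ real for real τ₁₁ and s₁₁, so conjugation acts
on the kernel at real arguments; the factor 2 undoes the 1/2! in the adjoint kernel. -/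
lemma conj_kerL (lam : Fin 3 → ℝ) (ε t u v a b : ℝ) :
    starRingEnd ℂ (kerL lam ε ε t u v a b)
      = 2 * kerLdag lam ε ε a b (t + 2 * I * ε) u v := by
  have hk : ∀ w : ℝ, starRingEnd ℂ (Complex.Gamma (I * (t - w - b) + ε))
      = Complex.Gamma (-I * (t + 2 * I * ε - w - b) - ε) := fun w =>
    conj_Gamma_eq (by simp; linear_combination (2 * ε : ℂ) * I_mul_I)
  have hk' : ∀ w : ℝ, starRingEnd ℂ (Complex.Gamma (I * (t - w) + ε + 1 / 2))
      = Complex.Gamma (-I * (t + 2 * I * ε - w) - ε + 1 / 2) := fun w =>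
    conj_Gamma_eq (by simp [map_ofNat]; linear_combination (2 * ε : ℂ) * I_mul_I)
  have hk'' : ∀ w : ℝ, starRingEnd ℂ (Complex.Gamma (I * (w - gam lam ε 2) + 1 / 2))
      = Complex.Gamma (-I * (w - gam lam ε 2) + 1 / 2) := fun w => conj_Gamma_eq (by simp [map_ofNat])
  have hexp : starRingEnd ℂ (exp (-(Real.pi * (t - I * ε) / 2)))
      = exp (-(Real.pi * (t + 2 * I * ε - I * ε) / 2)) := by
    rw [← exp_conj]
    congr 1
    simp only [map_neg, map_div₀, map_mul, map_sub, conj_ofReal, conj_I, map_ofNat]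
    ring
  simp only [kerL, kerLdag, map_mul, map_div₀, hk, hk', hk'', hexp, map_one, conj_ofReal, map_ofNat]
  rw [conj_Gamma_eq (s := I * u - I * v) (w := -I * u + I * v) (by simp),
    conj_Gamma_eq (s := I * b + 1 / 2) (w := -I * b + 1 / 2) (by simp [map_ofNat]),
    conj_Gamma_eq (s := I * (gamBar lam ε 0 - gamBar lam ε 1 + a) + 1 / 2)
      (w := -I * (gam lam ε 0 - gam lam ε 1 + a) + 1 / 2) (by simp [map_ofNat]; ring)]
  ring

/-- The integrand over `(s₁₁, s₂₁, s₂₂, τ₂₁)` to which both matrix elements reduce. -/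
noncomputable def jointForm (lam : Fin 3 → ℝ) (ε : ℝ) (x : Fin 3 → ℝ) (a b d u : ℝ) : ℂ :=
  starRingEnd ℂ (phiL lam ε a b d)
  * (exp (-∑ i, (x i : ℂ) * gtCartan lam ε i (gam lam ε 0 + a + b) u
        ((lam 0 + lam 1 + a + d - u : ℝ) : ℂ))
    * (kerLdag lam ε ε a b (gam lam ε 0 + a + b + I * ε) u ((lam 0 + lam 1 + a + d - u : ℝ) : ℂ)
      * psiRt lam ε (gam lam ε 0 + a + b) u ((lam 0 + lam 1 + a + d - u : ℝ) : ℂ)))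

/-- The Gamma of γ₁-γ₂+s₁₁ in the conjugate of `phiL` cancels the denominator of the kernel. The
result has no denominators left, so continuity and bounds are immediate. -/
lemma jointForm_eq (lam : Fin 3 → ℝ) (ε : ℝ) (hε : 0 < ε) (x : Fin 3 → ℝ) (a b d u : ℝ) :
    jointForm lam ε x a b d u
      = cNorm ^ 2 / (2 * Real.pi ^ 2)
        * exp (-∑ i, (x i : ℂ) * gtCartan lam ε i (gam lam ε 0 + a + b) u
            ((lam 0 + lam 1 + a + d - u : ℝ) : ℂ))
        * (Complex.Gamma (1 / 2 - I * (gam lam ε 1 - gam lam ε 2 + d))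
          * Complex.Gamma (1 - I * (gam lam ε 0 - gam lam ε 2 + a + b))
          * Complex.Gamma (1 / 2 - I * b))
        * hahn (I * ((lam 1 + d - lam 0 - a) / 2) + ε)
          (I * ((lam 0 - lam 1 - a - d) / 2) - ε + 1 / 2)
          (I * ((lam 1 - lam 0 - a - d) / 2) + ε + 1 / 2)
          ((u - (lam 0 + lam 1 + a + d) / 2 : ℝ) : ℂ) := by
  have h := kerLdag_mul_psiRt lam ε ε hε 0 a b d u
  simp only [gtBasis, rising_zero, mul_one, Nat.cast_zero, add_zero] at h
  have g : Complex.Gamma (1 / 2 - I * (gam lam ε 0 - gam lam ε 1 + a)) ≠ 0 :=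
    Complex.Gamma_ne_zero_of_re_pos (by simp; linarith)
  rw [jointForm, h, conj_phiL]
  generalize Complex.Gamma (1 / 2 - I * (gam lam ε 0 - gam lam ε 1 + a)) = G at g ⊢
  generalize Complex.Gamma (1 / 2 - I * b) = G₁
  generalize Complex.Gamma (1 / 2 - I * (gam lam ε 1 - gam lam ε 2 + d)) = G₂
  generalize Complex.Gamma (1 - I * (gam lam ε 0 - gam lam ε 2 + a + b)) = G₃
  generalize hahn _ _ _ _ = H
  generalize exp _ = E
  refine eq_of_eq_mul_mul_inv g ?_
  ring

lemma exists_norm_Gamma_le_of_re_eq {r : ℝ} (hr : 0 < r) :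
    ∃ C : ℝ, 0 < C ∧ ∀ (s : ℂ) (y : ℝ), s.re = r → |s.im| = |y| →
      ‖Complex.Gamma s‖ ≤ C * Real.exp (-(decayRate * |y|)) := by
  obtain ⟨C, hC, h⟩ := exists_norm_Gamma_le (M := r) hr
  exact ⟨C, hC, fun s y hs hy => hy ▸ h s hs.ge hs.le⟩

lemma continuous_jointForm (lam : Fin 3 → ℝ) {ε : ℝ} (hε : 0 < ε) (hε' : ε < 1 / 2)
    (x : Fin 3 → ℝ) :
    Continuous fun p : ℝ × ℝ × ℝ × ℝ => jointForm lam ε x p.1 p.2.1 p.2.2.1 p.2.2.2 := by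
  simp only [jointForm_eq lam ε hε, hahn, hahnGamma]
  refine (((Continuous.mul continuous_const ?_).mul (.mul (.mul ?_ ?_) ?_)).mul
    (.mul (.mul (.mul (.mul ?_ ?_) (.mul ?_ ?_)) (.mul ?_ ?_)) (by fun_prop)))
  · simp only [Fin.sum_univ_three, gtCartan]
    fun_prop
  all_goals exact continuous_Gamma_comp (by fun_prop) fun p => by simp <;> linarith

/-- Two Gammas, in s₂₁ and in s₂₂, are merely bounded; the decay of the other seven is kept. The
constant 11/4 is the 11/2 of `norm_mul_sinh_le`, since y = (u-v)/2. -/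
lemma exists_norm_jointForm_le (lam : Fin 3 → ℝ) {ε : ℝ} (hε : 0 < ε) (hε' : ε < 1 / 2)
    (x : Fin 3 → ℝ) : ∃ C : ℝ, 0 ≤ C ∧ ∀ a b d u v : ℝ, v = lam 0 + lam 1 + a + d - u →
      ‖jointForm lam ε x a b d u‖ ≤ C * Real.exp (decayRate * (11 / 4 * |u - v|
        - |lam 0 - lam 2 + a + b| - |u - lam 0 - a| - |v - lam 0 - a| - |u - lam 0|
        - |v - lam 0| - |u - lam 1| - |v - lam 1|)) := by
  obtain ⟨C₁, h₁, b₁⟩ := exists_norm_Gamma_le_of_re_eq (r := 1 / 2 - ε) (by linarith)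
  obtain ⟨C₂, h₂, b₂⟩ := exists_norm_Gamma_le_of_re_eq (r := 1 + ε) (by linarith)
  obtain ⟨C₃, h₃, b₃⟩ := exists_norm_Gamma_le_of_re_eq (r := 1 / 2) (by norm_num)
  obtain ⟨C₄, h₄, b₄⟩ := exists_norm_Gamma_le_of_re_eq hε
  obtain ⟨C₅, h₅, b₅⟩ := exists_norm_Gamma_le_of_re_eq (r := 1 / 2 + ε) (by linarith)
  have hθ := decayRate_pos
  have hone : ∀ y : ℝ, Real.exp (-(decayRate * |y|)) ≤ 1 := fun y =>
    Real.exp_le_one_iff.2 (by have := abs_nonneg y; nlinarith)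
  refine ⟨‖cNorm ^ 2 / (2 * (Real.pi : ℂ) ^ 2)‖ * Real.exp ((x 1 - x 0) * ε) * (C₁ * C₂ * C₃)
    * (((C₄ * C₄) * (C₁ * C₁) * (C₅ * C₅)) * (2 / decayRate)), by positivity,
    fun a b d u v hv => ?_⟩
  set y : ℝ := u - (lam 0 + lam 1 + a + d) / 2 with hy
  have k1 : ‖Complex.Gamma (1 / 2 - I * (gam lam ε 1 - gam lam ε 2 + d))‖ ≤ C₁ :=
    (b₁ _ (lam 1 - lam 2 + d) (by simp) (by rw [← abs_neg]; congr 1; simp)).trans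
      (mul_le_of_le_one_right h₁.le (hone _))
  have k2 : ‖Complex.Gamma (1 - I * (gam lam ε 0 - gam lam ε 2 + a + b))‖
      ≤ C₂ * Real.exp (-(decayRate * |lam 0 - lam 2 + a + b|)) :=
    b₂ _ _ (by simp) (by rw [← abs_neg]; congr 1; simp)
  have k3 : ‖Complex.Gamma (1 / 2 - I * b)‖ ≤ C₃ :=
    (b₃ _ b (by simp) (by simp)).trans (mul_le_of_le_one_right h₃.le (hone _))
  have a1 : ‖Complex.Gamma (I * ((lam 1 + d - lam 0 - a) / 2) + ε + I * y)‖
      ≤ C₄ * Real.exp (-(decayRate * |u - lam 0 - a|)) :=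
    b₄ _ _ (by simp) (by congr 1; simp [hy]; ring)
  have a2 : ‖Complex.Gamma (I * ((lam 1 + d - lam 0 - a) / 2) + ε - I * y)‖
      ≤ C₄ * Real.exp (-(decayRate * |v - lam 0 - a|)) :=
    b₄ _ _ (by simp) (by congr 1; simp [hy, hv]; ring)
  have a3 : ‖Complex.Gamma (I * ((lam 0 - lam 1 - a - d) / 2) - ε + 1 / 2 + I * y)‖
      ≤ C₁ * Real.exp (-(decayRate * |v - lam 0|)) :=
    b₁ _ _ (by simp; ring) (by rw [← abs_neg]; congr 1; simp [hy, hv]; ring)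
  have a4 : ‖Complex.Gamma (I * ((lam 0 - lam 1 - a - d) / 2) - ε + 1 / 2 - I * y)‖
      ≤ C₁ * Real.exp (-(decayRate * |u - lam 0|)) :=
    b₁ _ _ (by simp; ring) (by rw [← abs_neg]; congr 1; simp [hy]; ring)
  have a5 : ‖Complex.Gamma (I * ((lam 1 - lam 0 - a - d) / 2) + ε + 1 / 2 + I * y)‖
      ≤ C₅ * Real.exp (-(decayRate * |v - lam 1|)) :=
    b₅ _ _ (by simp; ring) (by rw [← abs_neg]; congr 1; simp [hy, hv]; ring)
  have a6 : ‖Complex.Gamma (I * ((lam 1 - lam 0 - a - d) / 2) + ε + 1 / 2 - I * y)‖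
      ≤ C₅ * Real.exp (-(decayRate * |u - lam 1|)) :=
    b₅ _ _ (by simp; ring) (by rw [← abs_neg]; congr 1; simp [hy]; ring)
  have hsy : ‖(y : ℂ) * sinh (2 * Real.pi * y)‖
      ≤ 2 / decayRate * Real.exp (11 / 4 * decayRate * |u - v|) := by
    refine (norm_mul_sinh_le y).trans_eq ?_
    rw [show u - v = 2 * y by rw [hy, hv]; ring, abs_mul, abs_two]
    ring_nf
  rw [jointForm_eq lam ε hε, ← hy, hahn, hahnGamma]
  simp only [norm_mul (_ : ℂ) (exp _), norm_mul _ (Complex.Gamma _), norm_mul _ (_ * _ : ℂ)]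
  rw [norm_exp_gtCartan, show (gam lam ε 0 + a + b).im = ε by simp]
  calc _ ≤ ‖cNorm ^ 2 / (2 * (Real.pi : ℂ) ^ 2)‖ * Real.exp ((x 1 - x 0) * ε)
        * (C₁ * (C₂ * Real.exp (-(decayRate * |lam 0 - lam 2 + a + b|))) * C₃)
        * (((C₄ * Real.exp (-(decayRate * |u - lam 0 - a|)))
            * (C₄ * Real.exp (-(decayRate * |v - lam 0 - a|)))
          * ((C₁ * Real.exp (-(decayRate * |v - lam 0|)))
            * (C₁ * Real.exp (-(decayRate * |u - lam 0|))))
          * ((C₅ * Real.exp (-(decayRate * |v - lam 1|)))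
            * (C₅ * Real.exp (-(decayRate * |u - lam 1|)))))
          * (2 / decayRate * Real.exp (11 / 4 * decayRate * |u - v|))) := by
        gcongr
    _ = _ := by
        rw [show decayRate * (11 / 4 * |u - v| - |lam 0 - lam 2 + a + b| - |u - lam 0 - a|
          - |v - lam 0 - a| - |u - lam 0| - |v - lam 0| - |u - lam 1| - |v - lam 1|)
          = 11 / 4 * decayRate * |u - v| + -(decayRate * |lam 0 - lam 2 + a + b|)
            + -(decayRate * |u - lam 0 - a|) + -(decayRate * |v - lam 0 - a|)
            + -(decayRate * |u - lam 0|) + -(decayRate * |v - lam 0|)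
            + -(decayRate * |u - lam 1|) + -(decayRate * |v - lam 1|) by ring,
          Real.exp_add, Real.exp_add, Real.exp_add, Real.exp_add, Real.exp_add, Real.exp_add,
          Real.exp_add]
        ring

/-- The new coordinates are the real part of τ₁₁ and both τ₂₁, τ₂₂ in place of s₂₁ and s₂₂. -/
lemma exists_norm_jointForm_comp_le (lam : Fin 3 → ℝ) {ε : ℝ} (hε : 0 < ε) (hε' : ε < 1 / 2)
    (x : Fin 3 → ℝ) : ∃ C : ℝ, 0 ≤ C ∧ ∀ a t u v : ℝ,
    ‖jointForm lam ε x a (t - (lam 0 + a)) (v + (u - lam 0 - lam 1 - a)) u‖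
      ≤ C * Real.exp (-(decayRate / 12 * (|a| + |t| + |u| + |v|))) := by
  obtain ⟨C, hC, h⟩ := exists_norm_jointForm_le lam hε hε' x
  refine ⟨C * Real.exp (decayRate / 12 * (2 * |lam 1| + |lam 2|)), by positivity,
    fun a t u v => ?_⟩
  refine (h a _ _ u v (by ring)).trans ?_
  rw [mul_assoc, ← Real.exp_add]
  refine mul_le_mul_of_nonneg_left (Real.exp_le_exp.2 ?_) hC
  rw [show lam 0 - lam 2 + a + (t - (lam 0 + a)) = t - lam 2 by ring]
  have i1 : |u - v| ≤ |u - lam 0 - a| + |v - lam 0 - a| := by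
    have := abs_sub (u - lam 0 - a) (v - lam 0 - a)
    rwa [show u - lam 0 - a - (v - lam 0 - a) = u - v by ring] at this
  have i2 : |u - v| ≤ |u - lam 0| + |v - lam 0| := by
    have := abs_sub (u - lam 0) (v - lam 0)
    rwa [show u - lam 0 - (v - lam 0) = u - v by ring] at this
  have i3 : |u - v| ≤ |u - lam 1| + |v - lam 1| := by
    have := abs_sub (u - lam 1) (v - lam 1)
    rwa [show u - lam 1 - (v - lam 1) = u - v by ring] at this
  have i4 : |a| ≤ |u - lam 0 - a| + |u - lam 0| := by
    have := abs_sub (u - lam 0) (u - lam 0 - a)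
    rw [show u - lam 0 - (u - lam 0 - a) = a by ring] at this
    linarith
  have i5 : ∀ w l : ℝ, |w| ≤ |w - l| + |l| := fun w l => by
    have := abs_add_le (w - l) l
    rwa [sub_add_cancel] at this
  have i6 := i5 u (lam 1)
  have i7 := i5 v (lam 1)
  have i8 := i5 t (lam 2)
  have := abs_nonneg (t - lam 2)
  have := abs_nonneg (v - lam 0)
  have := abs_nonneg (v - lam 0 - a)
  -- The six decaying terms form three pairs, each at least |u-v|; 11/12 of the pairs compensates
  -- 11/4 |u-v|. The twelfth left over controls |a|, |u| and |v|, and the term in t controls |t|.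
  have key := mul_le_mul_of_nonneg_left (show 11 / 4 * |u - v| - |t - lam 2| - |u - lam 0 - a|
    - |v - lam 0 - a| - |u - lam 0| - |v - lam 0| - |u - lam 1| - |v - lam 1|
    ≤ 1 / 12 * (2 * |lam 1| + |lam 2|) - 1 / 12 * (|a| + |t| + |u| + |v|) by linarith)
    decayRate_pos.le
  linarith

lemma continuous_jointForm_comp (lam : Fin 3 → ℝ) {ε : ℝ} (hε : 0 < ε) (hε' : ε < 1 / 2)
    (x : Fin 3 → ℝ) :
    Continuous fun p : ℝ × ℝ × ℝ × ℝ => jointForm lam ε x p.1 (p.2.1 - (lam 0 + p.1))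
      (p.2.2.2 + (p.2.2.1 - lam 0 - lam 1 - p.1)) p.2.2.1 :=
  (continuous_jointForm lam hε hε' x).comp (f := fun p : ℝ × ℝ × ℝ × ℝ =>
    (p.1, p.2.1 - (lam 0 + p.1), p.2.2.2 + (p.2.2.1 - lam 0 - lam 1 - p.1), p.2.2.1))
    (by fun_prop)

lemma integrable_jointForm_comp (lam : Fin 3 → ℝ) {ε : ℝ} (hε : 0 < ε) (hε' : ε < 1 / 2)
    (x : Fin 3 → ℝ) :
    Integrable fun p : ℝ × ℝ × ℝ × ℝ => jointForm lam ε x p.1 (p.2.1 - (lam 0 + p.1))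
      (p.2.2.2 + (p.2.2.1 - lam 0 - lam 1 - p.1)) p.2.2.1 := by
  obtain ⟨C, -, h⟩ := exists_norm_jointForm_comp_le lam hε hε' x
  have := decayRate_pos
  exact integrable_prod_prod_prod_of_norm_le_exp (continuous_jointForm_comp lam hε hε' x)
    (by positivity) h

lemma integrable_jointForm_comp_slice (lam : Fin 3 → ℝ) {ε : ℝ} (hε : 0 < ε) (hε' : ε < 1 / 2)
    (x : Fin 3 → ℝ) (a : ℝ) :
    Integrable fun p : ℝ × ℝ × ℝ => jointForm lam ε x a (p.1 - (lam 0 + a))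
      (p.2.2 + (p.2.1 - lam 0 - lam 1 - a)) p.2.1 := by
  obtain ⟨C, hC, h⟩ := exists_norm_jointForm_comp_le lam hε hε' x
  have := decayRate_pos
  refine integrable_prod_prod_of_norm_le_exp (C := C) (δ := decayRate / 12)
    ((continuous_jointForm_comp lam hε hε' x).comp (f := fun p : ℝ × ℝ × ℝ => (a, p))
      (by fun_prop)) (by positivity)
    fun t u v => (h a t u v).trans ?_
  gcongr
  linarith [abs_nonneg a]

lemma integrable_jointForm_comp_slice_slice (lam : Fin 3 → ℝ) {ε : ℝ} (hε : 0 < ε) (hε' : ε < 1 / 2)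
    (x : Fin 3 → ℝ) (a t : ℝ) :
    Integrable fun p : ℝ × ℝ => jointForm lam ε x a (t - (lam 0 + a))
      (p.2 + (p.1 - lam 0 - lam 1 - a)) p.1 := by
  obtain ⟨C, hC, h⟩ := exists_norm_jointForm_comp_le lam hε hε' x
  have := decayRate_pos
  refine integrable_prod_of_norm_le_exp (C := C) (δ := decayRate / 12)
    ((continuous_jointForm_comp lam hε hε' x).comp (f := fun p : ℝ × ℝ => (a, t, p))
      (by fun_prop)) (by positivity) fun u v => (h a t u v).trans ?_
  gcongr
  linarith [abs_nonneg a, abs_nonneg t]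

/-- Needed at fixed `a` and `b`, where the order of `d` and `u` is interchanged after the
translation to the coordinate s₂₂. -/
lemma integrable_jointForm_slice (lam : Fin 3 → ℝ) {ε : ℝ} (hε : 0 < ε) (hε' : ε < 1 / 2)
    (x : Fin 3 → ℝ) (a b : ℝ) :
    Integrable fun p : ℝ × ℝ => jointForm lam ε x a b p.1 p.2 := by
  obtain ⟨C, hC, h⟩ := exists_norm_jointForm_comp_le lam hε hε' x
  have hθ := decayRate_pos
  refine integrable_prod_of_norm_le_exp
    (C := C * Real.exp (decayRate / 24 * |lam 0 + lam 1 + a|)) (δ := decayRate / 24)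
    ((continuous_jointForm lam hε hε' x).comp (f := fun p : ℝ × ℝ => (a, b, p))
      (by fun_prop)) (by positivity) fun d u => ?_
  have := h a (b + (lam 0 + a)) u (d - (u - lam 0 - lam 1 - a))
  rw [add_sub_cancel_right, sub_add_cancel] at this
  refine this.trans ?_
  rw [mul_assoc, ← Real.exp_add]
  refine mul_le_mul_of_nonneg_left (Real.exp_le_exp.2 ?_) hC
  have i1 : |d| ≤ |d - (u - lam 0 - lam 1 - a)| + |u| + |lam 0 + lam 1 + a| := by
    have h1 := abs_add_le (d - (u - lam 0 - lam 1 - a)) u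
    have h2 := abs_sub (d - (u - lam 0 - lam 1 - a) + u) (lam 0 + lam 1 + a)
    rw [show d - (u - lam 0 - lam 1 - a) + u - (lam 0 + lam 1 + a) = d by ring] at h2
    linarith
  have h1 := abs_nonneg a
  have h2 := abs_nonneg (b + (lam 0 + a))
  have h3 := abs_nonneg (d - (u - lam 0 - lam 1 - a))
  have key := mul_le_mul_of_nonneg_left (show -(2 * (|a| + |b + (lam 0 + a)| + |u|
    + |d - (u - lam 0 - lam 1 - a)|)) ≤ |lam 0 + lam 1 + a| - (|d| + |u|) by linarith)
    (show 0 ≤ decayRate / 24 by positivity)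
  linarith

/-- One decaying Gamma for each of s₁₁, s₂₁, s₂₂ suffices: the other three are bounded on their
lines, and the exponential has constant modulus. -/
lemma integrable_ggPairInt (lam : Fin 3 → ℝ) {ε : ℝ} (hε : 0 < ε) (hε' : ε < 1 / 2)
    (x : Fin 3 → ℝ) :
    Integrable (ggPairInt (onReal (phiL lam ε)) (expGG lam ε x (onReal phiR))) := by
  have r1 : 0 < (I * (gamBar lam ε 0 - gamBar lam ε 1) + 1 / 2 : ℂ).re := by simp; linarith
  have r2 : 0 < (I * (gamBar lam ε 1 - gamBar lam ε 2) + 1 / 2 : ℂ).re := by simp; linarith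
  have r3 : 0 < (I * (gamBar lam ε 0 - gamBar lam ε 2) + 1 : ℂ).re := by simp; linarith
  have e1 : ∀ a : ℝ, I * (gamBar lam ε 0 - gamBar lam ε 1 + a) + 1 / 2
      = I * (gamBar lam ε 0 - gamBar lam ε 1) + 1 / 2 + I * a := fun a => by ring
  have e2 : ∀ d : ℝ, I * (gamBar lam ε 1 - gamBar lam ε 2 + d) + 1 / 2
      = I * (gamBar lam ε 1 - gamBar lam ε 2) + 1 / 2 + I * d := fun a => by ring
  have e3 : ∀ a b : ℝ, I * (gamBar lam ε 0 - gamBar lam ε 2 + a + b) + 1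
      = I * (gamBar lam ε 0 - gamBar lam ε 2) + 1 + I * ((a + b : ℝ) : ℂ) := fun a b => by
    push_cast; ring
  have e4 : ∀ a d : ℝ, 1 - I * (a : ℂ) - I * d = 1 - I * ((a + d : ℝ) : ℂ) := fun a d => by
    push_cast; ring
  have hf : ∀ p : ℝ × ℝ × ℝ,
      ggPairInt (onReal (phiL lam ε)) (expGG lam ε x (onReal phiR)) p
      = starRingEnd ℂ (cNorm
        * Complex.Gamma (I * (gamBar lam ε 0 - gamBar lam ε 1) + 1 / 2 + I * p.1)
        * Complex.Gamma (I * (gamBar lam ε 1 - gamBar lam ε 2) + 1 / 2 + I * p.2.2)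
        * Complex.Gamma (I * (gamBar lam ε 0 - gamBar lam ε 2) + 1 + I * ((p.1 + p.2.1 : ℝ) : ℂ)))
      * (exp (-∑ i, (x i : ℂ) * ggCartan lam ε i p.1 p.2.1 p.2.2)
        * (cNorm * Complex.Gamma (1 / 2 - I * p.2.1) * Complex.Gamma (1 / 2 - I * p.1)
          * Complex.Gamma (1 - I * ((p.1 + p.2.2 : ℝ) : ℂ)))) := fun p => by
    simp only [ggPairInt, onReal, expGG, phiL, phiR, e1, e2, e3, e4]
  obtain ⟨C₁, h₁, b₁⟩ := exists_norm_Gamma_add_le r1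
  obtain ⟨C₂, h₂, b₂⟩ := exists_norm_Gamma_add_le r2
  obtain ⟨C₃, h₃, b₃⟩ := exists_norm_Gamma_add_le r3
  obtain ⟨C₄, h₄, b₄⟩ := exists_norm_Gamma_sub_le (A := 1 / 2) (by simp)
  obtain ⟨C₅, h₅, b₅⟩ := exists_norm_Gamma_sub_le (A := 1) (by simp)
  have hθ := decayRate_pos
  have hone : ∀ y : ℝ, Real.exp (-(decayRate * |y|)) ≤ 1 := fun y =>
    Real.exp_le_one_iff.2 (by have := abs_nonneg y; nlinarith)
  have hW : ∀ a b d : ℝ, ‖exp (-∑ i, (x i : ℂ) * ggCartan lam ε i a b d)‖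
      = Real.exp ((x 1 - x 0) * ε) := fun a b d => by
    rw [norm_exp]
    congr 1
    simp [Fin.sum_univ_three, ggCartan]
    ring
  have b₃' := fun y => (b₃ y).trans (mul_le_of_le_one_right h₃.le (hone y))
  have b₄' := fun y => (b₄ y).trans (mul_le_of_le_one_right h₄.le (hone y))
  have b₅' := fun y => (b₅ y).trans (mul_le_of_le_one_right h₅.le (hone y))
  simp only [funext hf]
  refine integrable_prod_prod_of_norm_le_exp (δ := decayRate)
    (C := ‖cNorm‖ * C₁ * C₂ * C₃ * (Real.exp ((x 1 - x 0) * ε) * (‖cNorm‖ * C₄ * C₄ * C₅)))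
    (.mul (continuous_conj.comp (.mul (.mul (.mul continuous_const ?_) ?_) ?_))
      (.mul ?_ (.mul (.mul (.mul continuous_const ?_) ?_) ?_))) hθ fun a b d => ?_
  · exact continuous_Gamma_comp (by fun_prop) fun p => by simp; linarith
  · exact continuous_Gamma_comp (by fun_prop) fun p => by simp; linarith
  · exact continuous_Gamma_comp (by fun_prop) fun p => by simp; linarith
  · simp only [Fin.sum_univ_three, ggCartan]
    fun_prop
  · exact continuous_Gamma_comp (by fun_prop) fun p => by simp
  · exact continuous_Gamma_comp (by fun_prop) fun p => by simp
  · exact continuous_Gamma_comp (by fun_prop) fun p => by simp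
  · rw [norm_mul, RCLike.norm_conj]
    simp only [norm_mul, hW]
    calc _ ≤ ‖cNorm‖ * (C₁ * Real.exp (-(decayRate * |a|))) * (C₂ * Real.exp (-(decayRate * |d|)))
          * C₃ * (Real.exp ((x 1 - x 0) * ε) * (‖cNorm‖ * (C₄ * Real.exp (-(decayRate * |b|)))
            * C₄ * C₅)) := by
          gcongr
          · exact b₁ a
          · exact b₂ d
          · exact b₃' _
          · exact b₄ b
          · exact b₄' a
          · exact b₅' _
      _ = _ := by
          rw [show -(decayRate * (|a| + |b| + |d|)) = -(decayRate * |a|) + -(decayRate * |b|)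
            + -(decayRate * |d|) by ring, Real.exp_add, Real.exp_add]
          ring

/-- The integral over τ₂₁ is the case n = 0 of the dual Hahn evaluation, that is, `B_L†` applied to
`ψ̃_R`; the condition ϰ + ε < 1/2 is avoided because `B_R` is not involved. -/
lemma ggPairInt_eq (lam : Fin 3 → ℝ) {ε : ℝ} (hε : 0 < ε) (hε' : ε < 1 / 2)
    (x : Fin 3 → ℝ) (a b d : ℝ) :
    ggPairInt (onReal (phiL lam ε)) (expGG lam ε x (onReal phiR)) (a, b, d)
      = ∫ u : ℝ, jointForm lam ε x a b d u := by
  have h := (integrable_kerLdag_mul_psiRt lam ε ε hε hε' 0 a b d).2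
  simp only [gtBasis, ggBasis, rising_zero, mul_one] at h
  have hc : ∀ u : ℝ, exp (-∑ i, (x i : ℂ) * gtCartan lam ε i (gam lam ε 0 + a + b) u
      ((lam 0 + lam 1 + a + d - u : ℝ) : ℂ))
      = exp (-∑ i, (x i : ℂ) * ggCartan lam ε i a b d) := fun u => by
    push_cast
    simp only [gtCartan_eq_ggCartan]
  simp only [jointForm, hc]
  rw [integral_const_mul, integral_const_mul, h]
  rfl

/-- The conjugate of `𝓑_L φ̂_L = ψ̃_L`. -/
lemma integral_jointForm (lam : Fin 3 → ℝ) {ε : ℝ} (hε : 0 < ε) (hε' : ε < 1 / 2)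
    (x : Fin 3 → ℝ) (t u v : ℝ) :
    ∫ a : ℝ, jointForm lam ε x a (t - (lam 0 + a)) (v + (u - lam 0 - lam 1 - a)) u
      = 1 / 2 * gtForm lam ε x (t + ε * I) u v := by
  -- The first delta-function places `psiRt` on the line of height ε, the imaginary part of γ₁.
  have hT : ∀ a : ℝ, gam lam ε 0 + a + ((t - (lam 0 + a) : ℝ) : ℂ) = t + ε * I := fun a => by
    simp; ring
  have hv : ∀ a : ℝ, lam 0 + lam 1 + a + (v + (u - lam 0 - lam 1 - a)) - u = v := fun a => by ring
  have hBL : ∀ a : ℝ, BLint lam ε ε (phiL lam ε) t u v a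
      = kerL lam ε ε t u v a ((t - (lam 0 + a) : ℝ) : ℂ)
        * phiL lam ε a ((t - (lam 0 + a) : ℝ) : ℂ) ((v + (u - lam 0 - lam 1 - a) : ℝ) : ℂ) :=
    fun a => by
    have e1 : (t : ℂ) - I * ε - gamBar lam ε 0 - a = ((t - (lam 0 + a) : ℝ) : ℂ) := by
      simp; ring
    have e2 : (u : ℂ) + v - gamBar lam ε 0 - gamBar lam ε 1 - a
        = ((v + (u - lam 0 - lam 1 - a) : ℝ) : ℂ) := by
      simp; ring
    rw [BLint, cdelta, cdelta, e1, e2]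
  have hfun : ∀ a : ℝ, jointForm lam ε x a (t - (lam 0 + a)) (v + (u - lam 0 - lam 1 - a)) u
      = starRingEnd ℂ (BLint lam ε ε (phiL lam ε) t u v a)
        * (1 / 2 * (exp (-∑ i, (x i : ℂ) * gtCartan lam ε i (t + ε * I) u v)
          * psiRt lam ε (t + ε * I) u v)) := fun a => by
    rw [hBL, map_mul, conj_kerL, jointForm, hT, hv,
      show (t : ℂ) + ε * I + I * ε = t + 2 * I * ε by ring]
    ring
  simp only [hfun]
  have h := (integrable_BLint_phiL lam ε ε hε hε' hε t u v).2
  rw [BL] at h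
  rw [integral_mul_const, integral_conj, h, ← conj_psiLt_mul_psiRt,
    show starRingEnd ℂ ((t : ℂ) + ε * I) = t - I * ε by simp; ring]
  ring

/-- Fubini for `jointForm`: the Gelfand-Tsetlin line is moved up to height ε and the integral over
s₁₁ inserted. After exchanging the order, translations restore s₂₁ and s₂₂, and the inner integral
over τ₂₁ is evaluated. -/
theorem integral_gtForm_eq_ggPair (lam : Fin 3 → ℝ) {ε : ℝ} (hε : 0 < ε) (hε' : ε < 1 / 2)
    (x : Fin 3 → ℝ) :
    1 / 2 * ∫ p : ℝ × ℝ × ℝ, gtForm lam ε x p.1 p.2.1 p.2.2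
      = ggPair (onReal (phiL lam ε)) (expGG lam ε x (onReal phiR)) := by
  have hgg := integrable_ggPairInt lam hε hε' x
  have hJ := integrable_jointForm_comp lam hε hε' x
  calc 1 / 2 * ∫ p : ℝ × ℝ × ℝ, gtForm lam ε x p.1 p.2.1 p.2.2
      = ∫ p : ℝ × ℝ × ℝ, ∫ a : ℝ, jointForm lam ε x a (p.1 - (lam 0 + a))
          (p.2.2 + (p.2.1 - lam 0 - lam 1 - a)) p.2.1 := by
        simp only [integral_jointForm lam hε hε' x]
        rw [integral_const_mul, integral_gtForm_shift lam hε hε' x (by linarith)]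
    _ = ∫ a : ℝ, ∫ p : ℝ × ℝ × ℝ, jointForm lam ε x a (p.1 - (lam 0 + a))
          (p.2.2 + (p.2.1 - lam 0 - lam 1 - a)) p.2.1 := by
        rw [Measure.volume_eq_prod] at hJ
        exact (integral_integral_swap (f := fun (a : ℝ) (p : ℝ × ℝ × ℝ) =>
          jointForm lam ε x a (p.1 - (lam 0 + a))
          (p.2.2 + (p.2.1 - lam 0 - lam 1 - a)) p.2.1) hJ).symm
    _ = ∫ a : ℝ, ∫ t : ℝ, ∫ u : ℝ, ∫ v : ℝ, jointForm lam ε x a (t - (lam 0 + a))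
          (v + (u - lam 0 - lam 1 - a)) u := by
        refine integral_congr_ae (ae_of_all _ fun a => ?_)
        have h1 := integrable_jointForm_comp_slice lam hε hε' x a
        rw [Measure.volume_eq_prod] at h1
        simp only
        rw [Measure.volume_eq_prod, integral_prod _ h1]
        refine integral_congr_ae (ae_of_all _ fun t => ?_)
        have h2 := integrable_jointForm_comp_slice_slice lam hε hε' x a t
        rw [Measure.volume_eq_prod] at h2
        simp only
        rw [Measure.volume_eq_prod, integral_prod _ h2]
    _ = ∫ a : ℝ, ∫ b : ℝ, ∫ d : ℝ, ∫ u : ℝ, jointForm lam ε x a b d u := by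
        refine integral_congr_ae (ae_of_all _ fun a => ?_)
        simp only
        rw [integral_sub_right_eq_self (fun b : ℝ => ∫ u : ℝ, ∫ v : ℝ, jointForm lam ε x a b
          (v + (u - lam 0 - lam 1 - a)) u)]
        refine integral_congr_ae (ae_of_all _ fun b => ?_)
        have h1 := integrable_jointForm_slice lam hε hε' x a b
        rw [Measure.volume_eq_prod] at h1
        simp only
        rw [integral_integral_swap (f := fun d u : ℝ => jointForm lam ε x a b d u) h1]
        refine integral_congr_ae (ae_of_all _ fun u => ?_)
        exact integral_add_right_eq_self (fun d : ℝ => jointForm lam ε x a b d u) _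
    _ = ggPair (onReal (phiL lam ε)) (expGG lam ε x (onReal phiR)) := by
        rw [Measure.volume_eq_prod] at hgg
        rw [ggPair, Measure.volume_eq_prod, integral_prod _ hgg]
        refine integral_congr_ae ?_
        filter_upwards [hgg.prod_right_ae] with a ha
        rw [Measure.volume_eq_prod] at ha
        rw [Measure.volume_eq_prod, integral_prod _ ha]
        simp only [ggPairInt_eq lam hε hε' x]

end Gl3Whittaker

end

theorem theorem4p1 (lam : Fin 3 → ℝ) (ε ϰ : ℝ) (hε : 0 < ε) (hε' : ε < 1 / 2)
    (hϰ : 0 < ϰ) (hϰ' : ϰ < 1 / 2) :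
    -- `B_R` carries `φ̂_R` to the shifted `ψ̃_R`
    (ϰ + ε < 1 / 2 → ∀ t u v : ℝ,
      MeasureTheory.Integrable (Gl3Whittaker.BRint lam ε ϰ Gl3Whittaker.phiR t u v) ∧
      Gl3Whittaker.BR lam ε ϰ Gl3Whittaker.phiR t u v
        = Gl3Whittaker.psiRt lam ε (t - Complex.I * ϰ) u v) ∧
    -- `B_L` carries `φ̂_L` to the shifted `ψ̃_L`
    (∀ t u v : ℝ,
      MeasureTheory.Integrable
        (Gl3Whittaker.BLint lam ε ϰ (Gl3Whittaker.phiL lam ε) t u v) ∧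
      Gl3Whittaker.BL lam ε ϰ (Gl3Whittaker.phiL lam ε) t u v
        = Gl3Whittaker.psiLt (t - Complex.I * ϰ) u v) ∧
    -- `B_L†` maps the Gelfand-Tsetlin space to the Gauss-Givental space and intertwines
    (∀ f : Gl3Whittaker.Fn, Gl3Whittaker.GTSpace lam ε ϰ f →
      (∀ a b d : ℝ, MeasureTheory.Integrable
        (Gl3Whittaker.BLdagInt lam ε ϰ (Gl3Whittaker.mixed f) a b d)) ∧
      (∃ g : Gl3Whittaker.Fn, Gl3Whittaker.GGSpace lam ε g ∧
        Gl3Whittaker.RestrictsTo g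
          (Gl3Whittaker.BLdag lam ε ϰ (Gl3Whittaker.mixed f))) ∧
      (∀ g : Gl3Whittaker.Fn, Gl3Whittaker.GGSpace lam ε g →
        Gl3Whittaker.RestrictsTo g
          (Gl3Whittaker.BLdag lam ε ϰ (Gl3Whittaker.mixed f)) →
        ∀ i j : Fin 3, Gl3Whittaker.RestrictsTo (Gl3Whittaker.ggOp lam ε i j g)
          (Gl3Whittaker.BLdag lam ε ϰ
            (Gl3Whittaker.mixed (Gl3Whittaker.gtOpShift lam ε ϰ i j f))))) ∧
    -- `(B_L† ∘ B_R) φ̂_R = φ̂_R`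
    (ϰ + ε < 1 / 2 → ∀ a b d : ℝ,
      MeasureTheory.Integrable
        (Gl3Whittaker.BLdagInt lam ε ϰ
          (Gl3Whittaker.ext1 (Gl3Whittaker.BR lam ε ϰ Gl3Whittaker.phiR)) a b d) ∧
      Gl3Whittaker.BLdag lam ε ϰ
        (Gl3Whittaker.ext1 (Gl3Whittaker.BR lam ε ϰ Gl3Whittaker.phiR)) a b d
        = Gl3Whittaker.phiR a b d) ∧
    -- the two matrix elements are transformed into each other by `B_L` and `B_R`
    (ϰ + ε < 1 / 2 → ∀ x : Fin 3 → ℝ,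
      MeasureTheory.Integrable
        (Gl3Whittaker.gtPairInt ϰ
          (Gl3Whittaker.ext1 (Gl3Whittaker.BL lam ε ϰ (Gl3Whittaker.phiL lam ε)))
          (Gl3Whittaker.expGTShift lam ε ϰ x
            (Gl3Whittaker.ext1 (Gl3Whittaker.BR lam ε ϰ Gl3Whittaker.phiR)))) ∧
      Gl3Whittaker.gtMatrixElement lam ε x
        = Gl3Whittaker.expRho x * Gl3Whittaker.gtPair ϰ
            (Gl3Whittaker.ext1 (Gl3Whittaker.BL lam ε ϰ (Gl3Whittaker.phiL lam ε)))
            (Gl3Whittaker.expGTShift lam ε ϰ x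
              (Gl3Whittaker.ext1 (Gl3Whittaker.BR lam ε ϰ Gl3Whittaker.phiR))) ∧
      Gl3Whittaker.gtPair ϰ
            (Gl3Whittaker.ext1 (Gl3Whittaker.BL lam ε ϰ (Gl3Whittaker.phiL lam ε)))
            (Gl3Whittaker.expGTShift lam ε ϰ x
              (Gl3Whittaker.ext1 (Gl3Whittaker.BR lam ε ϰ Gl3Whittaker.phiR)))
        = Gl3Whittaker.ggPair (Gl3Whittaker.onReal (Gl3Whittaker.phiL lam ε))
            (Gl3Whittaker.BLdag lam ε ϰ
              (Gl3Whittaker.expGTShift lam ε ϰ x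
                (Gl3Whittaker.ext1 (Gl3Whittaker.BR lam ε ϰ Gl3Whittaker.phiR)))) ∧
      Gl3Whittaker.BLdag lam ε ϰ
          (Gl3Whittaker.expGTShift lam ε ϰ x
            (Gl3Whittaker.ext1 (Gl3Whittaker.BR lam ε ϰ Gl3Whittaker.phiR)))
        = Gl3Whittaker.expGG lam ε x
            (Gl3Whittaker.BLdag lam ε ϰ
              (Gl3Whittaker.ext1 (Gl3Whittaker.BR lam ε ϰ Gl3Whittaker.phiR)))) ∧
    -- the two matrix elements coincide
    (∀ x : Fin 3 → ℝ,
      MeasureTheory.Integrable (Gl3Whittaker.gtMatInt lam ε x) ∧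
      MeasureTheory.Integrable
        (Gl3Whittaker.ggPairInt (Gl3Whittaker.onReal (Gl3Whittaker.phiL lam ε))
          (Gl3Whittaker.expGG lam ε x (Gl3Whittaker.onReal Gl3Whittaker.phiR))) ∧
      Gl3Whittaker.gtMatrixElement lam ε x = Gl3Whittaker.ggMatrixElement lam ε x) := by
  refine ⟨fun h t u v => Gl3Whittaker.integrable_BRint_phiR lam ε ϰ hε hϰ h t u v,
    fun t u v => Gl3Whittaker.integrable_BLint_phiL lam ε ϰ hε hε' hϰ t u v,
    fun f hf => Gl3Whittaker.BLdag_intertwines lam ε ϰ hε hε' f hf,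
    fun h a b d => Gl3Whittaker.integrable_BLdagInt_BR lam ε ϰ hε hϰ h a b d,
    fun h x => ⟨?_, ?_, ?_, Gl3Whittaker.BLdag_expGTShift lam ε ϰ x _⟩,
    fun x => ⟨?_, Gl3Whittaker.integrable_ggPairInt lam hε hε' x, ?_⟩⟩
  · rw [funext (Gl3Whittaker.gtPairInt_eq lam ε ϰ hε hϰ h x)]
    exact Gl3Whittaker.integrable_gtForm lam hε hε' x (by linarith)
  · rw [Gl3Whittaker.gtMatrixElement, Gl3Whittaker.gtPair,
      funext (Gl3Whittaker.gtPairInt_eq lam ε ϰ hε hϰ h x),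
      funext (Gl3Whittaker.gtMatInt_eq lam ε x),
      Gl3Whittaker.integral_gtForm_shift lam hε hε' x (by linarith)]
  -- The adjoint relation is not proved for the given ϰ directly: both sides equal quantities
  -- independent of ϰ, the left by a contour shift and the right because `B_L† B_R` fixes `φ̂_R`.
  -- They are compared through the joint integral with ϰ = ε.
  · have hB : Gl3Whittaker.BLdag lam ε ϰ
        (Gl3Whittaker.ext1 (Gl3Whittaker.BR lam ε ϰ Gl3Whittaker.phiR))
        = Gl3Whittaker.onReal Gl3Whittaker.phiR := by
      funext a b d
      exact (Gl3Whittaker.integrable_BLdagInt_BR lam ε ϰ hε hϰ h a b d).2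
    rw [Gl3Whittaker.BLdag_expGTShift, hB, Gl3Whittaker.gtPair,
      funext (Gl3Whittaker.gtPairInt_eq lam ε ϰ hε hϰ h x),
      Gl3Whittaker.integral_gtForm_shift lam hε hε' x (by linarith),
      Gl3Whittaker.integral_gtForm_eq_ggPair lam hε hε' x]
  · rw [funext (Gl3Whittaker.gtMatInt_eq lam ε x)]
    simpa using Gl3Whittaker.integrable_gtForm lam hε hε' x (η := 0) (by norm_num)
  · rw [Gl3Whittaker.gtMatrixElement, Gl3Whittaker.ggMatrixElement,
      funext (Gl3Whittaker.gtMatInt_eq lam ε x),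
      Gl3Whittaker.integral_gtForm_eq_ggPair lam hε hε' x]
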